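/- **Theorem (second variation of the $p$-energy).** Let $(M,F)$ be an $n$-dimensional Finsler manifold: $M$ is a $C^\infty$ manifold and $F:TM\to\mathbb R$ is continuous, $C^\infty$ on $\{y\neq 0\}$, satisfies $F(x,y)>0$ for $y\ne0$ and $F(x,\lambda y)=|\lambda|F(x,y)$ for $\lambda\in\mathbb R$, and $g_{ij}(x,y)=\frac12\frac{\partial^2F^2}{\partial y^i\partial y^j}$ is positive definite for $y\neq0$. In induced coordinates put $$\Gamma^i_{jk}=\tfrac12g^{im}\Big(\tfrac{\partial g_{mk}}{\partial x^j}+\tfrac{\partial g_{jm}}{\partial x^k}-\tfrac{\partial g_{jk}}{\partial x^m}\Big),\quad N^i_j=\tfrac12\tfrac{\partial}{\partial y^j}\big(\Gamma^i_{kl}y^ky^l\big),\quad \tfrac{\delta}{\delta x^k}=\tfrac{\partial}{\partial x^k}-N^l_k\tfrac{\partial}{\partial y^l},$$ $$L^i_{jk}=\tfrac12g^{im}\Big(\tfrac{\delta g_{mk}}{\delta x^j}+\tfrac{\delta g_{jm}}{\delta x^k}-\tfrac{\delta g_{jk}}{\delta x^m}\Big),\quad C^i_{jk}=\tfrac12g^{im}\Big(\tfrac{\partial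 g_{mk}}{\partial y^j}+\tfrac{\partial g_{jm}}{\partial y^k}-\tfrac{\partial g_{jk}}{\partial y^m}\Big),$$ $$R^i_{jk}=\tfrac{\delta N^i_j}{\delta x^k}-\tfrac{\delta N^i_k}{\delta x^j},\qquad R^i_{hjk}=\tfrac{\delta L^i_{hj}}{\delta x^k}-\tfrac{\delta L^i_{hk}}{\delta x^j}+L^s_{hj}L^i_{sk}-L^s_{hk}L^i_{sj}+C^i_{hs}R^s_{jk}$$ (Cartan connection and its $h$-curvature). Along a regular curve $c$ put $g(X,Y)=g_{ij}(c,\dot c)X^iY^j$, $\|X\|=\sqrt{g(X,X)}$, $$\Big(\tfrac{\nabla X}{dt}\Big)^i=\tfrac{dX^i}{dt}+X^m\big[L^i_{mk}(c,\dot c)\,\dot c^k+C^i_{mk}(c,\dot c)\,(\ddot c^k+N^k_l(c,\dot c)\,\dot c^l)\big],$$ $R^2(X,\dot c)\dot c=R^l_{ijk}(c,\dot c)\,\dot c^i\dot c^jX^k\frac{\partial}{\partial x^l}$ and $R^2(X,\dot c,Y,\dot c)=g(R^2(Y,\dot c)\dot c,X)$. A geodesic is a smooth regular curve with $\nabla\dot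 c/dt=0$. Let $x_0,x_1\in M$, let $\Omega$ be the set of piecewise $C^\infty$ regular curves $c:[0,1]\to M$ with $c(0)=x_0$, $c(1)=x_1$, let $T_c\Omega$ be the space of continuous, piecewise $C^\infty$ vector fields along $c$ that vanish at $0$ and $1$, and for $p\in\mathbb R\setminus\{0\}$ let $E_p(c)=\int_0^1 g(\dot c,\dot c)^{p/2}dt$. Let $c\in\Omega$ be a geodesic with constant speed $\|\dot c\|=v$, and let $(c_{s_1s_2})_{s_1,s_2\in(-\epsilon,\epsilon)}\subset\Omega$ be a variation of $c=c_{00}$ such that for finitely many break points in $(0,1)$ the map $(s_1,s_2,t)\mapsto c_{s_1s_2}(t)$ is $C^\infty$ on each strip $(-\epsilon,\epsilon)^2\times[a,b]$ where $[a,b]\subset[0,1]$ has no break point in its interior. Put $X=\frac{\partial c_{s_1s_2}}{\partial s_1}\big|_{(0,0)}$ and $Y=\frac{\partial c_{s_1s_2}}{\partial s_2}\big|_{(0,0)}$. Then $X,Y\in T_c\Omega$, the derivative $I_p(X,Y)=\frac{\partial^2E_p(c_{s_1s_2})}{\partial s_1\partial s_2}(0,0)$ exists, and $$\frac{I_p(X,Y)}{p\,v^{p-4}}=-\sum_t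 g\Big(Y,\,v^2\Delta_t\big(\tfrac{\nabla X}{dt}\big)+(p-2)\,g\big(\Delta_t\big(\tfrac{\nabla X}{dt}\big),\dot c\big)\dot c\Big)-\int_0^1 g\big(Y,\,v^2J+(p-2)\,g(J,\dot c)\,\dot c\big)\,dt,$$ where $J=\frac{\nabla}{dt}\frac{\nabla X}{dt}+R^2(X,\dot c)\dot c$, the sum runs over the break points $t$, and $\Delta_t\big(\frac{\nabla X}{dt}\big)=\big(\frac{\nabla X}{dt}\big)_{t^+}-\big(\frac{\nabla X}{dt}\big)_{t^-}$. Moreover $R^2(X,\dot c)\dot c=R^l_{jk}(c,\dot c)\,\dot c^jX^k\frac{\partial}{\partial x^l}$, and $$I_p(X,Y)=p\,v^{p-4}\int_0^1\Big\{v^2\Big[g\big(\tfrac{\nabla X}{dt},\tfrac{\nabla Y}{dt}\big)-R^2(X,\dot c,Y,\dot c)\Big]+(p-2)\,g\big(\dot c,\tfrac{\nabla X}{dt}\big)g\big(\dot c,\tfrac{\nabla Y}{dt}\big)\Big\}dt,$$ all integrands being integrable. Finally $R^2(U,\dot c,W,\dot c)=R^2(W,\dot c,U,\dot c)$ for all vectors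 $U,W$ at points of $c$, and the right-hand side of the last formula is symmetric in $X,Y\in T_c\Omega$. -/

import Mathlib

open Set Filter Topology MeasureTheory
open scoped Manifold ContDiff

noncomputable section

namespace FinslerPEnergy

/-! ### Finsler geometry in one coordinate system

`f x y` is a fundamental function in the induced coordinates `(xⁱ, yⁱ)` of the tangent bundle. -/

section Coordinates

variable {n : ℕ}

/-- Partial derivative `∂h/∂xᵏ`. -/
def dX (k : Fin n) (h : EuclideanSpace ℝ (Fin n) → EuclideanSpace ℝ (Fin n) → ℝ)
    (x y : EuclideanSpace ℝ (Fin n)) : ℝ :=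
  fderiv ℝ (fun x' => h x' y) x (EuclideanSpace.single k 1)

/-- Partial derivative `∂h/∂yᵏ`. -/
def dY (k : Fin n) (h : EuclideanSpace ℝ (Fin n) → EuclideanSpace ℝ (Fin n) → ℝ)
    (x y : EuclideanSpace ℝ (Fin n)) : ℝ :=
  fderiv ℝ (fun y' => h x y') y (EuclideanSpace.single k 1)

/-- Fundamental tensor `g_{ij} = ½ ∂²f²/∂yⁱ∂yʲ`. -/
def gLow (f : EuclideanSpace ℝ (Fin n) → EuclideanSpace ℝ (Fin n) → ℝ)
    (i j : Fin n) (x y : EuclideanSpace ℝ (Fin n)) : ℝ :=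
  (1 / 2) * dY i (dY j (fun x y => f x y ^ 2)) x y

/-- Inverse matrix `g^{ij}`. -/
def gUp (f : EuclideanSpace ℝ (Fin n) → EuclideanSpace ℝ (Fin n) → ℝ)
    (i j : Fin n) (x y : EuclideanSpace ℝ (Fin n)) : ℝ :=
  (Matrix.of fun a b => gLow f a b x y)⁻¹ i j

/-- Formal Christoffel symbols `Γⁱ_{jk} = ½ g^{im}(∂g_{mk}/∂xʲ + ∂g_{jm}/∂xᵏ - ∂g_{jk}/∂xᵐ)`. -/
def christoffel (f : EuclideanSpace ℝ (Fin n) → EuclideanSpace ℝ (Fin n) → ℝ)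
    (i j k : Fin n) (x y : EuclideanSpace ℝ (Fin n)) : ℝ :=
  (1 / 2) * ∑ m, gUp f i m x y *
    (dX j (gLow f m k) x y + dX k (gLow f j m) x y - dX m (gLow f j k) x y)

/-- Nonlinear connection `Nⁱ_j = ½ ∂(Γⁱ_{kl} yᵏ yˡ)/∂yʲ`. -/
def nonlin (f : EuclideanSpace ℝ (Fin n) → EuclideanSpace ℝ (Fin n) → ℝ)
    (i j : Fin n) (x y : EuclideanSpace ℝ (Fin n)) : ℝ :=
  (1 / 2) * dY j (fun x y => ∑ k, ∑ l, christoffel f i k l x y * y k * y l) x y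

/-- Horizontal derivative `δh/δxᵏ = ∂h/∂xᵏ - Nˡ_k ∂h/∂yˡ`. -/
def dH (f : EuclideanSpace ℝ (Fin n) → EuclideanSpace ℝ (Fin n) → ℝ)
    (k : Fin n) (h : EuclideanSpace ℝ (Fin n) → EuclideanSpace ℝ (Fin n) → ℝ)
    (x y : EuclideanSpace ℝ (Fin n)) : ℝ :=
  dX k h x y - ∑ l, nonlin f l k x y * dY l h x y

/-- Horizontal coefficients `Lⁱ_{jk} = ½ g^{im}(δg_{mk}/δxʲ + δg_{jm}/δxᵏ - δg_{jk}/δxᵐ)`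
of the Cartan connection. -/
def cartanL (f : EuclideanSpace ℝ (Fin n) → EuclideanSpace ℝ (Fin n) → ℝ)
    (i j k : Fin n) (x y : EuclideanSpace ℝ (Fin n)) : ℝ :=
  (1 / 2) * ∑ m, gUp f i m x y *
    (dH f j (gLow f m k) x y + dH f k (gLow f j m) x y - dH f m (gLow f j k) x y)

/-- Vertical coefficients `Cⁱ_{jk} = ½ g^{im}(∂g_{mk}/∂yʲ + ∂g_{jm}/∂yᵏ - ∂g_{jk}/∂yᵐ)`
of the Cartan connection. -/
def cartanC (f : EuclideanSpace ℝ (Fin n) → EuclideanSpace ℝ (Fin n) → ℝ)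
    (i j k : Fin n) (x y : EuclideanSpace ℝ (Fin n)) : ℝ :=
  (1 / 2) * ∑ m, gUp f i m x y *
    (dY j (gLow f m k) x y + dY k (gLow f j m) x y - dY m (gLow f j k) x y)

/-- `Rⁱ_{jk} = δNⁱ_j/δxᵏ - δNⁱ_k/δxʲ`. -/
def nonlinCurv (f : EuclideanSpace ℝ (Fin n) → EuclideanSpace ℝ (Fin n) → ℝ)
    (i j k : Fin n) (x y : EuclideanSpace ℝ (Fin n)) : ℝ :=
  dH f k (nonlin f i j) x y - dH f j (nonlin f i k) x y

/-- The `h`-curvature of the Cartan connection,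
`Rⁱ_{hjk} = δLⁱ_{hj}/δxᵏ - δLⁱ_{hk}/δxʲ + Lˢ_{hj}Lⁱ_{sk} - Lˢ_{hk}Lⁱ_{sj} + Cⁱ_{hs}Rˢ_{jk}`. -/
def hCurv (f : EuclideanSpace ℝ (Fin n) → EuclideanSpace ℝ (Fin n) → ℝ)
    (i h j k : Fin n) (x y : EuclideanSpace ℝ (Fin n)) : ℝ :=
  dH f k (cartanL f i h j) x y - dH f j (cartanL f i h k) x y
    + ∑ s, (cartanL f s h j x y * cartanL f i s k x y - cartanL f s h k x y * cartanL f i s j x y)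
    + ∑ s, cartanC f i h s x y * nonlinCurv f s j k x y

end Coordinates

/-! ### Finsler manifolds and vector fields along curves -/

section Manifold

variable {n : ℕ} {M : Type*} [TopologicalSpace M] [ChartedSpace (EuclideanSpace ℝ (Fin n)) M]
  [IsManifold (𝓡 n) ∞ M]

/-- Components `vⁱ` of `v = vⁱ ∂/∂xⁱ ∈ T_xM` in the chart around `α`. -/
def comps (α x : M) (v : TangentSpace (𝓡 n) x) : EuclideanSpace ℝ (Fin n) :=
  (trivializationAt (EuclideanSpace ℝ (Fin n)) (TangentSpace (𝓡 n)) α).continuousLinearMapAt ℝ x v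

/-- The vector `wⁱ ∂/∂xⁱ ∈ T_xM` in the chart around `α`. -/
def ofComps (α x : M) (w : EuclideanSpace ℝ (Fin n)) : TangentSpace (𝓡 n) x :=
  (trivializationAt (EuclideanSpace ℝ (Fin n)) (TangentSpace (𝓡 n)) α).symmL ℝ x w

/-- `F` in the coordinates `(xⁱ, yⁱ)` induced on the tangent bundle by the chart around `α`. -/
def localF (F : TangentBundle (𝓡 n) M → ℝ) (α : M) (x y : EuclideanSpace ℝ (Fin n)) : ℝ :=
  F ⟨(extChartAt (𝓡 n) α).symm x, ofComps α ((extChartAt (𝓡 n) α).symm x) y⟩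

/-- `F` is a (reversible) Finsler fundamental function on `M`. -/
structure IsFinsler (F : TangentBundle (𝓡 n) M → ℝ) : Prop where
  pos : ∀ (x : M) (y : TangentSpace (𝓡 n) x), y ≠ 0 → 0 < F ⟨x, y⟩
  homogeneous : ∀ (x : M) (r : ℝ) (y : TangentSpace (𝓡 n) x), F ⟨x, r • y⟩ = |r| * F ⟨x, y⟩
  posDef : ∀ (α : M), ∀ x ∈ (extChartAt (𝓡 n) α).target, ∀ y : EuclideanSpace ℝ (Fin n), y ≠ 0 →
    (Matrix.of fun i j => gLow (localF F α) i j x y).PosDef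
  smooth : ContMDiffOn (𝓡 n).tangent 𝓘(ℝ, ℝ) ∞ F {w | w.2 ≠ 0}
  continuous : Continuous F

/-- The velocity `ċ(t)`, derivatives being taken within the interval `S`. -/
def velocity (c : ℝ → M) (S : Set ℝ) (t : ℝ) : TangentSpace (𝓡 n) (c t) :=
  mfderivWithin 𝓘(ℝ, ℝ) (𝓡 n) c S t (1 : ℝ)

/-- The scalar product `g(U, W)(c(t)) = g_{ij}(c(t), ċ(t)) Uⁱ Wʲ` along `c : [0,1] → M`. -/
def gAlong (F : TangentBundle (𝓡 n) M → ℝ) (c : ℝ → M) (t : ℝ)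
    (U W : TangentSpace (𝓡 n) (c t)) : ℝ :=
  ∑ i, ∑ j, gLow (localF F (c t)) i j (extChartAt (𝓡 n) (c t) (c t))
      (comps (c t) (c t) (velocity c (Icc 0 1) t))
    * comps (c t) (c t) U i * comps (c t) (c t) W j

/-- The covariant derivative along `c`,
`(∇X/dt)ⁱ = dXⁱ/dt + Xᵐ [Lⁱ_{mk}(c,ċ) ċᵏ + Cⁱ_{mk}(c,ċ) (c̈ᵏ + Nᵏ_l(c,ċ) ċˡ)]`,
computed at `t` in the chart around `c t`, with derivatives in `t` taken within the interval `S`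
(one-sided at the end points of `S`). -/
def covDeriv (F : TangentBundle (𝓡 n) M → ℝ) (c : ℝ → M) (S : Set ℝ)
    (X : ∀ t : ℝ, TangentSpace (𝓡 n) (c t)) (t : ℝ) : TangentSpace (𝓡 n) (c t) :=
  let f := localF F (c t)
  let x := extChartAt (𝓡 n) (c t) (c t)
  let X' : ℝ → EuclideanSpace ℝ (Fin n) := fun s => comps (c t) (c s) (X s)
  let V : ℝ → EuclideanSpace ℝ (Fin n) := fun s => comps (c t) (c s) (velocity c S s)
  ofComps (c t) (c t) (WithLp.toLp 2 fun i =>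
    derivWithin X' S t i + ∑ m, X' t m * ∑ k,
      (cartanL f i m k x (V t) * V t k
        + cartanC f i m k x (V t) * (derivWithin V S t k + ∑ l, nonlin f k l x (V t) * V t l)))

/-- `∇X/dt` for a curve `c : [0,1] → M`. -/
def nabla (F : TangentBundle (𝓡 n) M → ℝ) (c : ℝ → M)
    (X : ∀ t : ℝ, TangentSpace (𝓡 n) (c t)) : ∀ t : ℝ, TangentSpace (𝓡 n) (c t) :=
  covDeriv F c (Icc 0 1) X

/-- The jump `Δ_t(∇X/dt) = (∇X/dt)_{t⁺} - (∇X/dt)_{t⁻}`, as the difference of the one-sided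
covariant derivatives. -/
def jumpNabla (F : TangentBundle (𝓡 n) M → ℝ) (c : ℝ → M)
    (X : ∀ t : ℝ, TangentSpace (𝓡 n) (c t)) (t : ℝ) : TangentSpace (𝓡 n) (c t) :=
  covDeriv F c (Icc t 1) X t - covDeriv F c (Icc 0 t) X t

/-- `R²(W, ċ)ċ = Rˡ_{ijk}(c,ċ) ċⁱ ċʲ Wᵏ ∂/∂xˡ`, with the `h`-curvature. -/
def R2 (F : TangentBundle (𝓡 n) M → ℝ) (c : ℝ → M) (t : ℝ)
    (W : TangentSpace (𝓡 n) (c t)) : TangentSpace (𝓡 n) (c t) :=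
  let x := extChartAt (𝓡 n) (c t) (c t)
  let V := comps (c t) (c t) (velocity c (Icc 0 1) t)
  ofComps (c t) (c t) (WithLp.toLp 2 fun l => ∑ i, ∑ j, ∑ k,
    hCurv (localF F (c t)) l i j k x V * V i * V j * comps (c t) (c t) W k)

/-- `Rˡ_{jk}(c,ċ) ċʲ Wᵏ ∂/∂xˡ`. -/
def R2nonlin (F : TangentBundle (𝓡 n) M → ℝ) (c : ℝ → M) (t : ℝ)
    (W : TangentSpace (𝓡 n) (c t)) : TangentSpace (𝓡 n) (c t) :=
  let x := extChartAt (𝓡 n) (c t) (c t)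
  let V := comps (c t) (c t) (velocity c (Icc 0 1) t)
  ofComps (c t) (c t) (WithLp.toLp 2 fun l => ∑ j, ∑ k,
    nonlinCurv (localF F (c t)) l j k x V * V j * comps (c t) (c t) W k)

/-- `R²(U, ċ, W, ċ) = g(R²(W, ċ)ċ, U)`. -/
def R2form (F : TangentBundle (𝓡 n) M → ℝ) (c : ℝ → M) (t : ℝ)
    (U W : TangentSpace (𝓡 n) (c t)) : ℝ :=
  gAlong F c t (R2 F c t W) U

/-! ### The path space, its tangent spaces, variations and the `p`-energy -/

/-- `[a,b]` is a nondegenerate subinterval of `[0,1]` without points of `P` in its interior. -/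
def IsPiece (P : Finset ℝ) (a b : ℝ) : Prop :=
  0 ≤ a ∧ a < b ∧ b ≤ 1 ∧ ∀ t ∈ P, t ∉ Ioo a b

/-- `Ω`: the piecewise smooth regular curves `[0,1] → M` from `x₀` to `x₁`. -/
def PathSpace (n : ℕ) {M : Type*} [TopologicalSpace M]
    [ChartedSpace (EuclideanSpace ℝ (Fin n)) M] (x₀ x₁ : M) : Set (ℝ → M) :=
  {c | c 0 = x₀ ∧ c 1 = x₁ ∧ ∃ P : Finset ℝ, ∀ a b : ℝ, IsPiece P a b →
    ContMDiffOn 𝓘(ℝ, ℝ) (𝓡 n) ∞ c (Icc a b) ∧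
    ∀ t ∈ Icc a b, velocity (n := n) c (Icc a b) t ≠ 0}

/-- `T_cΩ`: the continuous, piecewise smooth vector fields along `c` vanishing at `0` and `1`
(continuity holds since adjacent closed pieces share their common end point). -/
def TangentPathSpace (n : ℕ) {M : Type*} [TopologicalSpace M]
    [ChartedSpace (EuclideanSpace ℝ (Fin n)) M] [IsManifold (𝓡 n) ∞ M] (c : ℝ → M) :
    Set (∀ t : ℝ, TangentSpace (𝓡 n) (c t)) :=
  {X | X 0 = 0 ∧ X 1 = 0 ∧ ∃ P : Finset ℝ, ∀ a b : ℝ, IsPiece P a b →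
    ContMDiffOn 𝓘(ℝ, ℝ) (𝓡 n).tangent ∞
      (fun t => (⟨c t, X t⟩ : TangentBundle (𝓡 n) M)) (Icc a b)}

/-- `c : [0,1] → M` is a smooth regular curve with `∇ċ/dt = 0`. -/
structure IsGeodesic (F : TangentBundle (𝓡 n) M → ℝ) (c : ℝ → M) : Prop where
  smooth : ContMDiffOn 𝓘(ℝ, ℝ) (𝓡 n) ∞ c (Icc 0 1)
  regular : ∀ t ∈ Icc (0 : ℝ) 1, velocity (n := n) c (Icc 0 1) t ≠ 0
  nabla_velocity : ∀ t ∈ Icc (0 : ℝ) 1, nabla F c (velocity c (Icc 0 1)) t = 0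

/-- `E_p(c) = ∫₀¹ g(ċ, ċ)^{p/2} dt`. -/
def pEnergy (F : TangentBundle (𝓡 n) M → ℝ) (p : ℝ) (c : ℝ → M) : ℝ :=
  ∫ t in (0 : ℝ)..1,
    gAlong F c t (velocity c (Icc 0 1) t) (velocity c (Icc 0 1) t) ^ (p / 2)

/-- `C s₁ s₂`, `s₁, s₂ ∈ (-ε, ε)`, is a two-parameter variation in `Ω` of the curve `C 0 0`:
a family of curves in `Ω`, smooth on each strip `(-ε, ε)² × [a, b]` between the break
points `P ⊂ (0, 1)`. -/
structure IsVariation (n : ℕ) {M : Type*} [TopologicalSpace M]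
    [ChartedSpace (EuclideanSpace ℝ (Fin n)) M]
    (x₀ x₁ : M) (ε : ℝ) (P : Finset ℝ) (C : ℝ → ℝ → ℝ → M) : Prop where
  eps_pos : 0 < ε
  breaks : ∀ t ∈ P, t ∈ Ioo (0 : ℝ) 1
  mem : ∀ s₁ ∈ Ioo (-ε) ε, ∀ s₂ ∈ Ioo (-ε) ε, C s₁ s₂ ∈ PathSpace n x₀ x₁
  smooth : ∀ a b : ℝ, IsPiece P a b →
    ContMDiffOn 𝓘(ℝ, ℝ × ℝ × ℝ) (𝓡 n) ∞ (fun q : ℝ × ℝ × ℝ => C q.1 q.2.1 q.2.2)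
      (Ioo (-ε) ε ×ˢ Ioo (-ε) ε ×ˢ Icc a b)

/-- `X(t) = ∂C/∂s₁ (0, 0, t)`. -/
def fieldX (C : ℝ → ℝ → ℝ → M) (t : ℝ) : TangentSpace (𝓡 n) (C 0 0 t) :=
  mfderiv 𝓘(ℝ, ℝ) (𝓡 n) (fun s => C s 0 t) 0 (1 : ℝ)

/-- `Y(t) = ∂C/∂s₂ (0, 0, t)`. -/
def fieldY (C : ℝ → ℝ → ℝ → M) (t : ℝ) : TangentSpace (𝓡 n) (C 0 0 t) :=
  mfderiv 𝓘(ℝ, ℝ) (𝓡 n) (fun s => C 0 s t) 0 (1 : ℝ)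

/-- The mixed partial derivative `∂²f/∂s₁∂s₂ (0, 0)` exists and equals `L`. -/
def HasMixedPartialAtZero (f : ℝ → ℝ → ℝ) (L : ℝ) : Prop :=
  ∃ D : ℝ → ℝ, (∀ᶠ s₁ in 𝓝 (0 : ℝ), HasDerivAt (fun s₂ => f s₁ s₂) (D s₁) 0) ∧ HasDerivAt D L 0

/-- `A ↦ v² A + (p - 2) g(A, ċ) ċ`. -/
def weighted (F : TangentBundle (𝓡 n) M → ℝ) (p v : ℝ) (c : ℝ → M) (t : ℝ)
    (A : TangentSpace (𝓡 n) (c t)) : TangentSpace (𝓡 n) (c t) :=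
  v ^ 2 • A + ((p - 2) * gAlong F c t A (velocity c (Icc 0 1) t)) • velocity c (Icc 0 1) t

/-- `g(Y, v² J + (p - 2) g(J, ċ) ċ)` with `J = ∇²X/dt² + R²(X, ċ)ċ`. -/
def jacobiIntegrand (F : TangentBundle (𝓡 n) M → ℝ) (p v : ℝ) (c : ℝ → M)
    (X Y : ∀ t : ℝ, TangentSpace (𝓡 n) (c t)) (t : ℝ) : ℝ :=
  gAlong F c t (Y t)
    (weighted F p v c t (nabla F c (nabla F c X) t + R2 F c t (X t)))

/-- `v² [g(∇X/dt, ∇Y/dt) - R²(X, ċ, Y, ċ)] + (p - 2) g(ċ, ∇X/dt) g(ċ, ∇Y/dt)`. -/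
def indexIntegrand (F : TangentBundle (𝓡 n) M → ℝ) (p v : ℝ) (c : ℝ → M)
    (X Y : ∀ t : ℝ, TangentSpace (𝓡 n) (c t)) (t : ℝ) : ℝ :=
  v ^ 2 * (gAlong F c t (nabla F c X t) (nabla F c Y t) - R2form F c t (X t) (Y t))
    + (p - 2) * gAlong F c t (velocity c (Icc 0 1) t) (nabla F c X t)
      * gAlong F c t (velocity c (Icc 0 1) t) (nabla F c Y t)

/-- The form `p v^{p-4} ∫₀¹ {v² [g(∇X, ∇Y) - R²(X, ċ, Y, ċ)] + (p-2) g(ċ, ∇X) g(ċ, ∇Y)} dt`. -/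
def indexForm (F : TangentBundle (𝓡 n) M → ℝ) (p v : ℝ) (c : ℝ → M)
    (X Y : ∀ t : ℝ, TangentSpace (𝓡 n) (c t)) : ℝ :=
  p * v ^ (p - 4) * ∫ t in (0 : ℝ)..1, indexIntegrand F p v c X Y t

end Manifold

end FinslerPEnergy

end

/-! In one coordinate domain everything is governed by the energy e = F²/2 and by the vector-valued
function H solved from its Euler-Lagrange equation, so that geodesics satisfy ẍ + H(x, ẋ) = 0. Put N
= ½ ∂H/∂y. Contraction with the direction y collapses the index formulas: Γ y y = H, L y = N, C y =
0, and both curvature expressions become the Jacobi endomorphism R of the spray (`sum_christoffel`,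
`sum_cartanL`, `sum_cartanC`, `sum_hCurv`, `sum_nonlinCurv`). Along a geodesic c̈ + N ċ = 0, so
∇X/dt is simply X' + N X. Differentiating Euler's identity and the Euler-Lagrange identity gives
metric compatibility (`metric_conn_add`), self-adjointness of R (`jacobiEnd_symm`) and R y = 0
(`jacobiEnd_self`).

For a two-parameter family u in a chart, the mixed s-derivative of e(u, ∂u/∂t) at the origin is
D²e(X, X')(Y, Y') + De(Z, Z') with Z = ∂²u/∂s₁∂s₂. The key identity `hasDerivWithinAt_boundaryTerm`
says that this equals g(∇X, ∇Y) - g(R X, Y) plus the t-derivative of b = De(0, Z) + D²e(0, Y)(X, -N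
X). The first s-derivatives of e are g(ċ, ∇X) and g(ċ, ∇Y), so the chain rule for (2e)^(p/2) at the
constant value v² produces p v^(p-4) times the index integrand, up to an exact derivative.

The passage to the manifold rests on the coordinate independence of b (`change_boundaryTerm`): the
non-tensorial parts in the laws for Z and N cancel. Thus b is one function of t on the whole curve.
It involves only s-derivatives of the family and the velocity of the smooth geodesic, no
t-derivative of the variation, so it takes the same value from both sides of a break point; its
contributions telescope over the pieces (`piece_induction`) and vanish at the fixed end points. This
gives the index form.

The formula with jumps is one further integration by parts (`IsGeodesic.hasDerivAt_momentum`): g(Y,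
v² ∇X + (p-2) g(∇X, ċ) ċ) has as derivative the sum of the Jacobi and index integrands. This
boundary function does contain ∇X, which jumps, and adding up the pieces leaves the sum over the
break points. -/

set_option linter.unusedSectionVars false

namespace FinslerPEnergy

/-! ### Sprays in one coordinate system, without indices -/

section Spray

variable {V : Type*} [NormedAddCommGroup V] [NormedSpace ℝ V]

/-- The energy `e = F²/2` of a Finsler metric in a coordinate domain `U`, and the vector field `H`
of the geodesic equation `ẍ + H(x, ẋ) = 0`. -/
structure SprayData (U : Set V) (e : V × V → ℝ) (H : V × V → V) : Prop where
  isOpen : IsOpen U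
  smooth_energy : ∀ z : V × V, z.1 ∈ U → z.2 ≠ 0 → ContDiffAt ℝ ∞ e z
  smooth_spray : ∀ z : V × V, z.1 ∈ U → z.2 ≠ 0 → ContDiffAt ℝ ∞ H z
  euler : ∀ z : V × V, z.1 ∈ U → z.2 ≠ 0 → fderiv ℝ e z (0, z.2) = 2 * e z
  eulerLagrange : ∀ z : V × V, z.1 ∈ U → z.2 ≠ 0 → ∀ w : V,
    fderiv ℝ (fderiv ℝ e) z (0, H z) (0, w)
      = fderiv ℝ (fderiv ℝ e) z (0, w) (z.2, 0) - fderiv ℝ e z (w, 0)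
  pos : ∀ z : V × V, z.1 ∈ U → z.2 ≠ 0 → ∀ w : V, w ≠ 0 →
    0 < fderiv ℝ (fderiv ℝ e) z (0, w) (0, w)

/-- The fundamental tensor. -/
noncomputable def metric (e : V × V → ℝ) (z : V × V) (u w : V) : ℝ :=
  fderiv ℝ (fderiv ℝ e) z (0, u) (0, w)

/-- The nonlinear connection of a spray. -/
noncomputable def conn (H : V × V → V) (z : V × V) (w : V) : V :=
  (1 / 2 : ℝ) • fderiv ℝ H z (0, w)

/-- The Jacobi endomorphism of a spray. -/
noncomputable def jacobiEnd (H : V × V → V) (z : V × V) (w : V) : V :=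
  fderiv ℝ H z (w, 0) - conn H z (conn H z w)
    - (1 / 2 : ℝ) • fderiv ℝ (fderiv ℝ H) z (z.2, -H z) (0, w)

/-! ### Derivatives along curves and lines -/

theorem contDiffAt_fderiv_top {A B : Type*} [NormedAddCommGroup A] [NormedSpace ℝ A]
    [NormedAddCommGroup B] [NormedSpace ℝ B] {f : A → B} {x : A} (h : ContDiffAt ℝ ∞ f x) :
    ContDiffAt ℝ ∞ (fderiv ℝ f) x :=
  h.fderiv_right (by exact_mod_cast le_rfl)

theorem snd_derivative_comm {A B : Type*} [NormedAddCommGroup A] [NormedSpace ℝ A]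
    [NormedAddCommGroup B] [NormedSpace ℝ B] {f : A → B} {x : A} (h : ContDiffAt ℝ ∞ f x)
    (a b : A) : fderiv ℝ (fderiv ℝ f) x a b = fderiv ℝ (fderiv ℝ f) x b a :=
  (h.isSymmSndFDerivAt (by simpa using WithTop.coe_le_coe.2 (le_top : (2 : ℕ∞) ≤ ⊤))) a b

theorem hasDerivWithinAt_comp_of_contDiffAt {A B : Type*} [NormedAddCommGroup A] [NormedSpace ℝ A]
    [NormedAddCommGroup B] [NormedSpace ℝ B] {f : A → B} {γ : ℝ → A} {a : A} {S : Set ℝ} {t : ℝ}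
    (h : ContDiffAt ℝ ∞ f (γ t)) (hγ : HasDerivWithinAt γ a S t) :
    HasDerivWithinAt (fun s => f (γ s)) (fderiv ℝ f (γ t) a) S t :=
  (h.differentiableAt (by simp)).hasFDerivAt.comp_hasDerivWithinAt t hγ

theorem deriv_zero_prod {X : ℝ → V} {X' : V} {S : Set ℝ} {t : ℝ}
    (h : HasDerivWithinAt X X' S t) :
    HasDerivWithinAt (fun s => ((0, X s) : V × V)) (0, X') S t :=
  (hasDerivWithinAt_const t S (0 : V)).prodMk h

theorem deriv_prod_zero {X : ℝ → V} {X' : V} {S : Set ℝ} {t : ℝ}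
    (h : HasDerivWithinAt X X' S t) :
    HasDerivWithinAt (fun s => ((X s, 0) : V × V)) (X', 0) S t :=
  h.prodMk (hasDerivWithinAt_const t S (0 : V))

theorem clm_prod_split {W : Type*} [NormedAddCommGroup W] [NormedSpace ℝ W]
    (L : V × V →L[ℝ] W) (u w : V) : L (u, w) = L (u, 0) + L (0, w) := by
  rw [← map_add]; simp

theorem clm_zero_neg {W : Type*} [NormedAddCommGroup W] [NormedSpace ℝ W]
    (L : V × V →L[ℝ] W) (w : V) : L (0, -w) = - L (0, w) := by
  rw [← map_neg]; simp

theorem clm_prod_neg {W : Type*} [NormedAddCommGroup W] [NormedSpace ℝ W]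
    (L : V × V →L[ℝ] W) (u w : V) : L (u, -w) = L (u, 0) - L (0, w) := by
  rw [← map_sub]; simp

theorem clm_zero_add {W : Type*} [NormedAddCommGroup W] [NormedSpace ℝ W]
    (L : V × V →L[ℝ] W) (u w : V) : L (0, u + w) = L (0, u) + L (0, w) := by
  rw [← map_add]; simp

theorem clm_zero_sub {W : Type*} [NormedAddCommGroup W] [NormedSpace ℝ W]
    (L : V × V →L[ℝ] W) (u w : V) : L (0, u - w) = L (0, u) - L (0, w) := by
  rw [← map_sub]; simp

theorem clm_zero_smul {W : Type*} [NormedAddCommGroup W] [NormedSpace ℝ W]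
    (L : V × V →L[ℝ] W) (r : ℝ) (w : V) : L (0, r • w) = r • L (0, w) := by
  rw [← map_smul]; simp

/-- Lines are the test curves for differentiating pointwise identities: each derived identity below
compares both sides along z + s a. The set `univ` makes the rules for curves on an interval
applicable unchanged. -/
theorem hasDerivAt_line (z a : V × V) :
    HasDerivWithinAt (fun s : ℝ => z + s • a) a univ 0 := by
  have := ((hasDerivAt_id (0 : ℝ)).smul_const a).const_add z
  simpa [HasDerivWithinAt] using this.hasDerivWithinAt (s := univ)

/-- Directional derivative of a function which agrees near `z` with another one. -/
theorem line_unique {W : Type*} [NormedAddCommGroup W] [NormedSpace ℝ W] {f g : V × V → W}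
    {z a : V × V} {f' g' : W}
    (hf : HasDerivWithinAt (fun s : ℝ => f (z + s • a)) f' univ 0)
    (hg : HasDerivWithinAt (fun s : ℝ => g (z + s • a)) g' univ 0)
    (h : ∀ᶠ z' in 𝓝 z, f z' = g z') : f' = g' := by
  rw [hasDerivWithinAt_univ] at hf hg
  have hc : Tendsto (fun s : ℝ => z + s • a) (𝓝 0) (𝓝 z) := by
    have : ContinuousAt (fun s : ℝ => z + s • a) 0 := by fun_prop
    simpa [ContinuousAt] using this
  exact hf.unique (hg.congr_of_eventuallyEq (hc.eventually h))

namespace SprayData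

variable {U : Set V} {e : V × V → ℝ} {H : V × V → V}

theorem eventually_mem (h : SprayData U e H) {z : V × V} (h1 : z.1 ∈ U) (h2 : z.2 ≠ 0) :
    ∀ᶠ z' : V × V in 𝓝 z, z'.1 ∈ U ∧ z'.2 ≠ 0 :=
  (continuous_fst.continuousAt.eventually (h.isOpen.mem_nhds h1)).and
    (continuous_snd.continuousAt.eventually (isOpen_ne.mem_nhds h2))

theorem deriv_fst {γ : ℝ → V × V} {a : V × V} {S : Set ℝ} {t : ℝ} (h : SprayData U e H)
    (h1 : (γ t).1 ∈ U) (h2 : (γ t).2 ≠ 0) (hγ : HasDerivWithinAt γ a S t)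
    {u : ℝ → V × V} {u' : V × V} (hu : HasDerivWithinAt u u' S t) :
    HasDerivWithinAt (fun s => fderiv ℝ e (γ s) (u s))
      (fderiv ℝ (fderiv ℝ e) (γ t) a (u t) + fderiv ℝ e (γ t) u') S t :=
  (hasDerivWithinAt_comp_of_contDiffAt
    (contDiffAt_fderiv_top (h.smooth_energy _ h1 h2)) hγ).clm_apply hu

theorem deriv_snd {γ : ℝ → V × V} {a : V × V} {S : Set ℝ} {t : ℝ} (h : SprayData U e H)
    (h1 : (γ t).1 ∈ U) (h2 : (γ t).2 ≠ 0) (hγ : HasDerivWithinAt γ a S t)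
    {u w : ℝ → V × V} {u' w' : V × V} (hu : HasDerivWithinAt u u' S t)
    (hw : HasDerivWithinAt w w' S t) :
    HasDerivWithinAt (fun s => fderiv ℝ (fderiv ℝ e) (γ s) (u s) (w s))
      (fderiv ℝ (fderiv ℝ (fderiv ℝ e)) (γ t) a (u t) (w t)
        + fderiv ℝ (fderiv ℝ e) (γ t) u' (w t) + fderiv ℝ (fderiv ℝ e) (γ t) (u t) w') S t := by
  simpa using ((hasDerivWithinAt_comp_of_contDiffAt
    (contDiffAt_fderiv_top (contDiffAt_fderiv_top (h.smooth_energy _ h1 h2)))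
    hγ).clm_apply hu).clm_apply hw

theorem deriv_spray {γ : ℝ → V × V} {a : V × V} {S : Set ℝ} {t : ℝ} (h : SprayData U e H)
    (h1 : (γ t).1 ∈ U) (h2 : (γ t).2 ≠ 0) (hγ : HasDerivWithinAt γ a S t) :
    HasDerivWithinAt (fun s => H (γ s)) (fderiv ℝ H (γ t) a) S t :=
  hasDerivWithinAt_comp_of_contDiffAt (h.smooth_spray _ h1 h2) hγ

theorem deriv_fderiv_spray {γ : ℝ → V × V} {a : V × V} {S : Set ℝ} {t : ℝ} (h : SprayData U e H)
    (h1 : (γ t).1 ∈ U) (h2 : (γ t).2 ≠ 0) (hγ : HasDerivWithinAt γ a S t)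
    {u : ℝ → V × V} {u' : V × V} (hu : HasDerivWithinAt u u' S t) :
    HasDerivWithinAt (fun s => fderiv ℝ H (γ s) (u s))
      (fderiv ℝ (fderiv ℝ H) (γ t) a (u t) + fderiv ℝ H (γ t) u') S t :=
  (hasDerivWithinAt_comp_of_contDiffAt
    (contDiffAt_fderiv_top (h.smooth_spray _ h1 h2)) hγ).clm_apply hu

theorem deriv_conn {γ : ℝ → V × V} {a : V × V} {S : Set ℝ} {t : ℝ} (h : SprayData U e H)
    (h1 : (γ t).1 ∈ U) (h2 : (γ t).2 ≠ 0) (hγ : HasDerivWithinAt γ a S t)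
    {X : ℝ → V} {X' : V} (hX : HasDerivWithinAt X X' S t) :
    HasDerivWithinAt (fun s => conn H (γ s) (X s))
      ((1 / 2 : ℝ) • fderiv ℝ (fderiv ℝ H) (γ t) a (0, X t) + conn H (γ t) X') S t := by
  have := (h.deriv_fderiv_spray h1 h2 hγ (deriv_zero_prod hX)).const_smul (1 / 2 : ℝ)
  rw [smul_add] at this
  exact this

theorem snd_symm (h : SprayData U e H) {z : V × V} (h1 : z.1 ∈ U) (h2 : z.2 ≠ 0) (a b : V × V) :
    fderiv ℝ (fderiv ℝ e) z a b = fderiv ℝ (fderiv ℝ e) z b a :=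
  snd_derivative_comm (h.smooth_energy z h1 h2) a b

theorem metric_comm (h : SprayData U e H) {z : V × V} (h1 : z.1 ∈ U) (h2 : z.2 ≠ 0) (a b : V) :
    metric e z a b = metric e z b a :=
  h.snd_symm h1 h2 _ _

theorem third_symm_left (h : SprayData U e H) {z : V × V} (h1 : z.1 ∈ U) (h2 : z.2 ≠ 0)
    (a b c : V × V) : fderiv ℝ (fderiv ℝ (fderiv ℝ e)) z a b c
      = fderiv ℝ (fderiv ℝ (fderiv ℝ e)) z b a c := by
  rw [snd_derivative_comm (contDiffAt_fderiv_top (h.smooth_energy z h1 h2))]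

/-- Schwarz for `fderiv ℝ e` only exchanges the first two slots. The last two are exchanged by
differentiating the symmetry of the Hessian, which holds on a whole neighbourhood. -/
theorem third_symm_right (h : SprayData U e H) {z : V × V} (h1 : z.1 ∈ U) (h2 : z.2 ≠ 0)
    (a b c : V × V) : fderiv ℝ (fderiv ℝ (fderiv ℝ e)) z a b c
      = fderiv ℝ (fderiv ℝ (fderiv ℝ e)) z a c b := by
  have hl := hasDerivAt_line z a
  have e1 := h.deriv_snd (by simpa) (by simpa) hl
    (hasDerivWithinAt_const _ _ b) (hasDerivWithinAt_const _ _ c)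
  have e2 := h.deriv_snd (by simpa) (by simpa) hl
    (hasDerivWithinAt_const _ _ c) (hasDerivWithinAt_const _ _ b)
  simpa using line_unique (f := fun z => fderiv ℝ (fderiv ℝ e) z b c)
    (g := fun z => fderiv ℝ (fderiv ℝ e) z c b) e1 e2
    ((h.eventually_mem h1 h2).mono fun z' hz => h.snd_symm hz.1 hz.2 b c)

/-- Positivity is tested on u - w. Vector identities for the spray are proved by pairing with an
arbitrary vector and cancelling through this lemma. -/
theorem metric_nondeg (h : SprayData U e H) {z : V × V} (h1 : z.1 ∈ U) (h2 : z.2 ≠ 0) {u w : V}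
    (huw : ∀ a, metric e z u a = metric e z w a) : u = w := by
  by_contra hne
  have hp := h.pos z h1 h2 (u - w) (sub_ne_zero.2 hne)
  have := huw (u - w)
  unfold metric at this
  rw [clm_zero_sub (fderiv ℝ (fderiv ℝ e) z), sub_apply, this, sub_self] at hp
  exact lt_irrefl _ hp

/-! ### Homogeneity and the nonlinear connection -/

theorem hasDerivAt_line_snd (z a : V × V) :
    HasDerivWithinAt (fun s : ℝ => (z + s • a).2) a.2 univ 0 :=
  ((ContinuousLinearMap.snd ℝ V V).hasFDerivAt.comp_hasDerivWithinAt 0 (hasDerivAt_line z a))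

/-- Derivative of Euler's identity in the direction a; the slot (0, z.2) moves as well and is
responsible for the last term. -/
theorem euler_snd (h : SprayData U e H) {z : V × V} (h1 : z.1 ∈ U) (h2 : z.2 ≠ 0) (a : V × V) :
    fderiv ℝ (fderiv ℝ e) z a (0, z.2) = 2 * fderiv ℝ e z a - fderiv ℝ e z (0, a.2) := by
  have hl := hasDerivAt_line z a
  have e1 := h.deriv_fst (by simpa) (by simpa) hl (deriv_zero_prod (hasDerivAt_line_snd z a))
  have e2 := (hasDerivWithinAt_comp_of_contDiffAt
    (h.smooth_energy (z + (0:ℝ) • a) (by simpa) (by simpa)) hl).const_mul 2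
  have := line_unique (f := fun z => fderiv ℝ e z (0, z.2)) (g := fun z => 2 * e z) e1 e2
    ((h.eventually_mem h1 h2).mono fun z' hz => h.euler z' hz.1 hz.2)
  simp only [zero_smul, add_zero] at this
  linarith

theorem euler_third (h : SprayData U e H) {z : V × V} (h1 : z.1 ∈ U) (h2 : z.2 ≠ 0)
    (a b : V × V) : fderiv ℝ (fderiv ℝ (fderiv ℝ e)) z a b (0, z.2)
      = 2 * fderiv ℝ (fderiv ℝ e) z a b - fderiv ℝ (fderiv ℝ e) z a (0, b.2)
        - fderiv ℝ (fderiv ℝ e) z b (0, a.2) := by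
  have hl := hasDerivAt_line z a
  have e1 := h.deriv_snd (by simpa) (by simpa) hl (hasDerivWithinAt_const _ _ b)
    (deriv_zero_prod (hasDerivAt_line_snd z a))
  have e2 := ((h.deriv_fst (by simpa) (by simpa) hl
    (hasDerivWithinAt_const _ _ b)).const_mul 2).sub (h.deriv_fst (by simpa) (by simpa) hl
    (hasDerivWithinAt_const _ _ ((0, b.2) : V × V)))
  have := line_unique (f := fun z => fderiv ℝ (fderiv ℝ e) z b (0, z.2))
    (g := fun z => 2 * fderiv ℝ e z b - fderiv ℝ e z (0, b.2)) e1 e2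
    ((h.eventually_mem h1 h2).mono fun z' hz => h.euler_snd hz.1 hz.2 b)
  simp only [zero_smul, add_zero, map_zero, zero_apply] at this
  linarith

/-- The Hessian in y is homogeneous of degree 0, so the Cartan tensor annihilates y. -/
theorem euler_third_vert (h : SprayData U e H) {z : V × V} (h1 : z.1 ∈ U) (h2 : z.2 ≠ 0)
    (u w : V) : fderiv ℝ (fderiv ℝ (fderiv ℝ e)) z (0, u) (0, w) (0, z.2) = 0 := by
  rw [h.euler_third h1 h2, h.snd_symm h1 h2 (0, u)]; ring

/-- The mixed derivative ∂²e/∂x∂y is homogeneous of degree 1 in y, and this is Euler's relation for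
it. -/
theorem euler_third_hor (h : SprayData U e H) {z : V × V} (h1 : z.1 ∈ U) (h2 : z.2 ≠ 0)
    (u w : V) : fderiv ℝ (fderiv ℝ (fderiv ℝ e)) z (u, 0) (0, w) (0, z.2)
      = fderiv ℝ (fderiv ℝ e) z (u, 0) (0, w) := by
  rw [h.euler_third h1 h2]
  have : ((0 : V), (0 : V)) = 0 := rfl
  simp only [this, map_zero]; ring

/-- The derivative of the Euler-Lagrange identity. -/
theorem eulerLagrange_deriv (h : SprayData U e H) {z : V × V} (h1 : z.1 ∈ U) (h2 : z.2 ≠ 0)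
    (a : V × V) (w : V) :
    fderiv ℝ (fderiv ℝ (fderiv ℝ e)) z a (0, H z) (0, w) + metric e z (fderiv ℝ H z a) w
      = fderiv ℝ (fderiv ℝ (fderiv ℝ e)) z a (0, w) (z.2, 0)
        + fderiv ℝ (fderiv ℝ e) z (0, w) (a.2, 0) - fderiv ℝ (fderiv ℝ e) z a (w, 0) := by
  have hl := hasDerivAt_line z a
  have e1 := h.deriv_snd (by simpa) (by simpa) hl
    (deriv_zero_prod (h.deriv_spray (by simpa) (by simpa) hl))
    (hasDerivWithinAt_const _ _ ((0, w) : V × V))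
  have e2 := (h.deriv_snd (by simpa) (by simpa) hl (hasDerivWithinAt_const _ _ ((0, w) : V × V))
    (deriv_prod_zero (hasDerivAt_line_snd z a))).sub (h.deriv_fst (by simpa) (by simpa) hl
    (hasDerivWithinAt_const _ _ ((w, 0) : V × V)))
  have := line_unique (f := fun z => fderiv ℝ (fderiv ℝ e) z (0, H z) (0, w))
    (g := fun z => fderiv ℝ (fderiv ℝ e) z (0, w) (z.2, 0) - fderiv ℝ e z (w, 0)) e1 e2
    ((h.eventually_mem h1 h2).mono fun z' hz => h.eulerLagrange z' hz.1 hz.2 w)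
  simp only [zero_smul, add_zero, map_zero, zero_apply] at this
  unfold metric
  linarith

/-- Homogeneity of degree 2 passes from e to H through the Euler-Lagrange identity: its derivative
in the fibre direction (0, y) loses the Cartan-tensor term, and nondegeneracy of the metric removes
the test vector. -/
theorem euler_spray (h : SprayData U e H) {z : V × V} (h1 : z.1 ∈ U) (h2 : z.2 ≠ 0) :
    fderiv ℝ H z (0, z.2) = (2 : ℝ) • H z := by
  refine h.metric_nondeg h1 h2 fun w => ?_
  have e1 := h.eulerLagrange_deriv h1 h2 (0, z.2) w
  have e2 := h.eulerLagrange z h1 h2 w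
  rw [h.third_symm_left h1 h2, h.third_symm_right h1 h2, h.euler_third_vert h1 h2,
    h.third_symm_left h1 h2, h.third_symm_right h1 h2, h.third_symm_left h1 h2,
    h.euler_third_hor h1 h2, h.snd_symm h1 h2 (0, z.2) (w, 0), h.euler_snd h1 h2] at e1
  have : ((0 : V), (0 : V)) = 0 := rfl
  simp only [this, map_zero] at e1
  unfold metric at *
  rw [clm_zero_smul, smul_apply, e2, smul_eq_mul]
  rw [h.snd_symm h1 h2 (z.2, 0)] at e1
  linarith

theorem conn_self (h : SprayData U e H) {z : V × V} (h1 : z.1 ∈ U) (h2 : z.2 ≠ 0) :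
    conn H z z.2 = H z := by
  unfold conn; rw [h.euler_spray h1 h2, smul_smul]; norm_num

/-- The lowered nonlinear connection. -/
theorem metric_conn (h : SprayData U e H) {z : V × V} (h1 : z.1 ∈ U) (h2 : z.2 ≠ 0) (u w : V) :
    2 * metric e z (conn H z u) w
      = fderiv ℝ (fderiv ℝ (fderiv ℝ e)) z (z.2, -H z) (0, u) (0, w)
        + fderiv ℝ (fderiv ℝ e) z (0, w) (u, 0) - fderiv ℝ (fderiv ℝ e) z (0, u) (w, 0) := by
  have e1 := h.eulerLagrange_deriv h1 h2 (0, u) w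
  rw [clm_prod_neg (W := V × V →L[ℝ] V × V →L[ℝ] ℝ)]
  rw [h.third_symm_right h1 h2 (0, u) (0, w) (z.2, 0), h.third_symm_left h1 h2 (0, u) (z.2, 0),
    h.third_symm_left h1 h2 (0, u) (0, H z)] at e1
  simp only [metric, conn, clm_zero_smul, smul_apply, smul_eq_mul,
    sub_apply] at *
  linarith

/-- Symmetric part of `metric_conn`. It says that the derivative of the metric along the spray is
compensated by N, which is metric compatibility of ∇/dt along geodesics. -/
theorem metric_conn_add (h : SprayData U e H) {z : V × V} (h1 : z.1 ∈ U) (h2 : z.2 ≠ 0)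
    (u w : V) : fderiv ℝ (fderiv ℝ (fderiv ℝ e)) z (z.2, -H z) (0, u) (0, w)
      = metric e z (conn H z u) w + metric e z u (conn H z w) := by
  have e1 := h.metric_conn h1 h2 u w
  have e2 := h.metric_conn h1 h2 w u
  rw [h.third_symm_right h1 h2 _ (0, w)] at e2
  rw [h.metric_comm h1 h2 u]
  linarith

/-- Antisymmetric part of `metric_conn`. Its derivative along the spray yields the self-adjointness
of the Jacobi endomorphism. -/
theorem metric_conn_sub (h : SprayData U e H) {z : V × V} (h1 : z.1 ∈ U) (h2 : z.2 ≠ 0)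
    (u w : V) : metric e z (conn H z u) w - metric e z u (conn H z w)
      = fderiv ℝ (fderiv ℝ e) z (0, w) (u, 0) - fderiv ℝ (fderiv ℝ e) z (0, u) (w, 0) := by
  have e1 := h.metric_conn h1 h2 u w
  have e2 := h.metric_conn h1 h2 w u
  rw [h.third_symm_right h1 h2 _ (0, w)] at e2
  rw [h.metric_comm h1 h2 u]
  linarith

/-- Together with `metric_self` this means that e is constant in horizontal directions, De(w, -N w)
= 0. It turns the first variation of e into g(ċ, ∇X). -/
theorem metric_self_conn (h : SprayData U e H) {z : V × V} (h1 : z.1 ∈ U) (h2 : z.2 ≠ 0)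
    (w : V) : metric e z z.2 (conn H z w) = fderiv ℝ e z (w, 0) := by
  have e1 := h.metric_conn h1 h2 w z.2
  have e2 := h.eulerLagrange z h1 h2 w
  rw [clm_prod_neg (W := V × V →L[ℝ] V × V →L[ℝ] ℝ)] at e1
  simp only [sub_apply] at e1
  rw [h.euler_third_vert h1 h2, h.euler_third_hor h1 h2, h.snd_symm h1 h2 (0, z.2),
    h.euler_snd h1 h2] at e1
  have : ((0 : V), (0 : V)) = 0 := rfl
  simp only [this, map_zero] at e1
  rw [h.metric_comm h1 h2]
  rw [h.snd_symm h1 h2 (z.2, 0)] at e1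
  linarith

theorem metric_self (h : SprayData U e H) {z : V × V} (h1 : z.1 ∈ U) (h2 : z.2 ≠ 0)
    (w : V) : metric e z z.2 w = fderiv ℝ e z (0, w) := by
  rw [h.metric_comm h1 h2, metric, h.euler_snd h1 h2]; ring

theorem metric_self_self (h : SprayData U e H) {z : V × V} (h1 : z.1 ∈ U) (h2 : z.2 ≠ 0) :
    metric e z z.2 z.2 = 2 * e z := by
  rw [h.metric_self h1 h2, h.euler z h1 h2]

/-! ### The Jacobi endomorphism and the second variation in coordinates -/

/-- The term g(∂H/∂x u, w) is eliminated by the x-derivative of the Euler-Lagrange identity; what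
remains is visibly symmetric up to terms controlled by `metric_conn_sub`. -/
theorem metric_jacobiEnd (h : SprayData U e H) {z : V × V} (h1 : z.1 ∈ U) (h2 : z.2 ≠ 0)
    (u w : V) : metric e z (jacobiEnd H z u) w
      = fderiv ℝ (fderiv ℝ (fderiv ℝ e)) z (z.2, -H z) (0, w) (u, 0)
        - fderiv ℝ (fderiv ℝ e) z (u, 0) (w, 0) - metric e z (conn H z (conn H z u)) w
        - (1 / 2) * metric e z (fderiv ℝ (fderiv ℝ H) z (z.2, -H z) (0, u)) w := by
  have e1 := h.eulerLagrange_deriv h1 h2 (u, 0) w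
  have : ((0 : V), (0 : V)) = 0 := rfl
  simp only [this, map_zero] at e1
  rw [clm_prod_neg (W := V × V →L[ℝ] V × V →L[ℝ] ℝ)]
  rw [h.third_symm_right h1 h2 (u, 0) (0, w) (z.2, 0), h.third_symm_left h1 h2 (u, 0) (z.2, 0),
    h.third_symm_right h1 h2 (z.2, 0), h.third_symm_left h1 h2 (u, 0),
    h.third_symm_right h1 h2 (0, H z)] at e1
  simp only [metric, jacobiEnd, clm_zero_sub (fderiv ℝ (fderiv ℝ e) z),
    clm_zero_smul (fderiv ℝ (fderiv ℝ e) z), smul_apply, smul_eq_mul, sub_apply] at *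
  linarith

/-- Differentiate `metric_conn_sub` in the spray direction (y, -H). The derivatives of the metric
that appear are rewritten by `metric_conn_add`, and the outcome is the antisymmetric part of
`metric_jacobiEnd` set equal to zero. -/
theorem jacobiEnd_symm (h : SprayData U e H) {z : V × V} (h1 : z.1 ∈ U) (h2 : z.2 ≠ 0)
    (u w : V) : metric e z (jacobiEnd H z u) w = metric e z (jacobiEnd H z w) u := by
  have hl := hasDerivAt_line z (z.2, -H z)
  have k : ∀ u : V, HasDerivWithinAt (fun s : ℝ => ((0, conn H (z + s • (z.2, -H z)) u) : V × V))
      _ univ 0 := fun u => deriv_zero_prod (h.deriv_conn (by simpa) (by simpa) hl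
        (hasDerivWithinAt_const _ _ u))
  have c : ∀ v : V × V, HasDerivWithinAt (fun _ : ℝ => v) 0 univ 0 :=
    fun v => hasDerivWithinAt_const _ _ v
  have e1 := (h.deriv_snd (by simpa) (by simpa) hl (k u) (c (0, w))).sub
    (h.deriv_snd (by simpa) (by simpa) hl (c (0, u)) (k w))
  have e2 := (h.deriv_snd (by simpa) (by simpa) hl (c (0, w)) (c (u, 0))).sub
    (h.deriv_snd (by simpa) (by simpa) hl (c (0, u)) (c (w, 0)))
  have e3 := line_unique (f := fun z => metric e z (conn H z u) w - metric e z u (conn H z w))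
    (g := fun z => fderiv ℝ (fderiv ℝ e) z (0, w) (u, 0) - fderiv ℝ (fderiv ℝ e) z (0, u) (w, 0))
    e1 e2 ((h.eventually_mem h1 h2).mono fun z' hz => h.metric_conn_sub hz.1 hz.2 u w)
  have z0 : conn H z 0 = 0 := by
    have : ((0 : V), (0 : V)) = 0 := rfl
    simp [conn, this]
  simp only [zero_smul, add_zero, map_zero, zero_apply, z0,
    clm_zero_smul, smul_apply, smul_eq_mul] at e3
  rw [h.metric_conn_add h1 h2, h.metric_conn_add h1 h2] at e3
  rw [h.metric_jacobiEnd h1 h2, h.metric_jacobiEnd h1 h2, h.snd_symm h1 h2 (u, 0),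
    h.metric_comm h1 h2 _ u, h.metric_comm h1 h2 _ u]
  simp only [metric] at *
  linarith

/-- This is the homogeneity relation `euler_spray` differentiated along the spray, combined with N y
= H. -/
theorem jacobiEnd_self (h : SprayData U e H) {z : V × V} (h1 : z.1 ∈ U) (h2 : z.2 ≠ 0) :
    jacobiEnd H z z.2 = 0 := by
  have hl := hasDerivAt_line z (z.2, -H z)
  have e1 := h.deriv_fderiv_spray (by simpa) (by simpa) hl
    (deriv_zero_prod (hasDerivAt_line_snd z (z.2, -H z)))
  have e2 := (h.deriv_spray (by simpa) (by simpa) hl).const_smul (2 : ℝ)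
  have e3 := line_unique (f := fun z => fderiv ℝ H z (0, z.2)) (g := fun z => (2 : ℝ) • H z)
    e1 e2 ((h.eventually_mem h1 h2).mono fun z' hz => h.euler_spray hz.1 hz.2)
  simp only [zero_smul, add_zero] at e3
  rw [clm_zero_neg, clm_prod_neg (fderiv ℝ H z), ← sub_eq_add_neg,
    sub_eq_iff_eq_add] at e3
  rw [jacobiEnd, h.conn_self h1 h2, e3, conn]
  module

/-- Energy of a vector. -/
theorem metric_jacobiEnd_self (h : SprayData U e H) {z : V × V} (h1 : z.1 ∈ U) (h2 : z.2 ≠ 0)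
    (u : V) : metric e z (jacobiEnd H z u) z.2 = 0 := by
  rw [h.jacobiEnd_symm h1 h2, h.jacobiEnd_self h1 h2, metric]
  have : ((0 : V), (0 : V)) = 0 := rfl
  simp [this]

/-- Metric compatibility of the covariant derivative along a geodesic. -/
theorem hasDerivWithinAt_metric (h : SprayData U e H) {γ : ℝ → V × V} {S : Set ℝ} {t : ℝ}
    (h1 : (γ t).1 ∈ U) (h2 : (γ t).2 ≠ 0) (hγ : HasDerivWithinAt γ ((γ t).2, -H (γ t)) S t)
    {X Y : ℝ → V} {X' Y' : V} (hX : HasDerivWithinAt X X' S t) (hY : HasDerivWithinAt Y Y' S t) :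
    HasDerivWithinAt (fun s => metric e (γ s) (X s) (Y s))
      (metric e (γ t) (X' + conn H (γ t) (X t)) (Y t)
        + metric e (γ t) (X t) (Y' + conn H (γ t) (Y t))) S t := by
  refine (h.deriv_snd h1 h2 hγ (deriv_zero_prod hX) (deriv_zero_prod hY)).congr_deriv ?_
  rw [h.metric_conn_add h1 h2]
  simp only [metric, clm_zero_add, add_apply]
  ring

/-- The boundary term of the second variation. -/
noncomputable def _root_.FinslerPEnergy.boundaryTerm (e : V × V → ℝ) (H : V × V → V) (z : V × V)
    (X Y Z : V) : ℝ :=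
  fderiv ℝ e z (0, Z) + fderiv ℝ (fderiv ℝ e) z (0, Y) (X, -conn H z X)

/-- The core of the second variation. By the Euler-Lagrange equation the Z-part of the boundary term
differentiates to De(Z, Z'); the part D²e(0, Y)(X, -N X) completes D²e(X, X')(Y, Y') to covariant
derivatives, and the derivative of N along the spray together with ∂H/∂x assembles into the
curvature. No relation between X, Y and Z is needed here. -/
theorem hasDerivWithinAt_boundaryTerm (h : SprayData U e H) {γ : ℝ → V × V} {S : Set ℝ} {t : ℝ}
    (h1 : (γ t).1 ∈ U) (h2 : (γ t).2 ≠ 0) (hγ : HasDerivWithinAt γ ((γ t).2, -H (γ t)) S t)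
    {X Y Z : ℝ → V} {X' Y' Z' : V} (hX : HasDerivWithinAt X X' S t)
    (hY : HasDerivWithinAt Y Y' S t) (hZ : HasDerivWithinAt Z Z' S t) :
    HasDerivWithinAt (fun s => boundaryTerm e H (γ s) (X s) (Y s) (Z s))
      (fderiv ℝ (fderiv ℝ e) (γ t) (X t, X') (Y t, Y') + fderiv ℝ e (γ t) (Z t, Z')
        - metric e (γ t) (X' + conn H (γ t) (X t)) (Y' + conn H (γ t) (Y t))
        + metric e (γ t) (jacobiEnd H (γ t) (X t)) (Y t)) S t := by
  have e1 := h.deriv_fst h1 h2 hγ (deriv_zero_prod hZ)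
  have e2 := h.deriv_snd h1 h2 hγ (deriv_zero_prod hY) (hX.prodMk (h.deriv_conn h1 h2 hγ hX).neg)
  refine (e1.add e2).congr_deriv ?_
  have f1 := h.eulerLagrange (γ t) h1 h2 (Z t)
  have f2 := h.metric_conn_sub h1 h2 X' (Y t)
  have f3 := h.metric_conn_add h1 h2 (Y t) (conn H (γ t) (X t))
  rw [h.metric_jacobiEnd h1 h2]
  set B := fderiv ℝ (fderiv ℝ e) (γ t) with hB
  have hs : ∀ a b, B a b = B b a := h.snd_symm h1 h2
  set T := fderiv ℝ (fderiv ℝ (fderiv ℝ e)) (γ t) ((γ t).2, -H (γ t)) with hT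
  set K := fderiv ℝ (fderiv ℝ H) (γ t) ((γ t).2, -H (γ t)) (0, X t) with hK
  simp only [metric, ← hB] at *
  -- Along a geodesic the derivative of ∂e/∂y is ∂e/∂x, so Z contributes nothing beyond De(Z, Z').
  have hσ : B ((γ t).2, -H (γ t)) (0, Z t) = fderiv ℝ e (γ t) (Z t, 0) := by
    rw [clm_prod_neg B, sub_apply, f1, hs (0, Z t)]
    ring
  have t1 : ∀ u u' w w' : V, B (u, u') (w, w')
      = B (u, 0) (w, 0) + B (u, 0) (0, w') + B (0, u') (w, 0) + B (0, u') (0, w') := by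
    intro u u' w w'
    rw [clm_prod_split B, add_apply, clm_prod_split (B (u, 0)), clm_prod_split (B (0, u'))]
    ring
  simp only [Pi.neg_apply]
  rw [hσ, clm_prod_neg (T (0, Y t)), f3, clm_prod_neg (B (0, Y')), clm_prod_neg (B (0, Y t)),
    t1 (X t) X' (Y t) Y', clm_prod_split (fderiv ℝ e (γ t)) (Z t) Z']
  simp only [clm_zero_add, clm_zero_smul, add_apply, smul_eq_mul]
  rw [hs (0, Y t) (0, K), hs (0, Y t) (0, conn H (γ t) (conn H (γ t) (X t))),
    hs (0, Y t) (0, conn H (γ t) X'), hs (0, Y') (0, conn H (γ t) (X t)),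
    hs (0, Y') (X t, 0), hs (0, conn H (γ t) (Y t)) (0, conn H (γ t) (X t))]
  linarith

/-! ### Transformation laws under a change of coordinates -/

section ChangeOfCoordinates

variable {U' : Set V} {e' : V × V → ℝ} {H' : V × V → V} {φ : V → V}

/-- Chain rule for the induced map (x, y) ↦ (φ x, φ'(x) y). The second derivative of φ enters
because the fibre component depends on x; this is the source of every non-tensorial term below. -/
theorem change_fst (h : SprayData U e H) (h' : SprayData U' e' H') {z : V × V} (h1 : z.1 ∈ U)
    (h2 : z.2 ≠ 0) (hφ : ContDiffAt ℝ ∞ φ z.1) (hU : φ z.1 ∈ U') (hne : fderiv ℝ φ z.1 z.2 ≠ 0)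
    (he : ∀ᶠ x in 𝓝 z.1, ∀ y, e' (φ x, fderiv ℝ φ x y) = e (x, y)) (a : V × V) :
    fderiv ℝ e z a = fderiv ℝ e' (φ z.1, fderiv ℝ φ z.1 z.2)
      (fderiv ℝ φ z.1 a.1, fderiv ℝ (fderiv ℝ φ) z.1 a.1 z.2 + fderiv ℝ φ z.1 a.2) := by
  have hl := hasDerivAt_line z a
  have hl1 : HasDerivWithinAt (fun s : ℝ => (z + s • a).1) a.1 univ 0 :=
    (ContinuousLinearMap.fst ℝ V V).hasFDerivAt.comp_hasDerivWithinAt 0 hl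
  have e1 := hasDerivWithinAt_comp_of_contDiffAt (h.smooth_energy (z + (0 : ℝ) • a)
    (by simpa) (by simpa)) hl
  have p1 := hasDerivWithinAt_comp_of_contDiffAt (f := φ) (by simpa using hφ) hl1
  have p2 := (hasDerivWithinAt_comp_of_contDiffAt (f := fderiv ℝ φ)
    (by simpa using contDiffAt_fderiv_top hφ) hl1).clm_apply (hasDerivAt_line_snd z a)
  have e2 := hasDerivWithinAt_comp_of_contDiffAt (f := e')
    (by simpa using h'.smooth_energy _ hU hne) (p1.prodMk p2)
  have := line_unique (f := e) (g := fun z => e' (φ z.1, fderiv ℝ φ z.1 z.2)) e1 e2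
    ((continuous_fst.continuousAt.eventually he).mono fun z' hz => (hz z'.2).symm)
  simpa using this

theorem change_snd (h : SprayData U e H) (h' : SprayData U' e' H') {z : V × V} (h1 : z.1 ∈ U)
    (h2 : z.2 ≠ 0) (hφ' : ∀ᶠ x in 𝓝 z.1, ContDiffAt ℝ ∞ φ x) (hU : φ z.1 ∈ U')
    (hne : fderiv ℝ φ z.1 z.2 ≠ 0)
    (he : ∀ᶠ x in 𝓝 z.1, ∀ y, e' (φ x, fderiv ℝ φ x y) = e (x, y)) (a : V × V) (w : V) :
    fderiv ℝ (fderiv ℝ e) z a (0, w)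
      = fderiv ℝ (fderiv ℝ e') (φ z.1, fderiv ℝ φ z.1 z.2)
          (fderiv ℝ φ z.1 a.1, fderiv ℝ (fderiv ℝ φ) z.1 a.1 z.2 + fderiv ℝ φ z.1 a.2)
          (0, fderiv ℝ φ z.1 w)
        + fderiv ℝ e' (φ z.1, fderiv ℝ φ z.1 z.2) (0, fderiv ℝ (fderiv ℝ φ) z.1 a.1 w) := by
  have hφ := hφ'.self_of_nhds
  have hl := hasDerivAt_line z a
  have hl1 : HasDerivWithinAt (fun s : ℝ => (z + s • a).1) a.1 univ 0 :=
    (ContinuousLinearMap.fst ℝ V V).hasFDerivAt.comp_hasDerivWithinAt 0 hl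
  have e1 := h.deriv_fst (by simpa) (by simpa) hl (hasDerivWithinAt_const _ _ ((0, w) : V × V))
  have p1 := hasDerivWithinAt_comp_of_contDiffAt (f := φ) (by simpa using hφ) hl1
  have p3 := hasDerivWithinAt_comp_of_contDiffAt (f := fderiv ℝ φ)
    (by simpa using contDiffAt_fderiv_top hφ) hl1
  have e2 := h'.deriv_fst (by simpa using hU) (by simpa using hne)
    (p1.prodMk (p3.clm_apply (hasDerivAt_line_snd z a)))
    (deriv_zero_prod (p3.clm_apply (hasDerivWithinAt_const _ _ w)))
  have hcd : ContinuousAt (fun z : V × V => (φ z.1, fderiv ℝ φ z.1 z.2)) z :=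
    (hφ.continuousAt.comp continuous_fst.continuousAt).prodMk
      (((contDiffAt_fderiv_top hφ).continuousAt.comp (f := Prod.fst)
        continuous_fst.continuousAt).clm_apply continuous_snd.continuousAt)
  have ev : ∀ᶠ z' : V × V in 𝓝 z, fderiv ℝ e z' (0, w)
      = fderiv ℝ e' (φ z'.1, fderiv ℝ φ z'.1 z'.2) (0, fderiv ℝ φ z'.1 w) := by
    filter_upwards [h.eventually_mem h1 h2, hcd.eventually (h'.eventually_mem hU hne),
      continuous_fst.continuousAt.eventually (eventually_eventually_nhds.2 he),
      continuous_fst.continuousAt.eventually hφ'] with z' k1 k2 k3 k4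
    have := change_fst h h' k1.1 k1.2 k4 k2.1 k2.2 k3 (0, w)
    simpa using this
  have := line_unique (f := fun z => fderiv ℝ e z (0, w))
    (g := fun z => fderiv ℝ e' (φ z.1, fderiv ℝ φ z.1 z.2) (0, fderiv ℝ φ z.1 w)) e1 e2 ev
  have z0 : ((0 : V), (0 : V)) = 0 := rfl
  simpa [z0] using this

theorem change_metric (h : SprayData U e H) (h' : SprayData U' e' H') {z : V × V} (h1 : z.1 ∈ U)
    (h2 : z.2 ≠ 0) (hφ' : ∀ᶠ x in 𝓝 z.1, ContDiffAt ℝ ∞ φ x) (hU : φ z.1 ∈ U')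
    (hne : fderiv ℝ φ z.1 z.2 ≠ 0)
    (he : ∀ᶠ x in 𝓝 z.1, ∀ y, e' (φ x, fderiv ℝ φ x y) = e (x, y)) (u w : V) :
    metric e' (φ z.1, fderiv ℝ φ z.1 z.2) (fderiv ℝ φ z.1 u) (fderiv ℝ φ z.1 w)
      = metric e z u w := by
  have z0 : ((0 : V), (0 : V)) = 0 := rfl
  simpa [metric, z0] using (change_snd h h' h1 h2 hφ' hU hne he (0, u) w).symm

/-- The Euler-Lagrange identity determines H, so its law follows from those of the derivatives of e.
Surjectivity of φ' is what lets the test vector be arbitrary in the new chart. -/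
theorem change_spray (h : SprayData U e H) (h' : SprayData U' e' H') {z : V × V} (h1 : z.1 ∈ U)
    (h2 : z.2 ≠ 0) (hφ' : ∀ᶠ x in 𝓝 z.1, ContDiffAt ℝ ∞ φ x) (hU : φ z.1 ∈ U')
    (hne : fderiv ℝ φ z.1 z.2 ≠ 0)
    (hs : Function.Surjective (fderiv ℝ φ z.1))
    (he : ∀ᶠ x in 𝓝 z.1, ∀ y, e' (φ x, fderiv ℝ φ x y) = e (x, y)) :
    H' (φ z.1, fderiv ℝ φ z.1 z.2)
      = fderiv ℝ φ z.1 (H z) - fderiv ℝ (fderiv ℝ φ) z.1 z.2 z.2 := by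
  have hφ := hφ'.self_of_nhds
  refine h'.metric_nondeg (z := (φ z.1, fderiv ℝ φ z.1 z.2)) hU hne fun a => ?_
  obtain ⟨w, rfl⟩ := hs a
  have k1 := h'.eulerLagrange (φ z.1, fderiv ℝ φ z.1 z.2) hU hne (fderiv ℝ φ z.1 w)
  have k2 := h.eulerLagrange z h1 h2 w
  have k3 := change_snd h h' h1 h2 hφ' hU hne he (z.2, 0) w
  have k4 := change_fst h h' h1 h2 hφ'.self_of_nhds hU hne he (w, 0)
  have k5 := change_metric h h' h1 h2 hφ' hU hne he (H z) w
  simp only [metric] at *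
  simp only [map_zero, add_zero] at k3 k4
  rw [clm_prod_split (fderiv ℝ e' _) (fderiv ℝ φ z.1 w)] at k4
  rw [clm_prod_split (W := V × V →L[ℝ] ℝ) _ (fderiv ℝ φ z.1 z.2)
    (fderiv ℝ (fderiv ℝ φ) z.1 z.2 z.2), add_apply] at k3
  rw [clm_zero_sub (W := V × V →L[ℝ] ℝ), sub_apply]
  rw [h.snd_symm h1 h2] at k3
  rw [h'.snd_symm (z := (φ z.1, fderiv ℝ φ z.1 z.2)) hU hne (_, 0)] at k3
  rw [snd_derivative_comm hφ w z.2] at k4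
  linarith

/-- Fibre derivative of `change_spray` at fixed base point. Injectivity of φ' keeps the transformed
direction nonzero for all nearby y; the factor ½ in N absorbs the two equal terms from
differentiating φ''(y, y). -/
theorem change_conn (h : SprayData U e H) (h' : SprayData U' e' H') {z : V × V} (h1 : z.1 ∈ U)
    (h2 : z.2 ≠ 0) (hφ' : ∀ᶠ x in 𝓝 z.1, ContDiffAt ℝ ∞ φ x) (hU : φ z.1 ∈ U')
    (hs : Function.Bijective (fderiv ℝ φ z.1))
    (he : ∀ᶠ x in 𝓝 z.1, ∀ y, e' (φ x, fderiv ℝ φ x y) = e (x, y)) (w : V) :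
    conn H' (φ z.1, fderiv ℝ φ z.1 z.2) (fderiv ℝ φ z.1 w)
      = fderiv ℝ φ z.1 (conn H z w) - fderiv ℝ (fderiv ℝ φ) z.1 z.2 w := by
  have hφ := hφ'.self_of_nhds
  have hnz : ∀ y : V, y ≠ 0 → fderiv ℝ φ z.1 y ≠ 0 := fun y hy =>
    (map_ne_zero_iff _ hs.1).2 hy
  have hl := hasDerivAt_line z (0, w)
  have hl2 : HasDerivWithinAt (fun s : ℝ => z.2 + s • w) w univ 0 := by
    simpa using hasDerivAt_line_snd z (0, w)
  have e1 : HasDerivAt (fun s : ℝ => H' (φ z.1, fderiv ℝ φ z.1 (z.2 + s • w)))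
      (fderiv ℝ H' (φ z.1, fderiv ℝ φ z.1 z.2) (0, fderiv ℝ φ z.1 w)) 0 := by
    have p : HasDerivWithinAt (fun s : ℝ => (φ z.1, fderiv ℝ φ z.1 (z.2 + s • w)))
        (0, fderiv ℝ φ z.1 w) univ 0 :=
      (hasDerivWithinAt_const _ _ _).prodMk
        ((fderiv ℝ φ z.1).hasFDerivAt.comp_hasDerivWithinAt 0 hl2)
    have := h'.deriv_spray (by simpa using hU) (by simpa using hnz _ h2) p
    simpa using this
  have e2 : HasDerivAt (fun s : ℝ => fderiv ℝ φ z.1 (H (z + s • (0, w)))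
      - fderiv ℝ (fderiv ℝ φ) z.1 (z.2 + s • w) (z.2 + s • w))
      (fderiv ℝ φ z.1 (fderiv ℝ H z (0, w)) - (fderiv ℝ (fderiv ℝ φ) z.1 w z.2
        + fderiv ℝ (fderiv ℝ φ) z.1 z.2 w)) 0 := by
    have p1 := (fderiv ℝ φ z.1).hasFDerivAt.comp_hasDerivWithinAt 0
      (h.deriv_spray (by simpa) (by simpa) hl)
    have p2 := ((fderiv ℝ (fderiv ℝ φ) z.1).hasFDerivAt.comp_hasDerivWithinAt 0 hl2).clm_apply hl2
    exact (hasDerivWithinAt_univ.1 (p1.sub p2)).congr_deriv (by simp)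
  have ev : ∀ᶠ s : ℝ in 𝓝 0, H' (φ z.1, fderiv ℝ φ z.1 (z.2 + s • w))
      = fderiv ℝ φ z.1 (H (z + s • (0, w)))
        - fderiv ℝ (fderiv ℝ φ) z.1 (z.2 + s • w) (z.2 + s • w) := by
    have hc : ContinuousAt (fun s : ℝ => z.2 + s • w) 0 := by fun_prop
    have : ∀ᶠ s : ℝ in 𝓝 0, z.2 + s • w ≠ 0 :=
      hc.eventually (isOpen_ne.mem_nhds (by simpa using h2))
    filter_upwards [this] with s k
    have := change_spray (z := z + s • (0, w)) h h' (by simpa) (by simpa using k)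
      (by simpa using hφ') (by simpa using hU) (by simpa using hnz _ k) (by simpa using hs.2)
      (by simpa using he)
    simpa using this
  have e3 := e1.unique (e2.congr_of_eventuallyEq ev)
  rw [snd_derivative_comm hφ w z.2] at e3
  simp only [conn, map_smul, e3, smul_sub, smul_add]
  module

/-- A mixed second derivative Z picks up φ''(X, Y), and N X picks up -φ''(y, X); their contributions
cancel. The boundary term is therefore defined on the manifold, and geodesics need not be cut into
chart-sized pieces. -/
theorem change_boundaryTerm (h : SprayData U e H) (h' : SprayData U' e' H') {z : V × V}
    (h1 : z.1 ∈ U) (h2 : z.2 ≠ 0) (hφ' : ∀ᶠ x in 𝓝 z.1, ContDiffAt ℝ ∞ φ x) (hU : φ z.1 ∈ U')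
    (hs : Function.Bijective (fderiv ℝ φ z.1))
    (he : ∀ᶠ x in 𝓝 z.1, ∀ y, e' (φ x, fderiv ℝ φ x y) = e (x, y)) (X Y Z : V) :
    boundaryTerm e' H' (φ z.1, fderiv ℝ φ z.1 z.2) (fderiv ℝ φ z.1 X) (fderiv ℝ φ z.1 Y)
        (fderiv ℝ φ z.1 Z + fderiv ℝ (fderiv ℝ φ) z.1 X Y) = boundaryTerm e H z X Y Z := by
  have hφ := hφ'.self_of_nhds
  have hne : fderiv ℝ φ z.1 z.2 ≠ 0 := (map_ne_zero_iff _ hs.1).2 h2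
  have k1 := change_snd h h' h1 h2 hφ' hU hne he (X, -conn H z X) Y
  have k2 := change_fst h h' h1 h2 hφ'.self_of_nhds hU hne he (0, Z)
  simp only [boundaryTerm]
  rw [change_conn h h' h1 h2 hφ' hU hs he, h.snd_symm h1 h2, k1, k2, clm_zero_add,
    h'.snd_symm (z := (φ z.1, fderiv ℝ φ z.1 z.2)) hU hne (0, _)]
  simp only [map_zero, zero_apply, zero_add, map_neg, neg_sub, ← sub_eq_add_neg]
  rw [snd_derivative_comm hφ z.2 X]
  ring

end ChangeOfCoordinates

end SprayData

end Spray

end FinslerPEnergy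

namespace FinslerPEnergy

/-! ### The index formulas in terms of the spray -/

section LocalFinsler

open Function (uncurry)

variable {n : ℕ}

local notation "𝔼" => EuclideanSpace ℝ (Fin n)
local notation "ε[" k "]" => EuclideanSpace.single k (1 : ℝ)

/-- The defining properties of a Finsler function in the coordinate domain `U`. -/
structure LocalFinsler (U : Set (EuclideanSpace ℝ (Fin n)))
    (f : EuclideanSpace ℝ (Fin n) → EuclideanSpace ℝ (Fin n) → ℝ) : Prop where
  isOpen : IsOpen U
  smooth : ∀ z : 𝔼 × 𝔼, z.1 ∈ U → z.2 ≠ 0 → ContDiffAt ℝ ∞ (uncurry f) z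
  homogeneous : ∀ x ∈ U, ∀ (r : ℝ) (y : 𝔼), f x (r • y) = |r| * f x y
  posDef : ∀ x ∈ U, ∀ y : 𝔼, y ≠ 0 → (Matrix.of fun i j => gLow f i j x y).PosDef

/-- The energy function `f²/2`. -/
noncomputable def energy (f : 𝔼 → 𝔼 → ℝ) (z : 𝔼 × 𝔼) : ℝ := (1 / 2) * f z.1 z.2 ^ 2

/-- The spray of a Finsler function, solved from the Euler-Lagrange equation of the energy. -/
noncomputable def spray (f : 𝔼 → 𝔼 → ℝ) (z : 𝔼 × 𝔼) : 𝔼 :=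
  WithLp.toLp 2 fun i => ∑ m, gUp f i m z.1 z.2 *
    (fderiv ℝ (fderiv ℝ (energy f)) z (0, ε[m]) (z.2, 0) - fderiv ℝ (energy f) z (ε[m], 0))

theorem sum_coord_smul_single (u : 𝔼) : ∑ k, u k • ε[k] = u := by
  ext i
  simp [Pi.single_apply]

theorem clm_sum_snd {W : Type*} [NormedAddCommGroup W] [NormedSpace ℝ W]
    (L : 𝔼 × 𝔼 →L[ℝ] W) (u : 𝔼) : L (0, u) = ∑ k, u k • L (0, ε[k]) := by
  conv_lhs => rw [← sum_coord_smul_single u]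
  refine (map_sum (L.comp (ContinuousLinearMap.inr ℝ 𝔼 𝔼))
    (fun k => u k • ε[k]) Finset.univ).trans ?_
  exact Finset.sum_congr rfl fun k _ => map_smul (L.comp (ContinuousLinearMap.inr ℝ 𝔼 𝔼)) _ _

theorem clm_sum_fst {W : Type*} [NormedAddCommGroup W] [NormedSpace ℝ W]
    (L : 𝔼 × 𝔼 →L[ℝ] W) (u : 𝔼) : L (u, 0) = ∑ k, u k • L (ε[k], 0) := by
  conv_lhs => rw [← sum_coord_smul_single u]
  refine (map_sum (L.comp (ContinuousLinearMap.inl ℝ 𝔼 𝔼))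
    (fun k => u k • ε[k]) Finset.univ).trans ?_
  exact Finset.sum_congr rfl fun k _ => map_smul (L.comp (ContinuousLinearMap.inl ℝ 𝔼 𝔼)) _ _

/-- Applied with A = -N, it recombines the horizontal lifts (ε_k, -N ε_k) of the basis vectors into
the lift of u. -/
theorem clm_sum_pair {W : Type*} [NormedAddCommGroup W] [NormedSpace ℝ W]
    (L : 𝔼 × 𝔼 →L[ℝ] W) (A : 𝔼 →L[ℝ] 𝔼) (u : 𝔼) :
    L (u, A u) = ∑ k, u k • L (ε[k], A ε[k]) := by
  conv_lhs => rw [← sum_coord_smul_single u]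
  refine (map_sum (L.comp ((ContinuousLinearMap.id ℝ 𝔼).prod A))
    (fun k => u k • ε[k]) Finset.univ).trans ?_
  exact Finset.sum_congr rfl fun k _ => map_smul (L.comp ((ContinuousLinearMap.id ℝ 𝔼).prod A)) _ _

theorem dX_eq {h : 𝔼 → 𝔼 → ℝ} {z : 𝔼 × 𝔼} (hd : DifferentiableAt ℝ (uncurry h) z) (k : Fin n) :
    dX k h z.1 z.2 = fderiv ℝ (uncurry h) z (ε[k], 0) := by
  have h1 : HasFDerivAt (fun x : 𝔼 => (x, z.2)) (ContinuousLinearMap.inl ℝ 𝔼 𝔼) z.1 :=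
    hasFDerivAt_prodMk_left z.1 z.2
  have := (HasFDerivAt.comp z.1 (f := fun x : 𝔼 => (x, z.2)) hd.hasFDerivAt h1).fderiv
  simp only [dX]
  exact congrArg (fun L => L ε[k]) this

theorem dY_eq {h : 𝔼 → 𝔼 → ℝ} {z : 𝔼 × 𝔼} (hd : DifferentiableAt ℝ (uncurry h) z) (k : Fin n) :
    dY k h z.1 z.2 = fderiv ℝ (uncurry h) z (0, ε[k]) := by
  have h1 : HasFDerivAt (fun y : 𝔼 => (z.1, y)) (ContinuousLinearMap.inr ℝ 𝔼 𝔼) z.2 :=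
    hasFDerivAt_prodMk_right z.1 z.2
  have := (HasFDerivAt.comp z.2 (f := fun y : 𝔼 => (z.1, y)) hd.hasFDerivAt h1).fderiv
  simp only [dY]
  exact congrArg (fun L => L ε[k]) this

theorem dX_eq_of_eventuallyEq {h : 𝔼 → 𝔼 → ℝ} {h' : 𝔼 × 𝔼 → ℝ} {z : 𝔼 × 𝔼}
    (he : uncurry h =ᶠ[𝓝 z] h') (hd : DifferentiableAt ℝ h' z) (k : Fin n) :
    dX k h z.1 z.2 = fderiv ℝ h' z (ε[k], 0) := by
  rw [dX_eq (he.differentiableAt_iff.2 hd), he.fderiv_eq]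

theorem dY_eq_of_eventuallyEq {h : 𝔼 → 𝔼 → ℝ} {h' : 𝔼 × 𝔼 → ℝ} {z : 𝔼 × 𝔼}
    (he : uncurry h =ᶠ[𝓝 z] h') (hd : DifferentiableAt ℝ h' z) (k : Fin n) :
    dY k h z.1 z.2 = fderiv ℝ h' z (0, ε[k]) := by
  rw [dY_eq (he.differentiableAt_iff.2 hd), he.fderiv_eq]

theorem contDiffAt_fderiv_apply {h : 𝔼 × 𝔼 → ℝ} {z : 𝔼 × 𝔼} (hs : ContDiffAt ℝ ∞ h z)
    (a : 𝔼 × 𝔼) : ContDiffAt ℝ ∞ (fun z => fderiv ℝ h z a) z :=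
  (contDiffAt_fderiv_top hs).clm_apply contDiffAt_const

theorem fderiv_metric {V : Type*} [NormedAddCommGroup V] [NormedSpace ℝ V] {e : V × V → ℝ}
    {z : V × V} (hs : ContDiffAt ℝ ∞ e z) (a : V × V) (u w : V) :
    fderiv ℝ (fun z => metric e z u w) z a
      = fderiv ℝ (fderiv ℝ (fderiv ℝ e)) z a (0, u) (0, w) := by
  have h2 := contDiffAt_fderiv_top (contDiffAt_fderiv_top hs)
  have := ((h2.differentiableAt (by simp)).hasFDerivAt.clm_apply
    (hasFDerivAt_const ((0, u) : V × V) z)).clm_apply (hasFDerivAt_const ((0, w) : V × V) z)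
  unfold metric
  rw [this.fderiv]
  simp

theorem fderiv_fderiv_apply {A B : Type*} [NormedAddCommGroup A] [NormedSpace ℝ A]
    [NormedAddCommGroup B] [NormedSpace ℝ B] {h : A → B} {z : A} (hs : ContDiffAt ℝ ∞ h z)
    (a b : A) : fderiv ℝ (fun z => fderiv ℝ h z a) z b = fderiv ℝ (fderiv ℝ h) z b a := by
  have := ((contDiffAt_fderiv_top hs).differentiableAt (by simp)).hasFDerivAt.clm_apply
    (hasFDerivAt_const a z)
  rw [this.fderiv]
  simp

namespace LocalFinsler

variable {U : Set (EuclideanSpace ℝ (Fin n))}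
  {f : EuclideanSpace ℝ (Fin n) → EuclideanSpace ℝ (Fin n) → ℝ}

theorem eventually_mem (h : LocalFinsler U f) {z : 𝔼 × 𝔼} (h1 : z.1 ∈ U) (h2 : z.2 ≠ 0) :
    ∀ᶠ z' : 𝔼 × 𝔼 in 𝓝 z, z'.1 ∈ U ∧ z'.2 ≠ 0 :=
  (continuous_fst.continuousAt.eventually (h.isOpen.mem_nhds h1)).and
    (continuous_snd.continuousAt.eventually (isOpen_ne.mem_nhds h2))

theorem smooth_energy (h : LocalFinsler U f) (z : 𝔼 × 𝔼) (h1 : z.1 ∈ U) (h2 : z.2 ≠ 0) :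
    ContDiffAt ℝ ∞ (energy f) z :=
  contDiffAt_const.mul ((h.smooth z h1 h2).pow 2)

theorem gLow_eq (h : LocalFinsler U f) {z : 𝔼 × 𝔼} (h1 : z.1 ∈ U) (h2 : z.2 ≠ 0) (i j : Fin n) :
    gLow f i j z.1 z.2 = metric (energy f) z ε[i] ε[j] := by
  have e1 : uncurry (dY j fun x y => f x y ^ 2)
      =ᶠ[𝓝 z] fun z => 2 * fderiv ℝ (energy f) z (0, ε[j]) := by
    filter_upwards [h.eventually_mem h1 h2] with z' hz
    have hd := (h.smooth_energy z' hz.1 hz.2).differentiableAt (by simp)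
    have := dY_eq_of_eventuallyEq (h := fun x y => f x y ^ 2) (h' := fun z => 2 * energy f z)
      (z := z') (Eventually.of_forall fun z => by simp [energy, uncurry]) (hd.const_mul 2) j
    rw [uncurry, this, fderiv_const_mul hd]
    simp
  have hs := h.smooth_energy z h1 h2
  have hd := (contDiffAt_fderiv_apply hs (0, ε[j])).differentiableAt (by simp)
  rw [gLow, dY_eq_of_eventuallyEq e1 (hd.const_mul 2), fderiv_const_mul hd, smul_apply,
    fderiv_fderiv_apply hs, metric]
  simp

theorem gLow_eventuallyEq (h : LocalFinsler U f) {z : 𝔼 × 𝔼} (h1 : z.1 ∈ U) (h2 : z.2 ≠ 0)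
    (i j : Fin n) : uncurry (gLow f i j) =ᶠ[𝓝 z] fun z => metric (energy f) z ε[i] ε[j] :=
  (h.eventually_mem h1 h2).mono fun _ hz => h.gLow_eq hz.1 hz.2 i j

theorem contDiffAt_metric (h : LocalFinsler U f) {z : 𝔼 × 𝔼} (h1 : z.1 ∈ U) (h2 : z.2 ≠ 0)
    (u w : 𝔼) : ContDiffAt ℝ ∞ (fun z => metric (energy f) z u w) z :=
  ((contDiffAt_fderiv_top (contDiffAt_fderiv_top (h.smooth_energy z h1 h2))).clm_apply
    contDiffAt_const).clm_apply contDiffAt_const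

theorem smooth_gLow (h : LocalFinsler U f) {z : 𝔼 × 𝔼} (h1 : z.1 ∈ U) (h2 : z.2 ≠ 0)
    (i j : Fin n) : ContDiffAt ℝ ∞ (uncurry (gLow f i j)) z :=
  (h.contDiffAt_metric h1 h2 _ _).congr_of_eventuallyEq (h.gLow_eventuallyEq h1 h2 i j)

theorem det_ne_zero (h : LocalFinsler U f) {z : 𝔼 × 𝔼} (h1 : z.1 ∈ U) (h2 : z.2 ≠ 0) :
    (Matrix.of fun i j => gLow f i j z.1 z.2).det ≠ 0 :=
  (h.posDef z.1 h1 z.2 h2).det_pos.ne'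

theorem contDiffAt_det {A : Type*} [NormedAddCommGroup A] [NormedSpace ℝ A]
    {M : A → Matrix (Fin n) (Fin n) ℝ} {z : A}
    (hM : ∀ i j, ContDiffAt ℝ ∞ (fun z => M z i j) z) :
    ContDiffAt ℝ ∞ (fun z => (M z).det) z := by
  simp only [Matrix.det_apply]
  exact ContDiffAt.sum fun σ _ => (contDiffAt_prod fun i _ => hM _ _).const_smul _

/-- Cramer's rule: an entry of the inverse is a determinant in the g_ij divided by a nonvanishing
determinant. -/
theorem smooth_gUp (h : LocalFinsler U f) {z : 𝔼 × 𝔼} (h1 : z.1 ∈ U) (h2 : z.2 ≠ 0)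
    (i j : Fin n) : ContDiffAt ℝ ∞ (uncurry (gUp f i j)) z := by
  have e : uncurry (gUp f i j) = fun z : 𝔼 × 𝔼 => ((Matrix.of fun a b => gLow f a b z.1 z.2).det)⁻¹
      * ((Matrix.of fun a b => gLow f a b z.1 z.2).updateRow j (Pi.single i 1)).det := by
    funext z
    simp [uncurry, gUp, Matrix.inv_def, Matrix.adjugate_apply]
  rw [e]
  refine ContDiffAt.mul (ContDiffAt.inv (contDiffAt_det fun a b => h.smooth_gLow h1 h2 a b)
    (h.det_ne_zero h1 h2)) (contDiffAt_det fun a b => ?_)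
  by_cases hab : a = j
  · subst hab; simpa using contDiffAt_const
  · simp only [Matrix.updateRow_ne hab]
    exact h.smooth_gLow h1 h2 a b

theorem metric_sum_left (z : 𝔼 × 𝔼) (u w : 𝔼) :
    metric (energy f) z u w = ∑ i, u i * metric (energy f) z ε[i] w := by
  unfold metric
  rw [clm_sum_snd (W := 𝔼 × 𝔼 →L[ℝ] ℝ) _ u]
  simp

theorem metric_sum_right (z : 𝔼 × 𝔼) (u w : 𝔼) :
    metric (energy f) z u w = ∑ i, w i * metric (energy f) z u ε[i] := by
  unfold metric
  rw [clm_sum_snd _ w]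
  simp

theorem sum_gLow (h : LocalFinsler U f) {z : 𝔼 × 𝔼} (h1 : z.1 ∈ U) (h2 : z.2 ≠ 0) (u w : 𝔼) :
    ∑ i, ∑ j, gLow f i j z.1 z.2 * u i * w j = metric (energy f) z u w := by
  rw [metric_sum_left]
  refine Finset.sum_congr rfl fun i _ => ?_
  rw [metric_sum_right, Finset.mul_sum]
  refine Finset.sum_congr rfl fun j _ => ?_
  rw [h.gLow_eq h1 h2]; ring

theorem raise_index (h : LocalFinsler U f) {z : 𝔼 × 𝔼} (h1 : z.1 ∈ U) (h2 : z.2 ≠ 0) (w : 𝔼)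
    (i : Fin n) : ∑ m, gUp f i m z.1 z.2 * metric (energy f) z w ε[m] = w i := by
  have hinv := Matrix.nonsing_inv_mul (Matrix.of fun a b => gLow f a b z.1 z.2)
    (h.det_ne_zero h1 h2).isUnit
  have hv : (Matrix.of fun a b => gLow f a b z.1 z.2).mulVec w
      = fun m => metric (energy f) z w ε[m] := by
    funext m
    rw [metric_sum_left]
    change ∑ j, gLow f m j z.1 z.2 * w j = _
    refine Finset.sum_congr rfl fun j _ => ?_
    rw [h.gLow_eq h1 h2, metric, metric, snd_derivative_comm (h.smooth_energy z h1 h2)]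
    ring
  have := congrArg (fun A => Matrix.mulVec A w) hinv
  simp only [← Matrix.mulVec_mulVec, hv, Matrix.one_mulVec] at this
  exact congrFun this i

theorem lower_index (h : LocalFinsler U f) {z : 𝔼 × 𝔼} (h1 : z.1 ∈ U) (h2 : z.2 ≠ 0)
    (b : Fin n → ℝ) (j : Fin n) :
    metric (energy f) z (WithLp.toLp 2 fun i => ∑ m, gUp f i m z.1 z.2 * b m) ε[j] = b j := by
  have hinv := Matrix.mul_nonsing_inv (Matrix.of fun a b => gLow f a b z.1 z.2)
    (h.det_ne_zero h1 h2).isUnit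
  have := congrFun (congrArg (fun A => Matrix.mulVec A b) hinv) j
  simp only [← Matrix.mulVec_mulVec, Matrix.one_mulVec] at this
  rw [← this, metric_sum_left]
  refine Finset.sum_congr rfl fun i _ => ?_
  rw [metric, snd_derivative_comm (h.smooth_energy z h1 h2), mul_comm]
  exact congrArg₂ _ (h.gLow_eq h1 h2 j i).symm rfl

theorem smooth_spray (h : LocalFinsler U f) (z : 𝔼 × 𝔼) (h1 : z.1 ∈ U) (h2 : z.2 ≠ 0) :
    ContDiffAt ℝ ∞ (spray f) z := by
  have hs := contDiffAt_fderiv_top (h.smooth_energy z h1 h2)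
  refine contDiffAt_piLp' _ fun i => ?_
  simp only [spray]
  refine ContDiffAt.sum fun m _ => (h.smooth_gUp h1 h2 i m).mul (ContDiffAt.sub ?_ ?_)
  · exact ((contDiffAt_fderiv_top hs).clm_apply contDiffAt_const).clm_apply
      (contDiffAt_snd.prodMk contDiffAt_const)
  · exact hs.clm_apply contDiffAt_const

/-- Derivative at r = 1 of r ↦ e(x, r y) = r² e(x, y); the absolute value in the homogeneity of f
disappears on squaring. -/
theorem euler_energy (h : LocalFinsler U f) (z : 𝔼 × 𝔼) (h1 : z.1 ∈ U) (h2 : z.2 ≠ 0) :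
    fderiv ℝ (energy f) z (0, z.2) = 2 * energy f z := by
  have e1 := ((h.smooth_energy z h1 h2).differentiableAt (by simp)).hasFDerivAt
  have hl : HasDerivAt (fun r : ℝ => ((z.1, r • z.2) : 𝔼 × 𝔼)) (0, z.2) 1 :=
    (hasDerivAt_const _ _).prodMk (by simpa using (hasDerivAt_id (1 : ℝ)).smul_const z.2)
  have e2 := HasFDerivAt.comp_hasDerivAt (f := fun r : ℝ => ((z.1, r • z.2) : 𝔼 × 𝔼)) 1
    (by simpa using e1) hl
  have e3 : HasDerivAt (fun r : ℝ => r ^ 2 * energy f z) (2 * energy f z) 1 := by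
    simpa using ((hasDerivAt_pow 2 (1 : ℝ)).mul_const (energy f z))
  refine e2.unique (e3.congr_of_eventuallyEq (Eventually.of_forall fun r => ?_))
  simp only [Function.comp, energy, h.homogeneous z.1 h1]
  rw [mul_pow, sq_abs]; ring

/-- The bridge to the index-free part. The Euler-Lagrange identity holds by the construction of
`spray`, since lowering undoes raising, and positivity is positive definiteness of the matrix g_ij.
-/
theorem sprayData (h : LocalFinsler U f) : SprayData U (energy f) (spray f) where
  isOpen := h.isOpen
  smooth_energy := h.smooth_energy
  smooth_spray := h.smooth_spray
  euler := h.euler_energy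
  eulerLagrange z h1 h2 w := by
    change metric (energy f) z (spray f z) w = _
    rw [metric_sum_right, clm_sum_fst (fderiv ℝ (energy f) z) w,
      clm_sum_snd (W := 𝔼 × 𝔼 →L[ℝ] ℝ) _ w, sum_apply,
      ← Finset.sum_sub_distrib]
    refine Finset.sum_congr rfl fun j _ => ?_
    rw [spray, h.lower_index h1 h2 (fun m =>
      fderiv ℝ (fderiv ℝ (energy f)) z (0, ε[m]) (z.2, 0) - fderiv ℝ (energy f) z (ε[m], 0)),
      smul_apply, smul_eq_mul, smul_eq_mul]
    ring
  pos z h1 h2 w hw := by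
    change 0 < metric (energy f) z w w
    rw [← h.sum_gLow h1 h2]
    have := (h.posDef z.1 h1 z.2 h2).dotProduct_mulVec_pos (x := w.ofLp)
      (by simpa using hw)
    refine this.trans_eq ?_
    simp only [dotProduct, Matrix.mulVec, Finset.mul_sum]
    refine Finset.sum_congr rfl fun i _ => Finset.sum_congr rfl fun j _ => ?_
    simp; ring

theorem dX_gLow (h : LocalFinsler U f) {z : 𝔼 × 𝔼} (h1 : z.1 ∈ U) (h2 : z.2 ≠ 0)
    (i j k : Fin n) : dX k (gLow f i j) z.1 z.2
      = fderiv ℝ (fderiv ℝ (fderiv ℝ (energy f))) z (ε[k], 0) (0, ε[i]) (0, ε[j]) := by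
  rw [dX_eq_of_eventuallyEq (h.gLow_eventuallyEq h1 h2 i j)
    ((h.contDiffAt_metric h1 h2 _ _).differentiableAt (by simp)),
    fderiv_metric (h.smooth_energy z h1 h2)]

theorem dY_gLow (h : LocalFinsler U f) {z : 𝔼 × 𝔼} (h1 : z.1 ∈ U) (h2 : z.2 ≠ 0)
    (i j k : Fin n) : dY k (gLow f i j) z.1 z.2
      = fderiv ℝ (fderiv ℝ (fderiv ℝ (energy f))) z (0, ε[k]) (0, ε[i]) (0, ε[j]) := by
  rw [dY_eq_of_eventuallyEq (h.gLow_eventuallyEq h1 h2 i j)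
    ((h.contDiffAt_metric h1 h2 _ _).differentiableAt (by simp)),
    fderiv_metric (h.smooth_energy z h1 h2)]

/-! ### Contractions of the connection coefficients with the direction -/

theorem sum_mul_clm_snd (L : 𝔼 × 𝔼 →L[ℝ] ℝ) (u : 𝔼) : ∑ k, L (0, ε[k]) * u k = L (0, u) := by
  rw [clm_sum_snd L u]; simp [mul_comm]

/-- The first two derivative terms contract to the same quantity. Homogeneity lowers each third
derivative of e to a second one, and the last of these to 2 ∂e/∂x, which leaves twice the
Euler-Lagrange expression defining `spray`. -/
theorem sum_christoffel (h : LocalFinsler U f) {z : 𝔼 × 𝔼} (h1 : z.1 ∈ U) (h2 : z.2 ≠ 0)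
    (i : Fin n) : ∑ k, ∑ l, christoffel f i k l z.1 z.2 * z.2 k * z.2 l = spray f z i := by
  have hS := h.sprayData
  have hT : ∀ m, ∑ k, ∑ l, (dX k (gLow f m l) z.1 z.2 + dX l (gLow f k m) z.1 z.2
      - dX m (gLow f k l) z.1 z.2) * z.2 k * z.2 l
      = 2 * (fderiv ℝ (fderiv ℝ (energy f)) z (0, ε[m]) (z.2, 0)
        - fderiv ℝ (energy f) z (ε[m], 0)) := by
    intro m
    set T := fderiv ℝ (fderiv ℝ (fderiv ℝ (energy f))) z with hT
    have t1 : ∑ k, ∑ l, dX k (gLow f m l) z.1 z.2 * z.2 k * z.2 l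
        = T (z.2, 0) (0, ε[m]) (0, z.2) := by
      rw [clm_sum_fst (W := 𝔼 × 𝔼 →L[ℝ] 𝔼 × 𝔼 →L[ℝ] ℝ) T z.2]
      simp only [sum_apply, smul_apply, smul_eq_mul]
      refine Finset.sum_congr rfl fun k _ => ?_
      rw [← sum_mul_clm_snd _ z.2, Finset.mul_sum]
      refine Finset.sum_congr rfl fun l _ => ?_
      rw [h.dX_gLow h1 h2]; ring
    have t2 : ∑ k, ∑ l, dX l (gLow f k m) z.1 z.2 * z.2 k * z.2 l
        = T (z.2, 0) (0, ε[m]) (0, z.2) := by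
      rw [← t1, Finset.sum_comm]
      refine Finset.sum_congr rfl fun k _ => Finset.sum_congr rfl fun l _ => ?_
      rw [h.dX_gLow h1 h2, h.dX_gLow h1 h2, hS.third_symm_right h1 h2]; ring
    have t3 : ∑ k, ∑ l, dX m (gLow f k l) z.1 z.2 * z.2 k * z.2 l
        = T (ε[m], 0) (0, z.2) (0, z.2) := by
      rw [clm_sum_snd (W := 𝔼 × 𝔼 →L[ℝ] ℝ) (T (ε[m], 0)) z.2]
      simp only [sum_apply, smul_apply, smul_eq_mul]
      refine Finset.sum_congr rfl fun k _ => ?_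
      rw [← sum_mul_clm_snd _ z.2, Finset.mul_sum]
      refine Finset.sum_congr rfl fun l _ => ?_
      rw [h.dX_gLow h1 h2]; ring
    simp only [add_mul, sub_mul, Finset.sum_add_distrib, Finset.sum_sub_distrib]
    have z0 : ((0 : 𝔼), (0 : 𝔼)) = 0 := rfl
    rw [t1, t2, t3, hS.euler_third_hor h1 h2, hS.euler_third_hor h1 h2, hS.euler_snd h1 h2,
      hS.snd_symm h1 h2 (0, ε[m])]
    simp only [z0, map_zero]
    ring
  have e : ∀ k l, christoffel f i k l z.1 z.2 * z.2 k * z.2 l = ∑ m, (1 / 2) * gUp f i m z.1 z.2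
      * ((dX k (gLow f m l) z.1 z.2 + dX l (gLow f k m) z.1 z.2
      - dX m (gLow f k l) z.1 z.2) * z.2 k * z.2 l) := by
    intro k l
    rw [christoffel, Finset.mul_sum, Finset.sum_mul, Finset.sum_mul]
    exact Finset.sum_congr rfl fun m _ => by ring
  simp only [e]
  calc _ = ∑ m, ∑ k, ∑ l, (1 / 2) * gUp f i m z.1 z.2
      * ((dX k (gLow f m l) z.1 z.2 + dX l (gLow f k m) z.1 z.2
      - dX m (gLow f k l) z.1 z.2) * z.2 k * z.2 l) := by
        rw [Finset.sum_comm]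
        rw [Finset.sum_congr rfl fun l _ => Finset.sum_comm]
        rw [Finset.sum_comm]
        exact Finset.sum_congr rfl fun m _ => Finset.sum_comm
    _ = _ := by
        refine Finset.sum_congr rfl fun m _ => ?_
        simp only [← Finset.mul_sum]
        rw [hT]; ring

theorem fderiv_coord {A : Type*} [NormedAddCommGroup A] [NormedSpace ℝ A] {G : A → 𝔼} {z : A}
    (hG : DifferentiableAt ℝ G z) (i : Fin n) (a : A) :
    fderiv ℝ (fun z => G z i) z a = fderiv ℝ G z a i := by
  have := (EuclideanSpace.proj (𝕜 := ℝ) i).hasFDerivAt.comp z hG.hasFDerivAt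
  exact congrArg (fun L => L a) this.fderiv

theorem contDiffAt_coord {A : Type*} [NormedAddCommGroup A] [NormedSpace ℝ A] {G : A → 𝔼} {z : A}
    (hG : ContDiffAt ℝ ∞ G z) (i : Fin n) : ContDiffAt ℝ ∞ (fun z => G z i) z :=
  (EuclideanSpace.proj (𝕜 := ℝ) i).contDiff.contDiffAt.comp z hG

theorem nonlin_eq (h : LocalFinsler U f) {z : 𝔼 × 𝔼} (h1 : z.1 ∈ U) (h2 : z.2 ≠ 0)
    (i j : Fin n) : nonlin f i j z.1 z.2 = conn (spray f) z ε[j] i := by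
  have hd := (contDiffAt_coord (h.smooth_spray z h1 h2) i).differentiableAt (by simp)
  rw [nonlin, dY_eq_of_eventuallyEq (h' := fun z => spray f z i) ?_ hd,
    fderiv_coord ((h.smooth_spray z h1 h2).differentiableAt (by simp)), conn]
  · simp
  · filter_upwards [h.eventually_mem h1 h2] with z' hz
    exact h.sum_christoffel hz.1 hz.2 i

/-- The nonlinear connection as a linear map. -/
noncomputable def _root_.FinslerPEnergy.connL (H : 𝔼 × 𝔼 → 𝔼) (z : 𝔼 × 𝔼) : 𝔼 →L[ℝ] 𝔼 :=
  (1 / 2 : ℝ) • (fderiv ℝ H z).comp (ContinuousLinearMap.inr ℝ 𝔼 𝔼)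

theorem conn_sum (H : 𝔼 × 𝔼 → 𝔼) (z : 𝔼 × 𝔼) (w : 𝔼) :
    conn H z w = ∑ k, w k • conn H z ε[k] := by
  simp only [conn]
  rw [clm_sum_snd _ w, Finset.smul_sum]
  exact Finset.sum_congr rfl fun k _ => smul_comm _ _ _

theorem sum_nonlin (h : LocalFinsler U f) {z : 𝔼 × 𝔼} (h1 : z.1 ∈ U) (h2 : z.2 ≠ 0)
    (i : Fin n) (w : 𝔼) : ∑ j, nonlin f i j z.1 z.2 * w j = conn (spray f) z w i := by
  rw [conn_sum _ _ w]
  simp [h.nonlin_eq h1 h2, mul_comm]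

theorem smooth_conn (h : LocalFinsler U f) {z : 𝔼 × 𝔼} (h1 : z.1 ∈ U) (h2 : z.2 ≠ 0) (w : 𝔼) :
    ContDiffAt ℝ ∞ (fun z => conn (spray f) z w) z :=
  ((contDiffAt_fderiv_top (h.smooth_spray z h1 h2)).clm_apply contDiffAt_const).const_smul _

theorem nonlin_eventuallyEq (h : LocalFinsler U f) {z : 𝔼 × 𝔼} (h1 : z.1 ∈ U) (h2 : z.2 ≠ 0)
    (i j : Fin n) : uncurry (nonlin f i j) =ᶠ[𝓝 z] fun z => conn (spray f) z ε[j] i :=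
  (h.eventually_mem h1 h2).mono fun _ hz => h.nonlin_eq hz.1 hz.2 i j

theorem dH_eq (h : LocalFinsler U f) {z : 𝔼 × 𝔼} (h1 : z.1 ∈ U) (h2 : z.2 ≠ 0)
    {q : 𝔼 → 𝔼 → ℝ} {q' : 𝔼 × 𝔼 → ℝ} (he : uncurry q =ᶠ[𝓝 z] q')
    (hd : DifferentiableAt ℝ q' z) (k : Fin n) :
    dH f k q z.1 z.2 = fderiv ℝ q' z (ε[k], -conn (spray f) z ε[k]) := by
  rw [dH, dX_eq_of_eventuallyEq he hd, clm_prod_neg, ← sum_mul_clm_snd _ (conn (spray f) z ε[k])]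
  congr 1
  refine Finset.sum_congr rfl fun l _ => ?_
  rw [dY_eq_of_eventuallyEq he hd, h.nonlin_eq h1 h2, mul_comm]

theorem smooth_dH (h : LocalFinsler U f) {z : 𝔼 × 𝔼} (h1 : z.1 ∈ U) (h2 : z.2 ≠ 0)
    {q : 𝔼 → 𝔼 → ℝ} (hq : ∀ z : 𝔼 × 𝔼, z.1 ∈ U → z.2 ≠ 0 → ContDiffAt ℝ ∞ (uncurry q) z)
    (k : Fin n) : ContDiffAt ℝ ∞ (uncurry (dH f k q)) z := by
  have : ContDiffAt ℝ ∞
      (fun z => fderiv ℝ (uncurry q) z (ε[k], -conn (spray f) z ε[k])) z :=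
    (contDiffAt_fderiv_top (hq z h1 h2)).clm_apply
      (contDiffAt_const.prodMk (h.smooth_conn h1 h2 _).neg)
  refine this.congr_of_eventuallyEq ((h.eventually_mem h1 h2).mono fun z' hz => ?_)
  exact h.dH_eq hz.1 hz.2 (EventuallyEq.refl _ _)
    ((hq z' hz.1 hz.2).differentiableAt (by simp)) k

theorem dH_gLow (h : LocalFinsler U f) {z : 𝔼 × 𝔼} (h1 : z.1 ∈ U) (h2 : z.2 ≠ 0)
    (i j k : Fin n) : dH f k (gLow f i j) z.1 z.2
      = fderiv ℝ (fderiv ℝ (fderiv ℝ (energy f))) z (ε[k], -conn (spray f) z ε[k])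
        (0, ε[i]) (0, ε[j]) := by
  rw [h.dH_eq h1 h2 (h.gLow_eventuallyEq h1 h2 i j)
    ((h.contDiffAt_metric h1 h2 _ _).differentiableAt (by simp)),
    fderiv_metric (h.smooth_energy z h1 h2)]

theorem cartanL_comm (h : LocalFinsler U f) {z : 𝔼 × 𝔼} (h1 : z.1 ∈ U) (h2 : z.2 ≠ 0)
    (i j k : Fin n) : cartanL f i j k z.1 z.2 = cartanL f i k j z.1 z.2 := by
  simp only [cartanL, h.dH_gLow h1 h2]
  congr 1
  refine Finset.sum_congr rfl fun m _ => ?_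
  rw [h.sprayData.third_symm_right h1 h2 _ (0, ε[m]), h.sprayData.third_symm_right h1 h2 _ (0, ε[j])
    (0, ε[m]), h.sprayData.third_symm_right h1 h2 _ (0, ε[j]) (0, ε[k])]
  ring

/-- Contracting with y turns δ/δxᵏ into the derivative along the spray, because N y = H. In the
other two terms the vertical parts vanish by homogeneity, and `metric_conn` is what remains. -/
theorem sum_cartanL (h : LocalFinsler U f) {z : 𝔼 × 𝔼} (h1 : z.1 ∈ U) (h2 : z.2 ≠ 0)
    (i j : Fin n) : ∑ k, cartanL f i j k z.1 z.2 * z.2 k = nonlin f i j z.1 z.2 := by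
  have hS := h.sprayData
  rw [h.nonlin_eq h1 h2, ← h.raise_index h1 h2 (conn (spray f) z ε[j]) i]
  have e : ∀ k, cartanL f i j k z.1 z.2 * z.2 k = ∑ m, (1 / 2) * gUp f i m z.1 z.2
      * ((dH f j (gLow f m k) z.1 z.2 + dH f k (gLow f j m) z.1 z.2
      - dH f m (gLow f j k) z.1 z.2) * z.2 k) := by
    intro k
    rw [cartanL, Finset.mul_sum, Finset.sum_mul]
    exact Finset.sum_congr rfl fun m _ => by ring
  simp only [e]
  rw [Finset.sum_comm]
  refine Finset.sum_congr rfl fun m _ => ?_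
  rw [← Finset.mul_sum]
  simp only [add_mul, sub_mul, Finset.sum_add_distrib, Finset.sum_sub_distrib, h.dH_gLow h1 h2]
  have e2 : ∑ k, fderiv ℝ (fderiv ℝ (fderiv ℝ (energy f))) z (ε[k], -conn (spray f) z ε[k])
      (0, ε[j]) (0, ε[m]) * z.2 k = fderiv ℝ (fderiv ℝ (fderiv ℝ (energy f))) z
      (z.2, -spray f z) (0, ε[j]) (0, ε[m]) := by
    have := clm_sum_pair (W := 𝔼 × 𝔼 →L[ℝ] 𝔼 × 𝔼 →L[ℝ] ℝ)
      (fderiv ℝ (fderiv ℝ (fderiv ℝ (energy f))) z) (-connL (spray f) z) z.2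
    have c : ∀ w, (-connL (spray f) z) w = -conn (spray f) z w := fun w => rfl
    simp only [c, hS.conn_self h1 h2] at this
    rw [this]
    simp [mul_comm]
  rw [sum_mul_clm_snd, sum_mul_clm_snd, e2, clm_prod_neg (W := 𝔼 × 𝔼 →L[ℝ] 𝔼 × 𝔼 →L[ℝ] ℝ) _ ε[j],
    clm_prod_neg (W := 𝔼 × 𝔼 →L[ℝ] 𝔼 × 𝔼 →L[ℝ] ℝ) _ ε[m], sub_apply, sub_apply, sub_apply,
    sub_apply, hS.euler_third_vert h1 h2, hS.euler_third_vert h1 h2, hS.euler_third_hor h1 h2,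
    hS.euler_third_hor h1 h2]
  have := hS.metric_conn h1 h2 ε[j] ε[m]
  rw [hS.snd_symm h1 h2 (0, ε[j]), hS.snd_symm h1 h2 (0, ε[m])] at this
  rw [mul_right_comm, mul_comm]
  linear_combination (-(1 / 2) * gUp f i m z.1 z.2) * this

/-- Each of the three terms is the totally symmetric Cartan tensor evaluated on y, which is zero. -/
theorem sum_cartanC (h : LocalFinsler U f) {z : 𝔼 × 𝔼} (h1 : z.1 ∈ U) (h2 : z.2 ≠ 0)
    (i k : Fin n) : ∑ j, cartanC f i j k z.1 z.2 * z.2 j = 0 := by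
  have hS := h.sprayData
  have e : ∀ j, cartanC f i j k z.1 z.2 * z.2 j = ∑ m, (1 / 2) * gUp f i m z.1 z.2
      * ((dY j (gLow f m k) z.1 z.2 + dY k (gLow f j m) z.1 z.2
      - dY m (gLow f j k) z.1 z.2) * z.2 j) := by
    intro j
    rw [cartanC, Finset.mul_sum, Finset.sum_mul]
    exact Finset.sum_congr rfl fun m _ => by ring
  simp only [e]
  rw [Finset.sum_comm]
  refine Finset.sum_eq_zero fun m _ => ?_
  rw [← Finset.mul_sum]
  have e1 : ∀ j, dY j (gLow f m k) z.1 z.2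
      = fderiv ℝ (fderiv ℝ (fderiv ℝ (energy f))) z (0, ε[m]) (0, ε[k]) (0, ε[j]) := fun j => by
    rw [h.dY_gLow h1 h2, hS.third_symm_left h1 h2, hS.third_symm_right h1 h2]
  have e2 : ∀ j, dY k (gLow f j m) z.1 z.2
      = fderiv ℝ (fderiv ℝ (fderiv ℝ (energy f))) z (0, ε[k]) (0, ε[m]) (0, ε[j]) := fun j => by
    rw [h.dY_gLow h1 h2, hS.third_symm_right h1 h2]
  have e3 : ∀ j, dY m (gLow f j k) z.1 z.2
      = fderiv ℝ (fderiv ℝ (fderiv ℝ (energy f))) z (0, ε[m]) (0, ε[k]) (0, ε[j]) := fun j => by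
    rw [h.dY_gLow h1 h2, hS.third_symm_right h1 h2]
  simp only [add_mul, sub_mul, Finset.sum_add_distrib, Finset.sum_sub_distrib, e1, e2, e3]
  rw [sum_mul_clm_snd, sum_mul_clm_snd, hS.euler_third_vert h1 h2, hS.euler_third_vert h1 h2]
  ring

/-! ### Contractions of the curvature -/

theorem smooth_cartanL (h : LocalFinsler U f) {z : 𝔼 × 𝔼} (h1 : z.1 ∈ U) (h2 : z.2 ≠ 0)
    (i j k : Fin n) : ContDiffAt ℝ ∞ (uncurry (cartanL f i j k)) z := by
  have hg : ∀ i j (z : 𝔼 × 𝔼), z.1 ∈ U → z.2 ≠ 0 → ContDiffAt ℝ ∞ (uncurry (gLow f i j)) z :=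
    fun i j z h1 h2 => h.smooth_gLow h1 h2 i j
  exact contDiffAt_const.mul (ContDiffAt.sum fun m _ => (h.smooth_gUp h1 h2 i m).mul
    (((h.smooth_dH h1 h2 (hg m k) j).add (h.smooth_dH h1 h2 (hg j m) k)).sub
      (h.smooth_dH h1 h2 (hg j k) m)))

theorem dH_nonlin (h : LocalFinsler U f) {z : 𝔼 × 𝔼} (h1 : z.1 ∈ U) (h2 : z.2 ≠ 0)
    (i j k : Fin n) : dH f k (nonlin f i j) z.1 z.2
      = ((1 / 2 : ℝ) • fderiv ℝ (fderiv ℝ (spray f)) z (ε[k], -conn (spray f) z ε[k])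
          (0, ε[j])) i := by
  have hs := h.smooth_conn h1 h2 ε[j]
  rw [h.dH_eq h1 h2 (h.nonlin_eventuallyEq h1 h2 i j)
    ((contDiffAt_coord hs i).differentiableAt (by simp)), fderiv_coord (hs.differentiableAt
    (by simp))]
  have hd := ((contDiffAt_fderiv_top (h.smooth_spray z h1 h2)).clm_apply
    (contDiffAt_const (c := ((0, ε[j]) : 𝔼 × 𝔼)))).differentiableAt (by simp)
  have : fderiv ℝ (fun z => conn (spray f) z ε[j]) z
      = (1 / 2 : ℝ) • fderiv ℝ (fun z => fderiv ℝ (spray f) z (0, ε[j])) z :=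
    (hd.hasFDerivAt.const_smul (1 / 2 : ℝ)).fderiv
  rw [this, smul_apply, fderiv_fderiv_apply (h.smooth_spray z h1 h2)]

/-- Product rule for N = L y, with δyˡ/δxᵏ = -Nˡ_k. The correction terms are those that cancel the
products L L in the contracted h-curvature. -/
theorem sum_dH_cartanL (h : LocalFinsler U f) {z : 𝔼 × 𝔼} (h1 : z.1 ∈ U) (h2 : z.2 ≠ 0)
    (i j k : Fin n) : ∑ l, dH f k (cartanL f i l j) z.1 z.2 * z.2 l
      = dH f k (nonlin f i j) z.1 z.2
        + ∑ l, cartanL f i l j z.1 z.2 * nonlin f l k z.1 z.2 := by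
  set a : 𝔼 × 𝔼 := (ε[k], -conn (spray f) z ε[k]) with ha
  have hd : ∀ l, DifferentiableAt ℝ (uncurry (cartanL f i l j)) z :=
    fun l => (h.smooth_cartanL h1 h2 i l j).differentiableAt (by simp)
  have hc : ∀ l, HasFDerivAt (fun z : 𝔼 × 𝔼 => z.2 l)
      ((EuclideanSpace.proj (𝕜 := ℝ) l).comp (ContinuousLinearMap.snd ℝ 𝔼 𝔼)) z := fun l =>
    ((EuclideanSpace.proj (𝕜 := ℝ) l).comp (ContinuousLinearMap.snd ℝ 𝔼 𝔼)).hasFDerivAt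
  have hsum : HasFDerivAt (fun z : 𝔼 × 𝔼 => ∑ l, uncurry (cartanL f i l j) z * z.2 l) _ z :=
    HasFDerivAt.fun_sum (u := Finset.univ) fun l _ => (hd l).hasFDerivAt.mul (hc l)
  have e1 : uncurry (nonlin f i j)
      =ᶠ[𝓝 z] fun z => ∑ l, uncurry (cartanL f i l j) z * z.2 l := by
    filter_upwards [h.eventually_mem h1 h2] with z' hz
    rw [uncurry, ← h.sum_cartanL hz.1 hz.2]
    exact Finset.sum_congr rfl fun l _ => by rw [h.cartanL_comm hz.1 hz.2]; rfl
  rw [h.dH_eq h1 h2 e1 hsum.differentiableAt, ← ha, HasFDerivAt.fderiv hsum, sum_apply,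
    ← Finset.sum_add_distrib]
  refine Finset.sum_congr rfl fun l _ => ?_
  rw [h.dH_eq h1 h2 (EventuallyEq.refl _ _) (hd l), h.nonlin_eq h1 h2]
  simp [← ha]
  simp [ha, uncurry]
  ring

/-- Contraction of the `h`-curvature of the Cartan connection with the supporting element. -/
theorem sum_hCurv (h : LocalFinsler U f) {z : 𝔼 × 𝔼} (h1 : z.1 ∈ U) (h2 : z.2 ≠ 0)
    (i j k : Fin n) : ∑ l, hCurv f i l j k z.1 z.2 * z.2 l = nonlinCurv f i j k z.1 z.2 := by
  simp only [hCurv, add_mul, sub_mul, Finset.sum_add_distrib, Finset.sum_sub_distrib]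
  rw [h.sum_dH_cartanL h1 h2, h.sum_dH_cartanL h1 h2, nonlinCurv]
  have e1 : ∀ j k, ∑ l, (∑ s, cartanL f s l j z.1 z.2 * cartanL f i s k z.1 z.2) * z.2 l
      = ∑ s, cartanL f i s k z.1 z.2 * nonlin f s j z.1 z.2 := by
    intro j k
    simp only [Finset.sum_mul]
    rw [Finset.sum_comm]
    refine Finset.sum_congr rfl fun s _ => ?_
    rw [← h.sum_cartanL h1 h2, Finset.mul_sum]
    refine Finset.sum_congr rfl fun l _ => ?_
    rw [h.cartanL_comm h1 h2 s l j]; ring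
  have e2 : ∑ l, (∑ s, cartanC f i l s z.1 z.2 * nonlinCurv f s j k z.1 z.2) * z.2 l = 0 := by
    simp only [Finset.sum_mul]
    rw [Finset.sum_comm]
    refine Finset.sum_eq_zero fun s _ => ?_
    have := h.sum_cartanC h1 h2 i s
    calc _ = (∑ l, cartanC f i l s z.1 z.2 * z.2 l) * nonlinCurv f s j k z.1 z.2 := by
          rw [Finset.sum_mul]
          exact Finset.sum_congr rfl fun l _ => by ring
      _ = 0 := by rw [this, zero_mul]
  rw [e1, e1, e2]
  ring

/-- The term with N differentiated along y is the derivative of N along the spray. In the other one,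
the horizontal derivative of `euler_spray` removes the second derivative of H and leaves ∂H/∂x w - N
N w. -/
theorem sum_nonlinCurv (h : LocalFinsler U f) {z : 𝔼 × 𝔼} (h1 : z.1 ∈ U) (h2 : z.2 ≠ 0)
    (i : Fin n) (w : 𝔼) : ∑ j, ∑ k, nonlinCurv f i j k z.1 z.2 * z.2 j * w k
      = jacobiEnd (spray f) z w i := by
  have hS := h.sprayData
  set T := fderiv ℝ (fderiv ℝ (spray f)) z with hT
  have c : ∀ w, (-connL (spray f) z) w = -conn (spray f) z w := fun w => rfl
  have g1 : ∀ u v : 𝔼, ∑ k, ∑ j, ((1 / 2 : ℝ) • T (ε[k], -conn (spray f) z ε[k])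
      (0, ε[j])) i * u k * v j = ((1 / 2 : ℝ) • T (u, -conn (spray f) z u) (0, v)) i := by
    intro u v
    have := clm_sum_pair (W := 𝔼 × 𝔼 →L[ℝ] 𝔼) T (-connL (spray f) z) u
    simp only [c] at this
    rw [this, clm_sum_snd _ v]
    simp only [sum_apply, smul_apply, Finset.smul_sum]
    rw [Finset.sum_comm]
    simp [mul_comm, mul_left_comm]
  simp only [nonlinCurv, h.dH_nonlin h1 h2, sub_mul, Finset.sum_sub_distrib]
  have hl := hasDerivAt_line z (w, -conn (spray f) z w)
  have e1 := hS.deriv_fderiv_spray (by simpa) (by simpa) hl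
    (deriv_zero_prod (SprayData.hasDerivAt_line_snd z (w, -conn (spray f) z w)))
  have e2 := (hS.deriv_spray (by simpa) (by simpa) hl).const_smul (2 : ℝ)
  have e3 := line_unique (f := fun z => fderiv ℝ (spray f) z (0, z.2))
    (g := fun z => (2 : ℝ) • spray f z)
    e1 e2 ((h.eventually_mem h1 h2).mono fun z' hz => hS.euler_spray hz.1 hz.2)
  simp only [zero_smul, add_zero] at e3
  have g2 := g1 z.2 w
  rw [hS.conn_self h1 h2] at g2
  have g3 := g1 w z.2
  rw [Finset.sum_comm] at g3
  rw [← hT] at e3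
  rw [eq_sub_of_add_eq e3] at g3
  have g4 : ∑ j, ∑ k, ((1 / 2 : ℝ) • T (ε[k], -conn (spray f) z ε[k]) (0, ε[j])) i * z.2 j * w k
      = ∑ j, ∑ k, ((1 / 2 : ℝ) • T (ε[k], -conn (spray f) z ε[k]) (0, ε[j])) i * w k * z.2 j :=
    Finset.sum_congr rfl fun j _ => Finset.sum_congr rfl fun k _ => by ring
  rw [g4, g3, g2, jacobiEnd, clm_prod_neg (fderiv ℝ (spray f) z), clm_zero_neg, ← hT]
  have g5 : fderiv ℝ (spray f) z (0, conn (spray f) z w)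
      = (2 : ℝ) • conn (spray f) z (conn (spray f) z w) := by
    simp only [conn, smul_smul]; norm_num
  rw [g5]
  simp only [PiLp.sub_apply, PiLp.smul_apply, PiLp.neg_apply, smul_eq_mul]
  ring

end LocalFinsler

end LocalFinsler

end FinslerPEnergy

namespace FinslerPEnergy

/-! ### Charts -/

section Charts

/-- The coordinate change between the charts around `α` and `β`. -/
noncomputable def chartChange (n : ℕ) {M : Type*} [TopologicalSpace M]
    [ChartedSpace (EuclideanSpace ℝ (Fin n)) M] (α β : M) :
    EuclideanSpace ℝ (Fin n) → EuclideanSpace ℝ (Fin n) :=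
  fun x => extChartAt (𝓡 n) β ((extChartAt (𝓡 n) α).symm x)

variable {n : ℕ} {M : Type*} [TopologicalSpace M] [ChartedSpace (EuclideanSpace ℝ (Fin n)) M]
  [IsManifold (𝓡 n) ∞ M]

local notation "𝔼" => EuclideanSpace ℝ (Fin n)

theorem comps_eq_mfderiv {α x : M} (hx : x ∈ (chartAt 𝔼 α).source) (v : TangentSpace (𝓡 n) x) :
    comps α x v = mfderiv (𝓡 n) 𝓘(ℝ, 𝔼) (extChartAt (𝓡 n) α) x v := by
  rw [comps, TangentBundle.continuousLinearMapAt_trivializationAt hx]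
  rfl

theorem comps_ofComps {α x : M} (hx : x ∈ (chartAt 𝔼 α).source) (w : 𝔼) :
    comps α x (ofComps α x w) = w :=
  (trivializationAt 𝔼 (TangentSpace (𝓡 n)) α).continuousLinearMapAt_symmL (R := ℝ)
    (by simpa using hx) w

theorem ofComps_comps {α x : M} (hx : x ∈ (chartAt 𝔼 α).source) (v : TangentSpace (𝓡 n) x) :
    ofComps α x (comps α x v) = v :=
  (trivializationAt 𝔼 (TangentSpace (𝓡 n)) α).symmL_continuousLinearMapAt (R := ℝ)
    (by simpa using hx) v

theorem comps_add (α x : M) (v w : TangentSpace (𝓡 n) x) :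
    comps α x (v + w) = comps α x v + comps α x w := map_add _ _ _

theorem comps_smul (α x : M) (r : ℝ) (v : TangentSpace (𝓡 n) x) :
    comps α x (r • v) = r • comps α x v := map_smul _ _ _

theorem comps_zero (α x : M) : comps (n := n) α x (0 : TangentSpace (𝓡 n) x) = 0 := map_zero _

theorem comps_injective {α x : M} (hx : x ∈ (chartAt 𝔼 α).source) :
    Function.Injective (comps (n := n) α x) :=
  Function.LeftInverse.injective (ofComps_comps hx)

theorem comps_ne_zero {α x : M} (hx : x ∈ (chartAt 𝔼 α).source) {v : TangentSpace (𝓡 n) x}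
    (hv : v ≠ 0) : comps α x v ≠ 0 := fun h =>
  hv (comps_injective hx (h.trans (comps_zero α x).symm))

theorem localF_apply (F : TangentBundle (𝓡 n) M → ℝ) {α x : M} (hx : x ∈ (chartAt 𝔼 α).source)
    (v : TangentSpace (𝓡 n) x) :
    localF F α (extChartAt (𝓡 n) α x) (comps α x v) = F ⟨x, v⟩ := by
  have hl : (extChartAt (𝓡 n) α).symm (extChartAt (𝓡 n) α x) = x :=
    (extChartAt (𝓡 n) α).left_inv (by simpa using hx)
  rw [localF, hl, ofComps_comps hx]

/-- Smoothness of the inverse trivialisation over the chart domain; composing F with it makes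
`localF` smooth off the zero section. -/
theorem contMDiffOn_tangent_symm (α : M) :
    ContMDiffOn 𝓘(ℝ, 𝔼 × 𝔼) (𝓡 n).tangent ∞ (fun z : 𝔼 × 𝔼 =>
      (⟨(extChartAt (𝓡 n) α).symm z.1, ofComps α ((extChartAt (𝓡 n) α).symm z.1) z.2⟩ :
        TangentBundle (𝓡 n) M)) ((extChartAt (𝓡 n) α).target ×ˢ univ) := by
  have h1 : ContMDiffOn 𝓘(ℝ, 𝔼 × 𝔼) ((𝓡 n).prod 𝓘(ℝ, 𝔼)) ∞
      (fun z : 𝔼 × 𝔼 => ((extChartAt (𝓡 n) α).symm z.1, z.2))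
      ((extChartAt (𝓡 n) α).target ×ˢ univ) := by
    refine ContMDiffOn.prodMk ?_ ?_
    · exact (contMDiffOn_extChartAt_symm α).comp contDiff_fst.contMDiff.contMDiffOn
        (fun z hz => hz.1)
    · exact contDiff_snd.contMDiff.contMDiffOn
  have h2 := (trivializationAt 𝔼 (TangentSpace (𝓡 n)) α).contMDiffOn_symm
    (IB := 𝓡 n) (n := ∞)
  have hb : ∀ z ∈ (extChartAt (𝓡 n) α).target ×ˢ (univ : Set 𝔼), (extChartAt (𝓡 n) α).symm z.1
      ∈ (trivializationAt 𝔼 (TangentSpace (𝓡 n)) α).baseSet := fun z hz => by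
    have := (extChartAt (𝓡 n) α).map_target hz.1
    rwa [extChartAt_source] at this
  have h3 := h2.comp h1 (fun z hz =>
    (trivializationAt 𝔼 (TangentSpace (𝓡 n)) α).mem_target.2 (hb z hz))
  refine h3.congr fun z hz => ?_
  rw [ofComps, Bundle.Trivialization.symmL_apply _ (hb z hz)]
  exact (trivializationAt 𝔼 (TangentSpace (𝓡 n)) α).mk_symm (hb z hz) z.2

theorem IsFinsler.localFinsler {F : TangentBundle (𝓡 n) M → ℝ} (hF : IsFinsler F) (α : M) :
    LocalFinsler (extChartAt (𝓡 n) α).target (localF F α) where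
  isOpen := isOpen_extChartAt_target α
  smooth z h1 h2 := by
    have hs : ∀ w : 𝔼, w ≠ 0 → ofComps α ((extChartAt (𝓡 n) α).symm z.1) w ≠ 0 := by
      intro w hw h0
      have hx : (extChartAt (𝓡 n) α).symm z.1 ∈ (chartAt 𝔼 α).source := by
        simpa using (extChartAt (𝓡 n) α).map_target h1
      exact hw (by rw [← comps_ofComps hx w, h0, comps_zero])
    have ho : IsOpen ((extChartAt (𝓡 n) α).target ×ˢ ({0}ᶜ : Set 𝔼)) :=
      (isOpen_extChartAt_target α).prod isOpen_compl_singleton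
    have h3 : ContMDiffOn 𝓘(ℝ, 𝔼 × 𝔼) 𝓘(ℝ, ℝ) ∞ (Function.uncurry (localF F α))
        ((extChartAt (𝓡 n) α).target ×ˢ ({0}ᶜ : Set 𝔼)) := by
      refine hF.smooth.comp ((contMDiffOn_tangent_symm α).mono
        (prod_mono_right (subset_univ _))) fun z hz => ?_
      intro h0
      have hx : (extChartAt (𝓡 n) α).symm z.1 ∈ (chartAt 𝔼 α).source := by
        simpa using (extChartAt (𝓡 n) α).map_target hz.1
      exact hz.2 (by
        change z.2 = 0
        rw [← comps_ofComps hx z.2]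
        exact (congrArg _ h0).trans (comps_zero _ _))
    exact (contMDiffOn_iff_contDiffOn.1 h3).contDiffAt (ho.mem_nhds ⟨h1, h2⟩)
  homogeneous x hx r y := by
    rw [localF, localF, ← hF.homogeneous]
    congr 2
    exact map_smul _ _ _
  posDef := hF.posDef α

theorem chartChange_apply {α x : M} (β : M) (hx : x ∈ (chartAt 𝔼 α).source) :
    chartChange n α β (extChartAt (𝓡 n) α x) = extChartAt (𝓡 n) β x := by
  rw [chartChange, (extChartAt (𝓡 n) α).left_inv (by simpa using hx)]

theorem contDiffAt_chartChange {α β x : M} (hα : x ∈ (chartAt 𝔼 α).source)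
    (hβ : x ∈ (chartAt 𝔼 β).source) :
    ContDiffAt ℝ ∞ (chartChange n α β) (extChartAt (𝓡 n) α x) := by
  have h1 : ContMDiffAt 𝓘(ℝ, 𝔼) (𝓡 n) ∞ (extChartAt (𝓡 n) α).symm (extChartAt (𝓡 n) α x) :=
    (contMDiffOn_extChartAt_symm α).contMDiffAt
      ((isOpen_extChartAt_target α).mem_nhds ((extChartAt (𝓡 n) α).map_source (by simpa using hα)))
  have hl : (extChartAt (𝓡 n) α).symm (extChartAt (𝓡 n) α x) = x :=
    (extChartAt (𝓡 n) α).left_inv (by simpa using hα)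
  have h2 : ContMDiffAt (𝓡 n) 𝓘(ℝ, 𝔼) ∞ (extChartAt (𝓡 n) β)
      ((extChartAt (𝓡 n) α).symm (extChartAt (𝓡 n) α x)) := by
    rw [hl]; exact contMDiffAt_extChartAt' hβ
  exact contMDiffAt_iff_contDiffAt.1 (h2.comp _ h1)

theorem eventually_chart_source {α β x : M} (hα : x ∈ (chartAt 𝔼 α).source)
    (hβ : x ∈ (chartAt 𝔼 β).source) : ∀ᶠ y in 𝓝 (extChartAt (𝓡 n) α x),
      y ∈ (extChartAt (𝓡 n) α).target ∧ (extChartAt (𝓡 n) α).symm y ∈ (chartAt 𝔼 α).source ∧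
      (extChartAt (𝓡 n) α).symm y ∈ (chartAt 𝔼 β).source := by
  have hx : x ∈ (extChartAt (𝓡 n) α).source := by simpa using hα
  have h1 : (extChartAt (𝓡 n) α).target ∈ 𝓝 (extChartAt (𝓡 n) α x) :=
    (isOpen_extChartAt_target α).mem_nhds ((extChartAt (𝓡 n) α).map_source hx)
  have hc : ContinuousAt (extChartAt (𝓡 n) α).symm (extChartAt (𝓡 n) α x) :=
    continuousAt_extChartAt_symm' hx
  have h2 := hc.eventually (((chartAt 𝔼 β).open_source).mem_nhds (by
    rw [(extChartAt (𝓡 n) α).left_inv hx]; exact hβ))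
  filter_upwards [h1, h2] with y hy1 hy2
  exact ⟨hy1, by simpa using (extChartAt (𝓡 n) α).map_target hy1, hy2⟩

theorem eventually_contDiffAt_chartChange {α β x : M} (hα : x ∈ (chartAt 𝔼 α).source)
    (hβ : x ∈ (chartAt 𝔼 β).source) :
    ∀ᶠ y in 𝓝 (extChartAt (𝓡 n) α x), ContDiffAt ℝ ∞ (chartChange n α β) y := by
  filter_upwards [eventually_chart_source hα hβ] with y hy
  have := contDiffAt_chartChange hy.2.1 hy.2.2
  rwa [(extChartAt (𝓡 n) α).right_inv hy.1] at this

theorem comps_chartChange {α β x : M} (hα : x ∈ (chartAt 𝔼 α).source)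
    (hβ : x ∈ (chartAt 𝔼 β).source) (v : TangentSpace (𝓡 n) x) :
    comps β x v = fderiv ℝ (chartChange n α β) (extChartAt (𝓡 n) α x) (comps α x v) := by
  have h1 : MDifferentiableAt (𝓡 n) 𝓘(ℝ, 𝔼) (extChartAt (𝓡 n) α) x :=
    mdifferentiableAt_extChartAt hα
  have h2 : MDifferentiableAt 𝓘(ℝ, 𝔼) 𝓘(ℝ, 𝔼) (chartChange n α β) (extChartAt (𝓡 n) α x) :=
    ((contDiffAt_chartChange hα hβ).differentiableAt (by simp)).mdifferentiableAt
  have h3 : extChartAt (𝓡 n) β =ᶠ[𝓝 x] chartChange n α β ∘ extChartAt (𝓡 n) α := by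
    filter_upwards [(chartAt 𝔼 α).open_source.mem_nhds hα] with y hy
    exact (chartChange_apply β hy).symm
  rw [comps_eq_mfderiv hβ, comps_eq_mfderiv hα, h3.mfderiv_eq, mfderiv_comp x h2 h1,
    mfderiv_eq_fderiv]
  rfl

/-- The derivative of the reverse coordinate change is an explicit inverse, because both derivatives
convert components of the same tangent vector. -/
theorem bijective_fderiv_chartChange {α β x : M} (hα : x ∈ (chartAt 𝔼 α).source)
    (hβ : x ∈ (chartAt 𝔼 β).source) :
    Function.Bijective (fderiv ℝ (chartChange n α β) (extChartAt (𝓡 n) α x)) := by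
  refine Function.bijective_iff_has_inverse.2
    ⟨fderiv ℝ (chartChange n β α) (extChartAt (𝓡 n) β x), fun u => ?_, fun u => ?_⟩
  · rw [← comps_ofComps hα u, ← comps_chartChange hα hβ, ← comps_chartChange hβ hα]
  · rw [← comps_ofComps hβ u, ← comps_chartChange hβ hα, ← comps_chartChange hα hβ]

/-- Both sides are half the square of F at one and the same tangent vector. This is the
compatibility hypothesis in the transformation laws. -/
theorem energy_chartChange (F : TangentBundle (𝓡 n) M → ℝ) {α β x : M}
    (hα : x ∈ (chartAt 𝔼 α).source) (hβ : x ∈ (chartAt 𝔼 β).source) :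
    ∀ᶠ y in 𝓝 (extChartAt (𝓡 n) α x), ∀ w, energy (localF F β)
      (chartChange n α β y, fderiv ℝ (chartChange n α β) y w) = energy (localF F α) (y, w) := by
  filter_upwards [eventually_chart_source hα hβ] with y hy w
  have hr := (extChartAt (𝓡 n) α).right_inv hy.1
  have h1 := comps_chartChange hy.2.1 hy.2.2 (ofComps α _ w)
  rw [comps_ofComps hy.2.1, hr] at h1
  have h2 := localF_apply F hy.2.2 (ofComps α _ w)
  rw [h1] at h2
  simp only [energy]
  rw [chartChange, h2]
  rfl

/-- Coordinates of the velocity. -/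
theorem comps_velocity {c : ℝ → M} {S : Set ℝ} {t : ℝ} {α : M} (hα : c t ∈ (chartAt 𝔼 α).source)
    (hc : MDifferentiableWithinAt 𝓘(ℝ, ℝ) (𝓡 n) c S t) (hS : UniqueDiffWithinAt ℝ S t) :
    comps α (c t) (velocity c S t) = derivWithin (fun s => extChartAt (𝓡 n) α (c s)) S t := by
  have h1 : MDifferentiableAt (𝓡 n) 𝓘(ℝ, 𝔼) (extChartAt (𝓡 n) α) (c t) :=
    mdifferentiableAt_extChartAt hα
  rw [comps_eq_mfderiv hα, velocity, ← fderivWithin_derivWithin, ← mfderivWithin_eq_fderivWithin]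
  have := mfderiv_comp_mfderivWithin t h1 hc hS.uniqueMDiffWithinAt
  exact (congrArg (fun L => L (1 : ℝ)) this).symm

end Charts

end FinslerPEnergy

namespace FinslerPEnergy

/-! ### Vector fields along geodesics in coordinates -/

section Curves

variable {n : ℕ} {M : Type*} [TopologicalSpace M] [ChartedSpace (EuclideanSpace ℝ (Fin n)) M]
  [IsManifold (𝓡 n) ∞ M]

local notation "𝔼" => EuclideanSpace ℝ (Fin n)

theorem contDiffWithinAt_chart_comp {A : Type*} [NormedAddCommGroup A] [NormedSpace ℝ A]
    {c : A → M} {S : Set A} {t : A} {α : M} (hα : c t ∈ (chartAt 𝔼 α).source)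
    (hc : ContMDiffWithinAt 𝓘(ℝ, A) (𝓡 n) ∞ c S t) :
    ContDiffWithinAt ℝ ∞ (fun s => extChartAt (𝓡 n) α (c s)) S t :=
  contMDiffWithinAt_iff_contDiffWithinAt.1
    ((contMDiffAt_extChartAt' (I := 𝓡 n) hα).comp_contMDiffWithinAt t hc)

theorem eventually_mem_chart {A : Type*} [NormedAddCommGroup A] [NormedSpace ℝ A]
    {c : A → M} {S : Set A} {t : A} {α : M} (hα : c t ∈ (chartAt 𝔼 α).source)
    (hc : ContMDiffWithinAt 𝓘(ℝ, A) (𝓡 n) ∞ c S t) :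
    ∀ᶠ s in 𝓝[S] t, c s ∈ (chartAt 𝔼 α).source :=
  hc.continuousWithinAt.eventually ((chartAt 𝔼 α).open_source.mem_nhds hα)

theorem contDiffWithinAt_derivWithin {B : Type*} [NormedAddCommGroup B] [NormedSpace ℝ B]
    {x : ℝ → B} {S : Set ℝ} {t : ℝ} (hx : ContDiffWithinAt ℝ ∞ x S t) (hS : UniqueDiffOn ℝ S)
    (ht : t ∈ S) : ContDiffWithinAt ℝ ∞ (derivWithin x S) S t := by
  have := (hx.fderivWithin_right (m := ∞) hS (by exact_mod_cast le_rfl) ht).clm_apply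
    (contDiffWithinAt_const (c := (1 : ℝ)))
  exact this

theorem velocity_subset {c : ℝ → M} {S S' : Set ℝ} {t : ℝ} (h : S ⊆ S') (hS : UniqueDiffOn ℝ S)
    (ht : t ∈ S) (hc : MDifferentiableWithinAt 𝓘(ℝ, ℝ) (𝓡 n) c S' t) :
    velocity (n := n) c S t = velocity c S' t := by
  rw [velocity, velocity, mfderivWithin_subset h (hS t ht).uniqueMDiffWithinAt hc]

/-- The lift of a curve to the tangent bundle, in the chart around `α`. -/
noncomputable def phase (c : ℝ → M) (α : M) (s : ℝ) : 𝔼 × 𝔼 :=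
  (extChartAt (𝓡 n) α (c s), comps α (c s) (velocity c (Icc 0 1) s))

theorem uniqueDiffOn_unit : UniqueDiffOn ℝ (Icc (0 : ℝ) 1) := uniqueDiffOn_Icc zero_lt_one

theorem velocity_eventuallyEq {c : ℝ → M} {S : Set ℝ} {t : ℝ} {α : M}
    (hα : c t ∈ (chartAt 𝔼 α).source) (hc : ContMDiffOn 𝓘(ℝ, ℝ) (𝓡 n) ∞ c S)
    (hS : UniqueDiffOn ℝ S) (ht : t ∈ S) : ∀ᶠ s in 𝓝[S] t,
      comps α (c s) (velocity c S s) = derivWithin (fun s => extChartAt (𝓡 n) α (c s)) S s := by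
  filter_upwards [eventually_mem_chart hα (hc t ht), self_mem_nhdsWithin] with s hs1 hs2
  exact comps_velocity hs1 ((hc s hs2).mdifferentiableWithinAt (by simp)) (hS s hs2)

theorem contDiffWithinAt_comps_velocity {c : ℝ → M} {S : Set ℝ} {t : ℝ} {α : M}
    (hα : c t ∈ (chartAt 𝔼 α).source) (hc : ContMDiffOn 𝓘(ℝ, ℝ) (𝓡 n) ∞ c S)
    (hS : UniqueDiffOn ℝ S) (ht : t ∈ S) :
    ContDiffWithinAt ℝ ∞ (fun s => comps (n := n) α (c s) (velocity c S s)) S t :=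
  (contDiffWithinAt_derivWithin (contDiffWithinAt_chart_comp hα (hc t ht)) hS ht).congr_of_eventuallyEq
    (velocity_eventuallyEq hα hc hS ht)
    ((velocity_eventuallyEq hα hc hS ht).self_of_nhdsWithin ht)

theorem contDiffWithinAt_phase {c : ℝ → M} {t : ℝ} {α : M}
    (hα : c t ∈ (chartAt 𝔼 α).source) (hc : ContMDiffOn 𝓘(ℝ, ℝ) (𝓡 n) ∞ c (Icc 0 1))
    (ht : t ∈ Icc (0 : ℝ) 1) : ContDiffWithinAt ℝ ∞ (phase (n := n) c α) (Icc 0 1) t :=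
  (contDiffWithinAt_chart_comp hα (hc t ht)).prodMk
    (contDiffWithinAt_comps_velocity hα hc uniqueDiffOn_unit ht)

theorem hasDerivWithinAt_chart_comp {c : ℝ → M} {S : Set ℝ} {t : ℝ} {α : M}
    (hα : c t ∈ (chartAt 𝔼 α).source) (hc : ContMDiffOn 𝓘(ℝ, ℝ) (𝓡 n) ∞ c S)
    (hS : UniqueDiffOn ℝ S) (ht : t ∈ S) :
    HasDerivWithinAt (fun s => extChartAt (𝓡 n) α (c s)) (comps α (c t) (velocity c S t)) S t := by
  rw [comps_velocity hα ((hc t ht).mdifferentiableWithinAt (by simp)) (hS t ht)]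
  exact ((contDiffWithinAt_chart_comp hα (hc t ht)).differentiableWithinAt
    (by simp)).hasDerivWithinAt

variable {F : TangentBundle (𝓡 n) M → ℝ}

theorem phase_mem {c : ℝ → M} {t : ℝ} {α : M} (hα : c t ∈ (chartAt 𝔼 α).source)
    (hr : velocity (n := n) c (Icc 0 1) t ≠ 0) :
    (phase (n := n) c α t).1 ∈ (extChartAt (𝓡 n) α).target ∧ (phase (n := n) c α t).2 ≠ 0 :=
  ⟨(extChartAt (𝓡 n) α).map_source (by simpa using hα), comps_ne_zero hα hr⟩

/-- The scalar product along a curve in the chart around the point. -/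
theorem gAlong_eq_self (hF : IsFinsler F) {c : ℝ → M} {t : ℝ}
    (hr : velocity (n := n) c (Icc 0 1) t ≠ 0) (U W : TangentSpace (𝓡 n) (c t)) :
    gAlong F c t U W = metric (energy (localF F (c t))) (phase c (c t) t)
      (comps (c t) (c t) U) (comps (c t) (c t) W) := by
  have hp := phase_mem (mem_chart_source 𝔼 (c t)) hr
  exact (hF.localFinsler (c t)).sum_gLow hp.1 hp.2 _ _

theorem phase_chartChange {c : ℝ → M} {t : ℝ} {α β : M} (hα : c t ∈ (chartAt 𝔼 α).source)
    (hβ : c t ∈ (chartAt 𝔼 β).source) : phase (n := n) c β t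
      = (chartChange n α β (phase (n := n) c α t).1,
          fderiv ℝ (chartChange n α β) (phase (n := n) c α t).1 (phase (n := n) c α t).2) := by
  simp only [phase]
  rw [chartChange_apply β hα, ← comps_chartChange hα hβ]

/-- `gAlong` uses a chart that moves with t; differentiation in t requires a fixed chart for all
nearby parameters. -/
theorem gAlong_eq (hF : IsFinsler F) {c : ℝ → M} {t : ℝ} {α : M}
    (hα : c t ∈ (chartAt 𝔼 α).source)
    (hr : velocity (n := n) c (Icc 0 1) t ≠ 0) (U W : TangentSpace (𝓡 n) (c t)) :
    gAlong F c t U W = metric (energy (localF F α)) (phase c α t)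
      (comps α (c t) U) (comps α (c t) W) := by
  have hs := mem_chart_source 𝔼 (c t)
  have hp := phase_mem hα hr
  have hp' := phase_mem hs hr
  rw [gAlong_eq_self hF hr, comps_chartChange hα hs, comps_chartChange hα hs,
    phase_chartChange hα hs]
  rw [phase_chartChange hα hs] at hp'
  exact SprayData.change_metric (hF.localFinsler α).sprayData (hF.localFinsler (c t)).sprayData
    hp.1 hp.2 (eventually_contDiffAt_chartChange hα hs) hp'.1 hp'.2
    (energy_chartChange F hα hs) _ _

theorem gAlong_comm (hF : IsFinsler F) {c : ℝ → M} {t : ℝ}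
    (hr : velocity (n := n) c (Icc 0 1) t ≠ 0) (U W : TangentSpace (𝓡 n) (c t)) :
    gAlong F c t U W = gAlong F c t W U := by
  have hp := phase_mem (mem_chart_source 𝔼 (c t)) hr
  rw [gAlong_eq_self hF hr, gAlong_eq_self hF hr,
    (hF.localFinsler (c t)).sprayData.metric_comm hp.1 hp.2]

theorem comps_R2nonlin (hF : IsFinsler F) {c : ℝ → M} {t : ℝ}
    (hr : velocity (n := n) c (Icc 0 1) t ≠ 0) (W : TangentSpace (𝓡 n) (c t)) :
    comps (c t) (c t) (R2nonlin F c t W)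
      = jacobiEnd (spray (localF F (c t))) (phase c (c t) t) (comps (c t) (c t) W) := by
  have hp := phase_mem (mem_chart_source 𝔼 (c t)) hr
  rw [R2nonlin, comps_ofComps (mem_chart_source 𝔼 (c t))]
  ext l
  exact (hF.localFinsler (c t)).sum_nonlinCurv hp.1 hp.2 l _

/-- One contraction of the h-curvature with ċ already gives the curvature of the nonlinear
connection, by `sum_hCurv`. -/
theorem R2_eq_R2nonlin (hF : IsFinsler F) {c : ℝ → M} {t : ℝ}
    (hr : velocity (n := n) c (Icc 0 1) t ≠ 0) (W : TangentSpace (𝓡 n) (c t)) :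
    R2 F c t W = R2nonlin F c t W := by
  have hp := phase_mem (mem_chart_source 𝔼 (c t)) hr
  have h := hF.localFinsler (c t)
  simp only [R2, R2nonlin]
  congr 2
  funext l
  set V := comps (n := n) (c t) (c t) (velocity c (Icc 0 1) t) with hV
  rw [Finset.sum_comm]
  refine Finset.sum_congr rfl fun j _ => ?_
  rw [Finset.sum_comm]
  refine Finset.sum_congr rfl fun k _ => ?_
  have := h.sum_hCurv hp.1 hp.2 l j k
  simp only [phase, ← hV] at this
  rw [← this, Finset.sum_mul, Finset.sum_mul]

theorem R2form_symm (hF : IsFinsler F) {c : ℝ → M} {t : ℝ}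
    (hr : velocity (n := n) c (Icc 0 1) t ≠ 0) (U W : TangentSpace (𝓡 n) (c t)) :
    R2form F c t U W = R2form F c t W U := by
  have hp := phase_mem (mem_chart_source 𝔼 (c t)) hr
  rw [R2form, R2form, gAlong_eq_self hF hr, gAlong_eq_self hF hr, R2_eq_R2nonlin hF hr,
    R2_eq_R2nonlin hF hr, comps_R2nonlin hF hr, comps_R2nonlin hF hr,
    (hF.localFinsler (c t)).sprayData.jacobiEnd_symm hp.1 hp.2]

/-- Since L ċ = N and N ċ = H, the defining formula splits into X' + N X and a C-term carrying the
factor c̈ + H. That term drops out for X = ċ on any curve, and for every X on a geodesic. -/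
theorem comps_covDeriv_aux (hF : IsFinsler F) {c : ℝ → M} {t : ℝ}
    (hr : velocity (n := n) c (Icc 0 1) t ≠ 0) {S : Set ℝ}
    (hv : velocity (n := n) c S t = velocity c (Icc 0 1) t)
    (X : ∀ t : ℝ, TangentSpace (𝓡 n) (c t)) (i : Fin n) :
    comps (c t) (c t) (covDeriv F c S X t) i
      = (derivWithin (fun s => comps (c t) (c s) (X s)) S t
        + conn (spray (localF F (c t))) (phase c (c t) t) (comps (c t) (c t) (X t))) i
        + ∑ m, comps (c t) (c t) (X t) m * ∑ k,
          cartanC (localF F (c t)) i m k (phase (n := n) c (c t) t).1 (phase (n := n) c (c t) t).2 *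
            (derivWithin (fun s => comps (n := n) (c t) (c s) (velocity c S s)) S t
              + spray (localF F (c t)) (phase c (c t) t)) k := by
  have hp := phase_mem (mem_chart_source 𝔼 (c t)) hr
  have h := hF.localFinsler (c t)
  rw [covDeriv, comps_ofComps (mem_chart_source 𝔼 (c t))]
  simp only [hv]
  have e1 := h.sum_nonlin hp.1 hp.2 i (comps (c t) (c t) (X t))
  have e2 : ∀ k, ∑ l, nonlin (localF F (c t)) k l (phase (n := n) c (c t) t).1
      (phase (n := n) c (c t) t).2 * (phase (n := n) c (c t) t).2 l
      = spray (localF F (c t)) (phase c (c t) t) k := fun k => by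
    rw [h.sum_nonlin hp.1 hp.2, h.sprayData.conn_self hp.1 hp.2]
  simp only [phase] at e1 e2 ⊢
  simp only [e2, PiLp.add_apply, ← e1]
  rw [add_assoc, ← Finset.sum_add_distrib]
  congr 1
  refine Finset.sum_congr rfl fun m _ => ?_
  rw [Finset.sum_add_distrib, mul_add]
  congr 1
  have := h.sum_cartanL hp.1 hp.2 i m
  simp only [phase] at this
  rw [this, mul_comm]

/-- The geodesic equation in the chart around the point. -/
theorem IsGeodesic.derivWithin_velocity (hF : IsFinsler F) {c : ℝ → M} (hc : IsGeodesic F c)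
    {t : ℝ} (ht : t ∈ Icc (0 : ℝ) 1) :
    derivWithin (fun s => comps (n := n) (c t) (c s) (velocity c (Icc 0 1) s)) (Icc 0 1) t
      = - spray (localF F (c t)) (phase c (c t) t) := by
  have hr := hc.regular t ht
  have hp := phase_mem (mem_chart_source 𝔼 (c t)) hr
  have h := hF.localFinsler (c t)
  rw [eq_neg_iff_add_eq_zero]
  ext i
  have e := comps_covDeriv_aux hF hr rfl (velocity c (Icc 0 1)) i
  have e0 : covDeriv F c (Icc 0 1) (velocity c (Icc 0 1)) t = 0 := hc.nabla_velocity t ht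
  rw [e0, comps_zero] at e
  simp only [Finset.mul_sum] at e
  rw [Finset.sum_comm] at e
  -- The C-term contains C contracted with ċ, so the equation ∇ċ/dt = 0 reads c̈ + H = 0 without any
  -- prior knowledge of c̈.
  have e2 : ∀ k (a : ℝ), ∑ m, comps (n := n) (c t) (c t) (velocity c (Icc 0 1) t) m *
      (cartanC (localF F (c t)) i m k (phase (n := n) c (c t) t).1 (phase (n := n) c (c t) t).2 * a)
      = 0 := by
    intro k a
    have := h.sum_cartanC hp.1 hp.2 i k
    calc _ = (∑ m, cartanC (localF F (c t)) i m k (phase (n := n) c (c t) t).1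
          (phase (n := n) c (c t) t).2 * (phase (n := n) c (c t) t).2 m) * a := by
          rw [Finset.sum_mul]
          exact Finset.sum_congr rfl fun m _ => by simp only [phase]; ring
      _ = 0 := by rw [this, zero_mul]
  simp only [e2, Finset.sum_const_zero, add_zero] at e
  have e3 := h.sprayData.conn_self hp.1 hp.2
  change conn _ _ (comps (c t) (c t) (velocity c (Icc 0 1) t)) = _ at e3
  rw [e3] at e
  exact e.symm

theorem IsGeodesic.hasDerivWithinAt_phase (hF : IsFinsler F) {c : ℝ → M} (hc : IsGeodesic F c)
    {t : ℝ} (ht : t ∈ Icc (0 : ℝ) 1) :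
    HasDerivWithinAt (phase (n := n) c (c t))
      ((phase (n := n) c (c t) t).2, -spray (localF F (c t)) (phase c (c t) t)) (Icc 0 1) t := by
  have hs := mem_chart_source 𝔼 (c t)
  refine (hasDerivWithinAt_chart_comp hs hc.smooth uniqueDiffOn_unit ht).prodMk ?_
  rw [← hc.derivWithin_velocity hF ht]
  exact ((contDiffWithinAt_comps_velocity hs hc.smooth uniqueDiffOn_unit ht).differentiableWithinAt
    (by simp)).hasDerivWithinAt

theorem IsGeodesic.velocity_subset {c : ℝ → M} (hc : IsGeodesic F c) {S : Set ℝ}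
    (hS : S ⊆ Icc 0 1) (hSu : UniqueDiffOn ℝ S) {t : ℝ} (ht : t ∈ S) :
    velocity (n := n) c S t = velocity c (Icc 0 1) t :=
  FinslerPEnergy.velocity_subset hS hSu ht
    ((hc.smooth t (hS ht)).mdifferentiableWithinAt (by simp))

/-- The covariant derivative along a geodesic in the chart around the point. -/
theorem IsGeodesic.comps_covDeriv_self (hF : IsFinsler F) {c : ℝ → M} (hc : IsGeodesic F c)
    {S : Set ℝ} (hS : S ⊆ Icc 0 1) (hSu : UniqueDiffOn ℝ S) {t : ℝ} (ht : t ∈ S)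
    (X : ∀ t : ℝ, TangentSpace (𝓡 n) (c t)) :
    comps (c t) (c t) (covDeriv F c S X t)
      = derivWithin (fun s => comps (c t) (c s) (X s)) S t
        + conn (spray (localF F (c t))) (phase c (c t) t) (comps (c t) (c t) (X t)) := by
  have hs := mem_chart_source 𝔼 (c t)
  -- The geodesic equation is known within [0,1]; smoothness of c transfers it to the smaller set S,
  -- where the derivative may be one-sided.
  have hv : derivWithin (fun s => comps (n := n) (c t) (c s) (velocity c S s)) S t
      = - spray (localF F (c t)) (phase c (c t) t) := by
    rw [← hc.derivWithin_velocity hF (hS ht)]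
    have hd := (contDiffWithinAt_comps_velocity hs hc.smooth uniqueDiffOn_unit
      (hS ht)).differentiableWithinAt (by simp)
    rw [← derivWithin_subset hS (hSu t ht) hd]
    refine derivWithin_congr (fun s hs' => ?_) ?_
    · rw [hc.velocity_subset hS hSu hs']
    · rw [hc.velocity_subset hS hSu ht]
  ext i
  rw [comps_covDeriv_aux hF (hc.regular t (hS ht)) (hc.velocity_subset hS hSu ht), hv]
  simp

theorem hasDerivWithinAt_fderiv_apply {V : Type*} [NormedAddCommGroup V] [NormedSpace ℝ V]
    {φ : V → V} {x X Y : ℝ → V} {x' X' : V} {S : Set ℝ} {t : ℝ}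
    (hφ : ContDiffAt ℝ ∞ φ (x t)) (hx : HasDerivWithinAt x x' S t)
    (hX : HasDerivWithinAt X X' S t) (hY : ∀ᶠ s in 𝓝[S] t, Y s = fderiv ℝ φ (x s) (X s))
    (ht : t ∈ S) : HasDerivWithinAt Y
      (fderiv ℝ (fderiv ℝ φ) (x t) x' (X t) + fderiv ℝ φ (x t) X') S t :=
  ((hasDerivWithinAt_comp_of_contDiffAt (contDiffAt_fderiv_top hφ) hx).clm_apply
    hX).congr_of_eventuallyEq hY (hY.self_of_nhdsWithin ht)

theorem comps_chartChange_eventually {A : Type*} [NormedAddCommGroup A] [NormedSpace ℝ A]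
    {c : A → M} {S : Set A} {t : A} {α β : M}
    (hα : c t ∈ (chartAt 𝔼 α).source) (hβ : c t ∈ (chartAt 𝔼 β).source)
    (hc : ContMDiffWithinAt 𝓘(ℝ, A) (𝓡 n) ∞ c S t) (X : ∀ t, TangentSpace (𝓡 n) (c t)) :
    ∀ᶠ s in 𝓝[S] t, comps β (c s) (X s)
      = fderiv ℝ (chartChange n α β) (extChartAt (𝓡 n) α (c s)) (comps α (c s) (X s)) := by
  filter_upwards [eventually_mem_chart hα hc, eventually_mem_chart hβ hc] with s h1 h2
  exact comps_chartChange h1 h2 _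

/-- The covariant derivative along a geodesic in an arbitrary chart. -/
theorem IsGeodesic.comps_covDeriv (hF : IsFinsler F) {c : ℝ → M} (hc : IsGeodesic F c)
    {S : Set ℝ} (hS : S ⊆ Icc 0 1) (hSu : UniqueDiffOn ℝ S) {t : ℝ} (ht : t ∈ S)
    {X : ∀ t : ℝ, TangentSpace (𝓡 n) (c t)} {α : M} (hα : c t ∈ (chartAt 𝔼 α).source)
    (hX : DifferentiableWithinAt ℝ (fun s => comps (c t) (c s) (X s)) S t) :
    comps α (c t) (covDeriv F c S X t)
      = derivWithin (fun s => comps α (c s) (X s)) S t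
        + conn (spray (localF F α)) (phase c α t) (comps α (c t) (X t)) := by
  have hs := mem_chart_source 𝔼 (c t)
  have hct := (hc.smooth.mono hS) t ht
  have hp := phase_mem hs (hc.regular t (hS ht))
  have hp' := phase_mem hα (hc.regular t (hS ht))
  have e1 := hasDerivWithinAt_chart_comp hs (hc.smooth.mono hS) hSu ht
  rw [hc.velocity_subset hS hSu ht] at e1
  have e4 := (hasDerivWithinAt_fderiv_apply (V := 𝔼) (Y := fun s => comps α (c s) (X s))
    (X := fun s => comps (c t) (c s) (X s)) (x := fun s => extChartAt (𝓡 n) (c t) (c s))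
    (contDiffAt_chartChange hs hα) e1 hX.hasDerivWithinAt
    (comps_chartChange_eventually hs hα hct X) ht).derivWithin (hSu t ht)
  rw [phase_chartChange hs hα] at hp'
  have := SprayData.change_conn (hF.localFinsler (c t)).sprayData (hF.localFinsler α).sprayData
    hp.1 hp.2 (eventually_contDiffAt_chartChange hs hα) hp'.1
    (bijective_fderiv_chartChange hs hα) (energy_chartChange F hs hα) (comps (c t) (c t) (X t))
  rw [← phase_chartChange hs hα] at this
  rw [comps_chartChange hs hα (covDeriv F c S X t), comps_chartChange hs hα (X t),
    hc.comps_covDeriv_self hF hS hSu ht, map_add]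
  -- The term φ''(ċ, X) from differentiating the components cancels the one in the law of the
  -- nonlinear connection.
  refine Eq.symm ((congrArg₂ (· + ·) e4 this).trans ?_)
  simp only [phase]
  abel

/-- Smoothness of a vector field along a curve. -/
theorem contMDiffOn_field_iff {c : ℝ → M} {S : Set ℝ} {X : ∀ t : ℝ, TangentSpace (𝓡 n) (c t)} :
    ContMDiffOn 𝓘(ℝ, ℝ) (𝓡 n).tangent ∞ (fun t => (⟨c t, X t⟩ : TangentBundle (𝓡 n) M)) S ↔
      ContMDiffOn 𝓘(ℝ, ℝ) (𝓡 n) ∞ c S ∧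
      ∀ t ∈ S, ∀ α : M, c t ∈ (chartAt 𝔼 α).source →
        ContDiffWithinAt ℝ ∞ (fun s => comps α (c s) (X s)) S t := by
  have key : ∀ t ∈ S, ∀ α : M, c t ∈ (chartAt 𝔼 α).source →
      (ContMDiffWithinAt 𝓘(ℝ, ℝ) (𝓡 n).tangent ∞
        (fun t => (⟨c t, X t⟩ : TangentBundle (𝓡 n) M)) S t ↔
      ContMDiffWithinAt 𝓘(ℝ, ℝ) (𝓡 n) ∞ c S t ∧
        ContDiffWithinAt ℝ ∞ (fun s => comps α (c s) (X s)) S t) := by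
    intro t ht α hα
    have h1 := (trivializationAt 𝔼 (TangentSpace (𝓡 n)) α).contMDiffWithinAt_iff
      (IM := 𝓘(ℝ, ℝ)) (IB := 𝓡 n) (n := ∞) (s := S) (x₀ := t)
      (f := fun t => (⟨c t, X t⟩ : TangentBundle (𝓡 n) M))
      ((trivializationAt 𝔼 (TangentSpace (𝓡 n)) α).mem_source.2 hα)
    refine h1.trans (and_congr_right fun hc => ?_)
    rw [contMDiffWithinAt_iff_contDiffWithinAt]
    have ev : (fun s => (trivializationAt 𝔼 (TangentSpace (𝓡 n)) α
        (⟨c s, X s⟩ : TangentBundle (𝓡 n) M)).2) =ᶠ[𝓝[S] t] fun s => comps α (c s) (X s) := by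
      filter_upwards [eventually_mem_chart hα hc] with s hs
      exact (congrFun ((trivializationAt 𝔼 (TangentSpace (𝓡 n)) α).coe_linearMapAt_of_mem
        (R := ℝ) hs) (X s)).symm
    have ev' := ev.self_of_nhdsWithin ht
    exact ⟨fun h => h.congr_of_eventuallyEq ev.symm ev'.symm, fun h => h.congr_of_eventuallyEq ev ev'⟩
  constructor
  · intro h
    exact ⟨fun t ht => ((key t ht (c t) (mem_chart_source 𝔼 _)).1 (h t ht)).1,
      fun t ht α hα => ((key t ht α hα).1 (h t ht)).2⟩
  · rintro ⟨h1, h2⟩ t ht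
    exact (key t ht (c t) (mem_chart_source 𝔼 _)).2 ⟨h1 t ht, h2 t ht _ (mem_chart_source 𝔼 _)⟩

end Curves

end FinslerPEnergy

namespace FinslerPEnergy

/-! ### Calculus along geodesics -/

section Fields

variable {n : ℕ} {M : Type*} [TopologicalSpace M] [ChartedSpace (EuclideanSpace ℝ (Fin n)) M]
  [IsManifold (𝓡 n) ∞ M]

local notation "𝔼" => EuclideanSpace ℝ (Fin n)

/-- A vector field along `c` whose coordinates are smooth on `S`. -/
def IsSmoothField (c : ℝ → M) (S : Set ℝ) (X : ∀ t : ℝ, TangentSpace (𝓡 n) (c t)) : Prop :=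
  ∀ t ∈ S, ∀ α : M, c t ∈ (chartAt 𝔼 α).source →
    ContDiffWithinAt ℝ ∞ (fun s => comps α (c s) (X s)) S t

variable {F : TangentBundle (𝓡 n) M → ℝ}

theorem gAlong_add_right (c : ℝ → M) (t : ℝ) (U W W' : TangentSpace (𝓡 n) (c t)) :
    gAlong F c t U (W + W') = gAlong F c t U W + gAlong F c t U W' := by
  simp only [gAlong, comps_add, PiLp.add_apply, mul_add, Finset.sum_add_distrib]

theorem gAlong_smul_right (c : ℝ → M) (t : ℝ) (r : ℝ) (U W : TangentSpace (𝓡 n) (c t)) :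
    gAlong F c t U (r • W) = r * gAlong F c t U W := by
  simp only [gAlong, comps_smul, PiLp.smul_apply, smul_eq_mul, Finset.mul_sum]
  exact Finset.sum_congr rfl fun i _ => Finset.sum_congr rfl fun j _ => by ring

theorem gAlong_add_left (c : ℝ → M) (t : ℝ) (U U' W : TangentSpace (𝓡 n) (c t)) :
    gAlong F c t (U + U') W = gAlong F c t U W + gAlong F c t U' W := by
  simp only [gAlong, comps_add, PiLp.add_apply, mul_add, add_mul, Finset.sum_add_distrib]

theorem gAlong_zero_left (c : ℝ → M) (t : ℝ) (W : TangentSpace (𝓡 n) (c t)) :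
    gAlong F c t 0 W = 0 := by
  simp [gAlong, comps_zero]

theorem gAlong_zero_right (c : ℝ → M) (t : ℝ) (W : TangentSpace (𝓡 n) (c t)) :
    gAlong F c t W 0 = 0 := by
  simp [gAlong, comps_zero]

theorem gAlong_weighted (p v : ℝ) (c : ℝ → M) (t : ℝ) (U A : TangentSpace (𝓡 n) (c t)) :
    gAlong F c t U (weighted F p v c t A) = v ^ 2 * gAlong F c t U A
      + (p - 2) * gAlong F c t A (velocity c (Icc 0 1) t)
        * gAlong F c t U (velocity c (Icc 0 1) t) := by
  rw [weighted, gAlong_add_right, gAlong_smul_right, gAlong_smul_right]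

/-- Only the germ of S at t matters. One-sided derivatives on a short piece thereby agree with those
on [0, t] or [t, 1] that define the jumps. -/
theorem covDeriv_congr_set {c : ℝ → M} {S S' : Set ℝ} {t : ℝ} (h : S =ᶠ[𝓝 t] S')
    (X : ∀ t : ℝ, TangentSpace (𝓡 n) (c t)) : covDeriv F c S X t = covDeriv F c S' X t := by
  have h1 : ∀ᶠ s in 𝓝 t, velocity (n := n) c S s = velocity c S' s := by
    filter_upwards [eventually_eventuallyEq_nhds.2 h] with s hs
    rw [velocity, velocity, mfderivWithin_congr_set hs]
  have h2 : (fun s => comps (n := n) (c t) (c s) (velocity c S s))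
      =ᶠ[𝓝 t] fun s => comps (c t) (c s) (velocity c S' s) := by
    filter_upwards [h1] with s hs
    rw [hs]
  have h3 : derivWithin (fun s => comps (n := n) (c t) (c s) (velocity c S s)) S t
      = derivWithin (fun s => comps (n := n) (c t) (c s) (velocity c S' s)) S' t := by
    rw [derivWithin_congr_set h]
    exact (h2.filter_mono nhdsWithin_le_nhds).derivWithin_eq h2.self_of_nhds
  simp only [covDeriv]
  rw [h1.self_of_nhds, h3, derivWithin_congr_set h]

theorem covDeriv_congr {c : ℝ → M} {S : Set ℝ} {t : ℝ}
    {X Y : ∀ t : ℝ, TangentSpace (𝓡 n) (c t)} (h : ∀ᶠ s in 𝓝 t, X s = Y s) :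
    covDeriv F c S X t = covDeriv F c S Y t := by
  have h2 : (fun s => comps (n := n) (c t) (c s) (X s))
      =ᶠ[𝓝 t] fun s => comps (c t) (c s) (Y s) := by
    filter_upwards [h] with s hs
    rw [hs]
  simp only [covDeriv]
  rw [h.self_of_nhds, (h2.filter_mono nhdsWithin_le_nhds).derivWithin_eq h2.self_of_nhds]

variable {c : ℝ → M} {S : Set ℝ} {X Y : ∀ t : ℝ, TangentSpace (𝓡 n) (c t)}

theorem IsSmoothField.mono {S' : Set ℝ} (hX : IsSmoothField c S X) (h : S' ⊆ S) :
    IsSmoothField c S' X := fun t ht α hα => (hX t (h ht) α hα).mono h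

theorem IsGeodesic.isSmoothField_velocity (hc : IsGeodesic F c) :
    IsSmoothField (n := n) c (Icc 0 1) (velocity c (Icc 0 1)) :=
  fun _ ht _ hα => contDiffWithinAt_comps_velocity hα hc.smooth uniqueDiffOn_unit ht

theorem IsGeodesic.isSmoothField_covDeriv (hF : IsFinsler F) (hc : IsGeodesic F c)
    (hS : S ⊆ Icc 0 1) (hSu : UniqueDiffOn ℝ S) (hX : IsSmoothField c S X) :
    IsSmoothField c S (covDeriv F c S X) := by
  intro t ht α hα
  have hp := phase_mem hα (hc.regular t (hS ht))
  have h := hF.localFinsler α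
  have e1 : ∀ᶠ s in 𝓝[S] t, comps α (c s) (covDeriv F c S X s)
      = derivWithin (fun s => comps α (c s) (X s)) S s
        + conn (spray (localF F α)) (phase c α s) (comps α (c s) (X s)) := by
    filter_upwards [eventually_mem_chart hα (hc.smooth.mono hS t ht), self_mem_nhdsWithin]
      with s h1 h2
    exact hc.comps_covDeriv hF hS hSu h2 h1
      ((hX s h2 _ (mem_chart_source 𝔼 _)).differentiableWithinAt (by simp))
  refine ContDiffWithinAt.congr_of_eventuallyEq ?_ e1 (e1.self_of_nhdsWithin ht)
  refine (contDiffWithinAt_derivWithin (hX t ht α hα) hSu ht).add (ContDiffWithinAt.const_smul _ ?_)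
  have e2 := (contDiffAt_fderiv_top (h.smooth_spray _ hp.1 hp.2)).comp_contDiffWithinAt t
    ((contDiffWithinAt_phase hα hc.smooth (hS ht)).mono hS)
  exact e2.clm_apply (contDiffWithinAt_const.prodMk (hX t ht α hα))

theorem IsGeodesic.contDiffOn_gAlong (hF : IsFinsler F) (hc : IsGeodesic F c)
    (hS : S ⊆ Icc 0 1) (hX : IsSmoothField c S X) (hY : IsSmoothField c S Y) :
    ContDiffOn ℝ ∞ (fun t => gAlong F c t (X t) (Y t)) S := by
  intro t ht
  have hα := mem_chart_source 𝔼 (c t)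
  have hp := phase_mem hα (hc.regular t (hS ht))
  have h := hF.localFinsler (c t)
  have e1 : ∀ᶠ s in 𝓝[S] t, gAlong F c s (X s) (Y s) = metric (energy (localF F (c t)))
      (phase c (c t) s) (comps (c t) (c s) (X s)) (comps (c t) (c s) (Y s)) := by
    filter_upwards [eventually_mem_chart hα (hc.smooth.mono hS t ht), self_mem_nhdsWithin]
      with s h1 h2
    exact gAlong_eq hF h1 (hc.regular s (hS h2)) _ _
  refine ContDiffWithinAt.congr_of_eventuallyEq ?_ e1 (e1.self_of_nhdsWithin ht)
  have e2 := (contDiffAt_fderiv_top (contDiffAt_fderiv_top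
    (h.smooth_energy _ hp.1 hp.2))).comp_contDiffWithinAt t
    ((contDiffWithinAt_phase hα hc.smooth (hS ht)).mono hS)
  exact (e2.clm_apply (contDiffWithinAt_const.prodMk (hX t ht _ hα))).clm_apply
    (contDiffWithinAt_const.prodMk (hY t ht _ hα))

theorem IsGeodesic.hasDerivWithinAt_gAlong (hF : IsFinsler F) (hc : IsGeodesic F c)
    (hS : S ⊆ Icc 0 1) (hSu : UniqueDiffOn ℝ S) {t : ℝ} (ht : t ∈ S)
    (hX : IsSmoothField c S X) (hY : IsSmoothField c S Y) :
    HasDerivWithinAt (fun t => gAlong F c t (X t) (Y t))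
      (gAlong F c t (covDeriv F c S X t) (Y t) + gAlong F c t (X t) (covDeriv F c S Y t)) S t := by
  have hα := mem_chart_source 𝔼 (c t)
  have hp := phase_mem hα (hc.regular t (hS ht))
  have h := hF.localFinsler (c t)
  have e1 : ∀ᶠ s in 𝓝[S] t, gAlong F c s (X s) (Y s) = metric (energy (localF F (c t)))
      (phase c (c t) s) (comps (c t) (c s) (X s)) (comps (c t) (c s) (Y s)) := by
    filter_upwards [eventually_mem_chart hα (hc.smooth.mono hS t ht), self_mem_nhdsWithin]
      with s h1 h2
    exact gAlong_eq hF h1 (hc.regular s (hS h2)) _ _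
  have dX := ((hX t ht _ hα).differentiableWithinAt (by simp)).hasDerivWithinAt
  have dY := ((hY t ht _ hα).differentiableWithinAt (by simp)).hasDerivWithinAt
  have e2 := h.sprayData.hasDerivWithinAt_metric hp.1 hp.2
    ((hc.hasDerivWithinAt_phase hF (hS ht)).mono hS) dX dY
  refine (e2.congr_of_eventuallyEq e1 (e1.self_of_nhdsWithin ht)).congr_deriv ?_
  rw [gAlong_eq_self hF (hc.regular t (hS ht)), gAlong_eq_self hF (hc.regular t (hS ht)),
    hc.comps_covDeriv_self hF hS hSu ht, hc.comps_covDeriv_self hF hS hSu ht]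

theorem IsGeodesic.covDeriv_velocity (hF : IsFinsler F) (hc : IsGeodesic F c)
    (hS : S ⊆ Icc 0 1) (hSu : UniqueDiffOn ℝ S) {t : ℝ} (ht : t ∈ S) :
    covDeriv F c S (velocity c (Icc 0 1)) t = 0 := by
  have hα := mem_chart_source 𝔼 (c t)
  have hp := phase_mem hα (hc.regular t (hS ht))
  refine comps_injective hα ?_
  have hd := (contDiffWithinAt_comps_velocity hα hc.smooth uniqueDiffOn_unit
      (hS ht)).differentiableWithinAt (by simp)
  have h3 := (hF.localFinsler (c t)).sprayData.conn_self hp.1 hp.2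
  change conn _ _ (comps (c t) (c t) (velocity c (Icc 0 1) t)) = _ at h3
  rw [hc.comps_covDeriv_self hF hS hSu ht, comps_zero, derivWithin_subset hS (hSu t ht) hd,
    hc.derivWithin_velocity hF (hS ht), h3, neg_add_cancel]

/-- Self-adjointness moves R onto ċ, where it vanishes. Hence the (p-2)-part of the Jacobi integrand
contains no curvature. -/
theorem IsGeodesic.gAlong_R2_velocity (hF : IsFinsler F) (hc : IsGeodesic F c) {t : ℝ}
    (ht : t ∈ Icc (0 : ℝ) 1) (W : TangentSpace (𝓡 n) (c t)) :
    gAlong F c t (R2 F c t W) (velocity c (Icc 0 1) t) = 0 := by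
  have hα := mem_chart_source 𝔼 (c t)
  have hp := phase_mem hα (hc.regular t ht)
  rw [gAlong_eq_self hF (hc.regular t ht), R2_eq_R2nonlin hF (hc.regular t ht),
    comps_R2nonlin hF (hc.regular t ht)]
  exact (hF.localFinsler (c t)).sprayData.metric_jacobiEnd_self hp.1 hp.2 _

/-- The boundary function `g(Y, v² ∇X + (p - 2) g(∇X, ċ) ċ)` of the integration by parts. -/
noncomputable def momentum (F : TangentBundle (𝓡 n) M → ℝ) (p v : ℝ) (c : ℝ → M) (S : Set ℝ)
    (X Y : ∀ t : ℝ, TangentSpace (𝓡 n) (c t)) (t : ℝ) : ℝ :=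
  gAlong F c t (Y t) (weighted F p v c t (covDeriv F c S X t))

theorem IsGeodesic.contDiffOn_momentum (hF : IsFinsler F) (hc : IsGeodesic F c) (p v : ℝ)
    (hS : S ⊆ Icc 0 1) (hSu : UniqueDiffOn ℝ S)
    (hX : IsSmoothField c S X) (hY : IsSmoothField c S Y) :
    ContDiffOn ℝ ∞ (momentum F p v c S X Y) S := by
  have hD := hc.isSmoothField_covDeriv hF hS hSu hX
  have hV := hc.isSmoothField_velocity.mono hS
  have e : momentum F p v c S X Y = fun t => v ^ 2 * gAlong F c t (Y t) (covDeriv F c S X t)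
      + (p - 2) * gAlong F c t (covDeriv F c S X t) (velocity c (Icc 0 1) t)
        * gAlong F c t (Y t) (velocity c (Icc 0 1) t) := by
    funext t; exact gAlong_weighted _ _ _ _ _ _
  rw [e]
  exact (contDiffOn_const.mul (hc.contDiffOn_gAlong hF hS hY hD)).add
    ((contDiffOn_const.mul (hc.contDiffOn_gAlong hF hS hD hV)).mul
      (hc.contDiffOn_gAlong hF hS hY hV))

theorem Icc_eventuallyEq_unit {a b t : ℝ} (h : Icc a b ⊆ Icc 0 1) (ht : t ∈ Ioo a b) :
    (Icc 0 1 : Set ℝ) =ᶠ[𝓝 t] Icc a b := by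
  have h1 : Icc a b ∈ 𝓝 t := Icc_mem_nhds ht.1 ht.2
  exact (eventuallyEq_univ.2 (mem_of_superset h1 h)).trans (eventuallyEq_univ.2 h1).symm

theorem nabla_eq_covDeriv {a b t : ℝ} (h : Icc a b ⊆ Icc 0 1) (ht : t ∈ Ioo a b)
    (X : ∀ t : ℝ, TangentSpace (𝓡 n) (c t)) : nabla F c X t = covDeriv F c (Icc a b) X t :=
  covDeriv_congr_set (Icc_eventuallyEq_unit h ht) X

theorem nabla_nabla_eq {a b t : ℝ} (h : Icc a b ⊆ Icc 0 1) (ht : t ∈ Ioo a b)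
    (X : ∀ t : ℝ, TangentSpace (𝓡 n) (c t)) : nabla F c (nabla F c X) t
      = covDeriv F c (Icc a b) (covDeriv F c (Icc a b) X) t := by
  rw [nabla_eq_covDeriv h ht]
  refine covDeriv_congr ?_
  filter_upwards [Ioo_mem_nhds ht.1 ht.2] with s hs
  exact nabla_eq_covDeriv h hs X

/-- Leibniz rule with ∇ċ/dt = 0. The curvature terms of the two integrands cancel in their sum, as
neither occurs in the derivative of the boundary function. -/
theorem IsGeodesic.hasDerivAt_momentum (hF : IsFinsler F) (hc : IsGeodesic F c) (p v : ℝ)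
    {a b : ℝ} (hS : Icc a b ⊆ Icc 0 1) {t : ℝ} (ht : t ∈ Ioo a b)
    (hX : IsSmoothField c (Icc a b) X) (hY : IsSmoothField c (Icc a b) Y) :
    HasDerivAt (momentum F p v c (Icc a b) X Y)
      (jacobiIntegrand F p v c X Y t + indexIntegrand F p v c X Y t) t := by
  have hSu : UniqueDiffOn ℝ (Icc a b) := uniqueDiffOn_Icc (ht.1.trans ht.2)
  have ht' : t ∈ Icc a b := Ioo_subset_Icc_self ht
  have hr := hc.regular t (hS ht')
  have hD := hc.isSmoothField_covDeriv hF hS hSu hX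
  have hV := hc.isSmoothField_velocity.mono hS
  have e : momentum F p v c (Icc a b) X Y
      = fun t => v ^ 2 * gAlong F c t (Y t) (covDeriv F c (Icc a b) X t)
      + ((p - 2) * gAlong F c t (covDeriv F c (Icc a b) X t) (velocity c (Icc 0 1) t))
        * gAlong F c t (Y t) (velocity c (Icc 0 1) t) := by
    funext t; exact gAlong_weighted _ _ _ _ _ _
  rw [e]
  have d1 := hc.hasDerivWithinAt_gAlong hF hS hSu ht' hY hD
  have d2 := hc.hasDerivWithinAt_gAlong hF hS hSu ht' hD hV
  have d3 := hc.hasDerivWithinAt_gAlong hF hS hSu ht' hY hV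
  have d := ((d1.const_mul (v ^ 2)).add ((d2.const_mul (p - 2)).mul d3)).hasDerivAt
    (Icc_mem_nhds ht.1 ht.2)
  refine d.congr_deriv ?_
  rw [hc.covDeriv_velocity hF hS hSu ht', gAlong_zero_right, gAlong_zero_right, jacobiIntegrand,
    indexIntegrand, gAlong_weighted, nabla_nabla_eq hS ht, nabla_eq_covDeriv hS ht,
    nabla_eq_covDeriv hS ht, gAlong_add_right, gAlong_add_left,
    hc.gAlong_R2_velocity hF (hS ht'), R2form_symm hF hr, R2form,
    gAlong_comm hF hr (velocity c (Icc 0 1) t), gAlong_comm hF hr (velocity c (Icc 0 1) t),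
    gAlong_comm hF hr (R2 F c t (X t)),
    gAlong_comm hF hr (covDeriv F c (Icc a b) X t) (covDeriv F c (Icc a b) Y t)]
  ring

theorem IsGeodesic.indexIntegrand_symm (hF : IsFinsler F) (hc : IsGeodesic F c) (p v : ℝ) {t : ℝ}
    (ht : t ∈ Icc (0 : ℝ) 1) (X Y : ∀ t : ℝ, TangentSpace (𝓡 n) (c t)) :
    indexIntegrand F p v c X Y t = indexIntegrand F p v c Y X t := by
  have hr := hc.regular t ht
  rw [indexIntegrand, indexIntegrand, gAlong_comm hF hr (nabla F c X t) (nabla F c Y t),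
    R2form_symm hF hr]
  ring

theorem IsGeodesic.indexForm_symm (hF : IsFinsler F) (hc : IsGeodesic F c) (p v : ℝ)
    (X Y : ∀ t : ℝ, TangentSpace (𝓡 n) (c t)) :
    indexForm F p v c X Y = indexForm F p v c Y X := by
  rw [indexForm, indexForm]
  congr 1
  refine intervalIntegral.integral_congr fun t ht => ?_
  rw [uIcc_of_le zero_le_one] at ht
  exact hc.indexIntegrand_symm hF p v ht X Y

end Fields

end FinslerPEnergy

namespace FinslerPEnergy

/-! ### Calculus on a strip -/

section Strip

/-- The strip `(-ε, ε)² × [a, b]`. -/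
def strip (ε a b : ℝ) : Set (ℝ × ℝ × ℝ) := Ioo (-ε) ε ×ˢ Ioo (-ε) ε ×ˢ Icc a b

variable {ε a b : ℝ} {B : Type*} [NormedAddCommGroup B] [NormedSpace ℝ B]

theorem uniqueDiffOn_strip (hab : a < b) : UniqueDiffOn ℝ (strip ε a b) :=
  isOpen_Ioo.uniqueDiffOn.prod (isOpen_Ioo.uniqueDiffOn.prod (uniqueDiffOn_Icc hab))

theorem strip_subset_closure (hab : a < b) :
    strip ε a b ⊆ closure (interior (strip ε a b)) := by
  rw [strip, interior_prod_eq, interior_prod_eq, isOpen_Ioo.interior_eq, interior_Icc,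
    closure_prod_eq, closure_prod_eq, closure_Ioo hab.ne]
  exact prod_mono subset_closure (prod_mono subset_closure subset_rfl)

theorem zero_mem_strip (hε : 0 < ε) {t : ℝ} (ht : t ∈ Icc a b) :
    ((0, 0, t) : ℝ × ℝ × ℝ) ∈ strip ε a b := ⟨⟨by simpa, hε⟩, ⟨by simpa, hε⟩, ht⟩

/-- The derivative of `u` in the direction `w` within the strip. -/
noncomputable def pderiv (ε a b : ℝ) (w : ℝ × ℝ × ℝ) (u : ℝ × ℝ × ℝ → B) (q : ℝ × ℝ × ℝ) : B :=
  fderivWithin ℝ u (strip ε a b) q w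

theorem contDiffWithinAt_pderiv (hab : a < b) {u : ℝ × ℝ × ℝ → B} {q : ℝ × ℝ × ℝ}
    (hu : ContDiffWithinAt ℝ ∞ u (strip ε a b) q) (hq : q ∈ strip ε a b) (w : ℝ × ℝ × ℝ) :
    ContDiffWithinAt ℝ ∞ (pderiv ε a b w u) (strip ε a b) q :=
  (hu.fderivWithin_right (m := ∞) (uniqueDiffOn_strip hab) (by exact_mod_cast le_rfl)
    hq).clm_apply contDiffWithinAt_const

theorem pderiv_congr {u u' : ℝ × ℝ × ℝ → B} {q : ℝ × ℝ × ℝ} (hq : q ∈ strip ε a b)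
    (h : u =ᶠ[𝓝[strip ε a b] q] u') (w : ℝ × ℝ × ℝ) : pderiv ε a b w u q = pderiv ε a b w u' q := by
  rw [pderiv, pderiv, h.fderivWithin_eq (h.self_of_nhdsWithin hq)]

/-- Symmetry persists on the faces t = a and t = b, because the strip lies in the closure of its
interior. -/
theorem pderiv_comm (hab : a < b) {u : ℝ × ℝ × ℝ → B} {q : ℝ × ℝ × ℝ}
    (hu : ContDiffWithinAt ℝ ∞ u (strip ε a b) q) (hq : q ∈ strip ε a b) (w w' : ℝ × ℝ × ℝ) :
    pderiv ε a b w (pderiv ε a b w' u) q = pderiv ε a b w' (pderiv ε a b w u) q := by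
  have hU := uniqueDiffOn_strip (ε := ε) hab
  have hd : DifferentiableWithinAt ℝ (fderivWithin ℝ u (strip ε a b)) (strip ε a b) q :=
    (hu.fderivWithin_right (m := ∞) hU (by exact_mod_cast le_rfl) hq).differentiableWithinAt
      (by simp)
  have key : ∀ w w', pderiv ε a b w (pderiv ε a b w' u) q
      = fderivWithin ℝ (fderivWithin ℝ u (strip ε a b)) (strip ε a b) q w w' := by
    intro w w'
    have := hd.hasFDerivWithinAt.clm_apply (hasFDerivWithinAt_const w' q (strip ε a b))
    rw [pderiv]
    change fderivWithin ℝ (fun y => fderivWithin ℝ u (strip ε a b) y w') _ _ _ = _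
    rw [this.fderivWithin (hU q hq)]
    simp
  rw [key, key]
  exact (hu.isSymmSndFDerivWithinAt
    (by simpa using WithTop.coe_le_coe.2 (le_top : (2 : ℕ∞) ≤ ⊤)) hU
    (strip_subset_closure hab hq) hq) w w'

theorem hasDerivAt_fst {u : ℝ × ℝ × ℝ → B} {s r t : ℝ}
    (hu : ContDiffWithinAt ℝ ∞ u (strip ε a b) (s, r, t)) (hq : (s, r, t) ∈ strip ε a b) :
    HasDerivAt (fun s => u (s, r, t)) (pderiv ε a b (1, 0, 0) u (s, r, t)) s := by
  have h1 : HasDerivWithinAt (fun s : ℝ => ((s, r, t) : ℝ × ℝ × ℝ)) (1, 0, 0) (Ioo (-ε) ε) s :=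
    (hasDerivWithinAt_id _ _).prodMk (hasDerivWithinAt_const _ _ _)
  have h2 : MapsTo (fun s : ℝ => ((s, r, t) : ℝ × ℝ × ℝ)) (Ioo (-ε) ε) (strip ε a b) :=
    fun x hx => ⟨hx, hq.2⟩
  exact ((hu.differentiableWithinAt (by simp)).hasFDerivWithinAt.comp_hasDerivWithinAt s h1
    h2).hasDerivAt (isOpen_Ioo.mem_nhds hq.1)

theorem hasDerivAt_snd {u : ℝ × ℝ × ℝ → B} {s r t : ℝ}
    (hu : ContDiffWithinAt ℝ ∞ u (strip ε a b) (s, r, t)) (hq : (s, r, t) ∈ strip ε a b) :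
    HasDerivAt (fun r => u (s, r, t)) (pderiv ε a b (0, 1, 0) u (s, r, t)) r := by
  have h1 : HasDerivWithinAt (fun r : ℝ => ((s, r, t) : ℝ × ℝ × ℝ)) (0, 1, 0) (Ioo (-ε) ε) r :=
    (hasDerivWithinAt_const _ _ _).prodMk
      ((hasDerivWithinAt_id _ _).prodMk (hasDerivWithinAt_const _ _ _))
  have h2 : MapsTo (fun r : ℝ => ((s, r, t) : ℝ × ℝ × ℝ)) (Ioo (-ε) ε) (strip ε a b) :=
    fun x hx => ⟨hq.1, hx, hq.2.2⟩
  exact ((hu.differentiableWithinAt (by simp)).hasFDerivWithinAt.comp_hasDerivWithinAt r h1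
    h2).hasDerivAt (isOpen_Ioo.mem_nhds hq.2.1)

theorem hasDerivWithinAt_thd {u : ℝ × ℝ × ℝ → B} {s r t : ℝ}
    (hu : ContDiffWithinAt ℝ ∞ u (strip ε a b) (s, r, t)) (hq : (s, r, t) ∈ strip ε a b) :
    HasDerivWithinAt (fun t => u (s, r, t)) (pderiv ε a b (0, 0, 1) u (s, r, t)) (Icc a b) t := by
  have h1 : HasDerivWithinAt (fun t : ℝ => ((s, r, t) : ℝ × ℝ × ℝ)) (0, 0, 1) (Icc a b) t :=
    (hasDerivWithinAt_const _ _ _).prodMk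
      ((hasDerivWithinAt_const _ _ _).prodMk (hasDerivWithinAt_id _ _))
  have h2 : MapsTo (fun t : ℝ => ((s, r, t) : ℝ × ℝ × ℝ)) (Icc a b) (strip ε a b) :=
    fun x hx => ⟨hq.1, hq.2.1, hx⟩
  exact (hu.differentiableWithinAt (by simp)).hasFDerivWithinAt.comp_hasDerivWithinAt t h1 h2

theorem contDiffWithinAt_slice {u : ℝ × ℝ × ℝ → B} {s r t : ℝ}
    (hu : ContDiffWithinAt ℝ ∞ u (strip ε a b) (s, r, t)) (hq : (s, r, t) ∈ strip ε a b) :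
    ContDiffWithinAt ℝ ∞ (fun t => u (s, r, t)) (Icc a b) t :=
  have h2 : MapsTo (fun t : ℝ => ((s, r, t) : ℝ × ℝ × ℝ)) (Icc a b) (strip ε a b) :=
    fun _ hx => ⟨hq.1, hq.2.1, hx⟩
  hu.comp t (contDiff_const.prodMk (contDiff_const.prodMk contDiff_id)).contDiffWithinAt h2

theorem tendsto_slice (hε : 0 < ε) {t : ℝ} :
    Tendsto (fun t : ℝ => ((0, 0, t) : ℝ × ℝ × ℝ)) (𝓝[Icc a b] t) (𝓝[strip ε a b] (0, 0, t)) := by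
  refine tendsto_nhdsWithin_iff.2 ⟨?_, ?_⟩
  · exact ((continuous_const.prodMk (continuous_const.prodMk continuous_id)).tendsto
      t).mono_left nhdsWithin_le_nhds
  · filter_upwards [self_mem_nhdsWithin] with s hs using zero_mem_strip hε hs

theorem tendsto_slice_fst (hε : 0 < ε) {t : ℝ} (ht : t ∈ Icc a b) :
    Tendsto (fun s : ℝ => ((s, 0, t) : ℝ × ℝ × ℝ)) (𝓝 0) (𝓝[strip ε a b] (0, 0, t)) := by
  refine tendsto_nhdsWithin_iff.2 ⟨?_, ?_⟩
  · exact (continuous_id.prodMk continuous_const).tendsto 0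
  · filter_upwards [Ioo_mem_nhds (show -ε < 0 by linarith) hε] with s hs
    exact ⟨hs, (zero_mem_strip hε ht).2⟩

end Strip

/-! ### Variations in coordinates -/

section Variations

variable {n : ℕ} {M : Type*} [TopologicalSpace M] [ChartedSpace (EuclideanSpace ℝ (Fin n)) M]
  [IsManifold (𝓡 n) ∞ M]

local notation "𝔼" => EuclideanSpace ℝ (Fin n)

/-- `C` is smooth on the strip `(-ε, ε)² × [a, b]`. -/
def SmoothOnStrip (n : ℕ) {M : Type*} [TopologicalSpace M]
    [ChartedSpace (EuclideanSpace ℝ (Fin n)) M] (ε a b : ℝ) (C : ℝ → ℝ → ℝ → M) : Prop :=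
  ContMDiffOn 𝓘(ℝ, ℝ × ℝ × ℝ) (𝓡 n) ∞ (fun q : ℝ × ℝ × ℝ => C q.1 q.2.1 q.2.2) (strip ε a b)

/-- A variation in the chart around `α`. -/
noncomputable def coord (C : ℝ → ℝ → ℝ → M) (α : M) (q : ℝ × ℝ × ℝ) : 𝔼 :=
  extChartAt (𝓡 n) α (C q.1 q.2.1 q.2.2)

variable {ε a b : ℝ} {C : ℝ → ℝ → ℝ → M} {α : M}

theorem SmoothOnStrip.coord (hC : SmoothOnStrip n ε a b C) {q : ℝ × ℝ × ℝ}
    (hq : q ∈ strip ε a b) (hα : C q.1 q.2.1 q.2.2 ∈ (chartAt 𝔼 α).source) :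
    ContDiffWithinAt ℝ ∞ (coord (n := n) C α) (strip ε a b) q :=
  contDiffWithinAt_chart_comp (c := fun q : ℝ × ℝ × ℝ => C q.1 q.2.1 q.2.2) hα (hC q hq)

theorem SmoothOnStrip.eventually (hC : SmoothOnStrip n ε a b C) {q : ℝ × ℝ × ℝ}
    (hq : q ∈ strip ε a b) (hα : C q.1 q.2.1 q.2.2 ∈ (chartAt 𝔼 α).source) :
    ∀ᶠ q in 𝓝[strip ε a b] q, q ∈ strip ε a b ∧ C q.1 q.2.1 q.2.2 ∈ (chartAt 𝔼 α).source :=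
  Filter.Eventually.and self_mem_nhdsWithin
    (eventually_mem_chart (c := fun q : ℝ × ℝ × ℝ => C q.1 q.2.1 q.2.2) hα (hC q hq))

theorem SmoothOnStrip.curve (hC : SmoothOnStrip n ε a b C) {s r : ℝ} (hs : s ∈ Ioo (-ε) ε)
    (hr : r ∈ Ioo (-ε) ε) : ContMDiffOn 𝓘(ℝ, ℝ) (𝓡 n) ∞ (C s r) (Icc a b) := by
  have h1 : ContDiff ℝ ∞ (fun t : ℝ => ((s, r, t) : ℝ × ℝ × ℝ)) :=
    contDiff_const.prodMk (contDiff_const.prodMk contDiff_id)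
  have h2 : MapsTo (fun t : ℝ => ((s, r, t) : ℝ × ℝ × ℝ)) (Icc a b) (strip ε a b) :=
    fun x hx => ⟨hs, hr, hx⟩
  exact ContMDiffOn.comp (f := fun t : ℝ => ((s, r, t) : ℝ × ℝ × ℝ)) hC h1.contMDiff.contMDiffOn h2

theorem SmoothOnStrip.comps_velocity (hC : SmoothOnStrip n ε a b C) (hab : a < b) {q : ℝ × ℝ × ℝ}
    (hq : q ∈ strip ε a b) (hα : C q.1 q.2.1 q.2.2 ∈ (chartAt 𝔼 α).source) :
    comps (n := n) α (C q.1 q.2.1 q.2.2) (velocity (C q.1 q.2.1) (Icc a b) q.2.2)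
      = pderiv ε a b (0, 0, 1) (FinslerPEnergy.coord C α) q := by
  have hu := uniqueDiffOn_Icc hab _ hq.2.2
  rw [FinslerPEnergy.comps_velocity hα
    ((hC.curve hq.1 hq.2.1 _ hq.2.2).mdifferentiableWithinAt (by simp)) hu]
  exact (hasDerivWithinAt_thd (hC.coord hq hα) hq).derivWithin hu

theorem SmoothOnStrip.comps_fieldX (hC : SmoothOnStrip n ε a b C) (hε : 0 < ε) {t : ℝ}
    (ht : t ∈ Icc a b) (hα : C 0 0 t ∈ (chartAt 𝔼 α).source) :
    comps (n := n) α (C 0 0 t) (fieldX C t)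
      = pderiv ε a b (1, 0, 0) (FinslerPEnergy.coord C α) (0, 0, t) := by
  have hq := zero_mem_strip hε ht
  have h1 : ContMDiffOn 𝓘(ℝ, ℝ) (𝓡 n) ∞ (fun s => C s 0 t) (Ioo (-ε) ε) :=
    ContMDiffOn.comp (f := fun s : ℝ => ((s, 0, t) : ℝ × ℝ × ℝ)) hC
      (contDiff_id.prodMk contDiff_const).contMDiff.contMDiffOn fun s hs => ⟨hs, hq.2⟩
  have h2 : MDifferentiableAt 𝓘(ℝ, ℝ) (𝓡 n) (fun s => C s 0 t) 0 :=
    (h1.contMDiffAt (isOpen_Ioo.mem_nhds hq.1)).mdifferentiableAt (by simp)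
  have h3 := FinslerPEnergy.comps_velocity (c := fun s => C s 0 t) (t := 0) (S := univ) hα
    h2.mdifferentiableWithinAt uniqueDiffWithinAt_univ
  rw [velocity, mfderivWithin_univ, derivWithin_univ] at h3
  exact h3.trans (hasDerivAt_fst (hC.coord hq hα) hq).deriv

theorem SmoothOnStrip.comps_fieldY (hC : SmoothOnStrip n ε a b C) (hε : 0 < ε) {t : ℝ}
    (ht : t ∈ Icc a b) (hα : C 0 0 t ∈ (chartAt 𝔼 α).source) :
    comps (n := n) α (C 0 0 t) (fieldY C t)
      = pderiv ε a b (0, 1, 0) (FinslerPEnergy.coord C α) (0, 0, t) := by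
  have hq := zero_mem_strip hε ht
  have h1 : ContMDiffOn 𝓘(ℝ, ℝ) (𝓡 n) ∞ (fun s => C 0 s t) (Ioo (-ε) ε) :=
    ContMDiffOn.comp (f := fun s : ℝ => ((0, s, t) : ℝ × ℝ × ℝ)) hC
      (contDiff_const.prodMk (contDiff_id.prodMk contDiff_const)).contMDiff.contMDiffOn
      fun s hs => ⟨hq.1, hs, hq.2.2⟩
  have h2 : MDifferentiableAt 𝓘(ℝ, ℝ) (𝓡 n) (fun s => C 0 s t) 0 :=
    (h1.contMDiffAt (isOpen_Ioo.mem_nhds hq.1)).mdifferentiableAt (by simp)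
  have h3 := FinslerPEnergy.comps_velocity (c := fun s => C 0 s t) (t := 0) (S := univ) hα
    h2.mdifferentiableWithinAt uniqueDiffWithinAt_univ
  rw [velocity, mfderivWithin_univ, derivWithin_univ] at h3
  exact h3.trans (hasDerivAt_snd (hC.coord hq hα) hq).deriv

theorem SmoothOnStrip.isSmoothField_fieldX (hC : SmoothOnStrip n ε a b C) (hε : 0 < ε)
    (hab : a < b) : IsSmoothField (n := n) (C 0 0) (Icc a b) (fieldX C) := by
  intro t ht α hα
  have hq := zero_mem_strip hε ht
  have h1 : ∀ᶠ s in 𝓝[Icc a b] t, comps (n := n) α (C 0 0 s) (fieldX C s)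
      = pderiv ε a b (1, 0, 0) (FinslerPEnergy.coord C α) (0, 0, s) := by
    filter_upwards [(tendsto_slice hε).eventually (hC.eventually hq hα)] with s hs
    exact hC.comps_fieldX hε hs.1.2.2 hs.2
  exact (contDiffWithinAt_slice (contDiffWithinAt_pderiv hab (hC.coord hq hα) hq _)
    hq).congr_of_eventuallyEq h1 (h1.self_of_nhdsWithin ht)

theorem SmoothOnStrip.isSmoothField_fieldY (hC : SmoothOnStrip n ε a b C) (hε : 0 < ε)
    (hab : a < b) : IsSmoothField (n := n) (C 0 0) (Icc a b) (fieldY C) := by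
  intro t ht α hα
  have hq := zero_mem_strip hε ht
  have h1 : ∀ᶠ s in 𝓝[Icc a b] t, comps (n := n) α (C 0 0 s) (fieldY C s)
      = pderiv ε a b (0, 1, 0) (FinslerPEnergy.coord C α) (0, 0, s) := by
    filter_upwards [(tendsto_slice hε).eventually (hC.eventually hq hα)] with s hs
    exact hC.comps_fieldY hε hs.1.2.2 hs.2
  exact (contDiffWithinAt_slice (contDiffWithinAt_pderiv hab (hC.coord hq hα) hq _)
    hq).congr_of_eventuallyEq h1 (h1.self_of_nhdsWithin ht)

variable {x₀ x₁ : M} {P : Finset ℝ}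

theorem IsVariation.smoothOnStrip (hC : IsVariation n x₀ x₁ ε P C) (h : IsPiece P a b) :
    SmoothOnStrip n ε a b C := hC.smooth a b h

theorem mfderiv_const_of_eventually {f : ℝ → M} {x : M} (h : ∀ᶠ s in 𝓝 (0 : ℝ), f s = x) :
    (mfderiv 𝓘(ℝ, ℝ) (𝓡 n) f 0 : ℝ →L[ℝ] 𝔼) = 0 := by
  have h1 : f =ᶠ[𝓝 0] fun _ => x := h
  exact h1.mfderiv_eq.trans mfderiv_const

theorem IsVariation.eventually_mem (hC : IsVariation n x₀ x₁ ε P C) :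
    ∀ᶠ s in 𝓝 (0 : ℝ), s ∈ Ioo (-ε) ε :=
  Ioo_mem_nhds (by linarith [hC.eps_pos]) hC.eps_pos

theorem IsVariation.fieldX_mem (hC : IsVariation n x₀ x₁ ε P C) :
    fieldX C ∈ TangentPathSpace n (C 0 0) := by
  have h0 := hC.eventually_mem.self_of_nhds
  refine ⟨?_, ?_, P, fun a b h => ?_⟩
  · exact congrArg (fun L : ℝ →L[ℝ] 𝔼 => L 1) (mfderiv_const_of_eventually (n := n) (x := x₀)
      (hC.eventually_mem.mono fun s hs => (hC.mem s hs 0 h0).1))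
  · exact congrArg (fun L : ℝ →L[ℝ] 𝔼 => L 1) (mfderiv_const_of_eventually (n := n) (x := x₁)
      (hC.eventually_mem.mono fun s hs => (hC.mem s hs 0 h0).2.1))
  · exact contMDiffOn_field_iff.2 ⟨(hC.smoothOnStrip h).curve h0 h0,
      (hC.smoothOnStrip h).isSmoothField_fieldX hC.eps_pos h.2.1⟩

theorem IsVariation.fieldY_mem (hC : IsVariation n x₀ x₁ ε P C) :
    fieldY C ∈ TangentPathSpace n (C 0 0) := by
  have h0 := hC.eventually_mem.self_of_nhds
  refine ⟨?_, ?_, P, fun a b h => ?_⟩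
  · exact congrArg (fun L : ℝ →L[ℝ] 𝔼 => L 1) (mfderiv_const_of_eventually (n := n) (x := x₀)
      (hC.eventually_mem.mono fun s hs => (hC.mem 0 h0 s hs).1))
  · exact congrArg (fun L : ℝ →L[ℝ] 𝔼 => L 1) (mfderiv_const_of_eventually (n := n) (x := x₁)
      (hC.eventually_mem.mono fun s hs => (hC.mem 0 h0 s hs).2.1))
  · exact contMDiffOn_field_iff.2 ⟨(hC.smoothOnStrip h).curve h0 h0,
      (hC.smoothOnStrip h).isSmoothField_fieldY hC.eps_pos h.2.1⟩

end Variations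

end FinslerPEnergy

namespace FinslerPEnergy

/-! ### Subdivisions of the unit interval -/

/-- Strong induction on the number of break points inside (a, b): cutting at one of them removes it
from both halves. Gluing is only required at points of P, so additive statements can acquire a
correction exactly there. -/
theorem piece_induction {P : Finset ℝ} {Q : ℝ → ℝ → Prop} (hp : ∀ a b, IsPiece P a b → Q a b)
    (hg : ∀ a b c, 0 ≤ a → a < b → b < c → c ≤ 1 → b ∈ P → Q a b → Q b c → Q a c)
    {a b : ℝ} (ha : 0 ≤ a) (hab : a < b) (hb : b ≤ 1) : Q a b := by
  induction hn : (P.filter (· ∈ Ioo a b)).card using Nat.strong_induction_on generalizing a b with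
  | _ k ih =>
    by_cases h : ∀ t ∈ P, t ∉ Ioo a b
    · exact hp a b ⟨ha, hab, hb, h⟩
    · push Not at h
      obtain ⟨t, htP, ht⟩ := h
      have key : ∀ a' b', a ≤ a' → b' ≤ b → t ∉ Ioo a' b' →
          (P.filter (· ∈ Ioo a' b')).card < k := by
        intro a' b' h1 h2 h3
        rw [← hn]
        refine Finset.card_lt_card ⟨fun s hs => ?_, fun hs => ?_⟩
        · rw [Finset.mem_filter] at hs ⊢
          exact ⟨hs.1, Ioo_subset_Ioo h1 h2 hs.2⟩
        · exact h3 (Finset.mem_filter.1 (hs (Finset.mem_filter.2 ⟨htP, ht⟩))).2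
      exact hg a t b ha ht.1 ht.2 hb htP
        (ih _ (key a t le_rfl ht.2.le fun h => lt_irrefl _ h.2) ha ht.1 (ht.2.le.trans hb) rfl)
        (ih _ (key t b ht.1.le le_rfl fun h => lt_irrefl _ h.1) (ha.trans ht.1.le) ht.2 hb rfl)

/-- Needed because each curve of a variation may come with its own set of break points, unrelated to
those of the variation. -/
theorem exists_piece (P : Finset ℝ) {a b t : ℝ} (ha : 0 ≤ a) (hab : a < b) (hb : b ≤ 1)
    (ht : t ∈ Icc a b) :
    ∃ a' b', IsPiece P a' b' ∧ Icc a' b' ⊆ Icc a b ∧ t ∈ Icc a' b' := by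
  revert t
  refine piece_induction (P := P) (Q := fun a b => ∀ {t : ℝ}, t ∈ Icc a b →
    ∃ a' b', IsPiece P a' b' ∧ Icc a' b' ⊆ Icc a b ∧ t ∈ Icc a' b') ?_ ?_ ha hab hb
  · exact fun a b h t ht => ⟨a, b, h, subset_rfl, ht⟩
  · intro a b c _ h1 h2 _ _ hQ1 hQ2 t ht
    rcases le_total t b with h | h
    · obtain ⟨a', b', h3, h4, h5⟩ := hQ1 ⟨ht.1, h⟩
      exact ⟨a', b', h3, h4.trans (Icc_subset_Icc_right h2.le), h5⟩
    · obtain ⟨a', b', h3, h4, h5⟩ := hQ2 ⟨h, ht.2⟩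
      exact ⟨a', b', h3, h4.trans (Icc_subset_Icc_left h1.le), h5⟩

theorem IsPiece.subset {P : Finset ℝ} {a b : ℝ} (h : IsPiece P a b) : Icc a b ⊆ Icc 0 1 :=
  Icc_subset_Icc h.1 h.2.2.1

/-! ### Differentiation under the integral sign -/

/-- Halving ε puts the parameters into a compact rectangle, on which the continuous derivative is
bounded; the constant bound allows differentiation under the integral. -/
theorem hasDerivAt_integral_of_continuousOn {ε a b : ℝ} (hε : 0 < ε) (hab : a ≤ b)
    {f f' : ℝ → ℝ → ℝ} (hf : ∀ s ∈ Ioo (-ε) ε, ContinuousOn (f s) (Icc a b))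
    (hf' : ContinuousOn (fun q : ℝ × ℝ => f' q.1 q.2) (Ioo (-ε) ε ×ˢ Icc a b))
    (hd : ∀ s ∈ Ioo (-ε) ε, ∀ t ∈ Icc a b, HasDerivAt (fun s => f s t) (f' s t) s) :
    HasDerivAt (fun s => ∫ t in a..b, f s t) (∫ t in a..b, f' 0 t) 0 := by
  have hsub : Icc (-(ε / 2)) (ε / 2) ⊆ Ioo (-ε) ε := Icc_subset_Ioo (by linarith) (by linarith)
  have h0 : (0 : ℝ) ∈ Ioo (-ε) ε := ⟨by linarith, hε⟩
  have huI : uIoc a b ⊆ Icc a b := by rw [uIoc_of_le hab]; exact Ioc_subset_Icc_self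
  obtain ⟨K, hK⟩ := (isCompact_Icc.prod isCompact_Icc).exists_bound_of_continuousOn
    (hf'.mono (prod_mono_left hsub) : ContinuousOn (fun q : ℝ × ℝ => f' q.1 q.2)
      (Icc (-(ε / 2)) (ε / 2) ×ˢ Icc a b))
  have hint : ∀ s ∈ Ioo (-ε) ε, IntervalIntegrable (f s) volume a b := fun s hs =>
    (hf s hs).intervalIntegrable_of_Icc hab
  have hint' : IntervalIntegrable (f' 0) volume a b := by
    refine ContinuousOn.intervalIntegrable_of_Icc hab ?_
    exact hf'.comp (f := fun t : ℝ => ((0 : ℝ), t)) (by fun_prop) fun t ht => ⟨h0, ht⟩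
  refine (intervalIntegral.hasDerivAt_integral_of_dominated_loc_of_deriv_le
    (s := Ioo (-(ε / 2)) (ε / 2)) (bound := fun _ => K) (Ioo_mem_nhds (by linarith) (by linarith))
    ?_ (hint 0 h0) hint'.def'.aestronglyMeasurable ?_ intervalIntegrable_const ?_).2
  · filter_upwards [Ioo_mem_nhds h0.1 h0.2] with s hs using (hint s hs).def'.aestronglyMeasurable
  · exact Eventually.of_forall fun t ht s hs => hK (s, t) ⟨Ioo_subset_Icc_self hs, huI ht⟩
  · exact Eventually.of_forall fun t ht s hs => hd s (hsub (Ioo_subset_Icc_self hs)) t (huI ht)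

section Strip

variable {ε a b : ℝ} {u : ℝ × ℝ × ℝ → ℝ}

theorem continuousOn_slice (hu : ContDiffOn ℝ ∞ u (strip ε a b)) {s r : ℝ} (hs : s ∈ Ioo (-ε) ε)
    (hr : r ∈ Ioo (-ε) ε) : ContinuousOn (fun t => u (s, r, t)) (Icc a b) :=
  fun t ht => (contDiffWithinAt_slice (hu (s, r, t) ⟨hs, hr, ht⟩) ⟨hs, hr, ht⟩).continuousWithinAt

theorem contDiffOn_pderiv (hab : a < b) (hu : ContDiffOn ℝ ∞ u (strip ε a b)) (w : ℝ × ℝ × ℝ) :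
    ContDiffOn ℝ ∞ (pderiv ε a b w u) (strip ε a b) :=
  fun q hq => contDiffWithinAt_pderiv hab (hu q hq) hq w

theorem hasDerivAt_integral_fst (hε : 0 < ε) (hab : a < b) (hu : ContDiffOn ℝ ∞ u (strip ε a b)) :
    HasDerivAt (fun s => ∫ t in a..b, u (s, 0, t))
      (∫ t in a..b, pderiv ε a b (1, 0, 0) u (0, 0, t)) 0 := by
  have h0 : (0 : ℝ) ∈ Ioo (-ε) ε := ⟨by linarith, hε⟩
  refine hasDerivAt_integral_of_continuousOn hε hab.le (f := fun s t => u (s, 0, t))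
    (f' := fun s t => pderiv ε a b (1, 0, 0) u (s, 0, t))
    (fun s hs => continuousOn_slice hu hs h0) ?_
    fun s hs t ht => hasDerivAt_fst (hu (s, 0, t) ⟨hs, h0, ht⟩) ⟨hs, h0, ht⟩
  exact (contDiffOn_pderiv hab hu _).continuousOn.comp
    (f := fun q : ℝ × ℝ => ((q.1, 0, q.2) : ℝ × ℝ × ℝ)) (by fun_prop) fun q hq => ⟨hq.1, h0, hq.2⟩

theorem hasDerivAt_integral_snd (hε : 0 < ε) (hab : a < b) (hu : ContDiffOn ℝ ∞ u (strip ε a b))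
    {s : ℝ} (hs : s ∈ Ioo (-ε) ε) : HasDerivAt (fun r => ∫ t in a..b, u (s, r, t))
      (∫ t in a..b, pderiv ε a b (0, 1, 0) u (s, 0, t)) 0 := by
  refine hasDerivAt_integral_of_continuousOn hε hab.le (f := fun r t => u (s, r, t))
    (f' := fun r t => pderiv ε a b (0, 1, 0) u (s, r, t))
    (fun r hr => continuousOn_slice hu hs hr) ?_
    fun r hr t ht => hasDerivAt_snd (hu (s, r, t) ⟨hs, hr, ht⟩) ⟨hs, hr, ht⟩
  exact (contDiffOn_pderiv hab hu _).continuousOn.comp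
    (f := fun q : ℝ × ℝ => ((s, q.1, q.2) : ℝ × ℝ × ℝ)) (by fun_prop) fun q hq => ⟨hs, hq.1, hq.2⟩

variable {A B : Type*} [NormedAddCommGroup A] [NormedSpace ℝ A] [NormedAddCommGroup B]
  [NormedSpace ℝ B]

theorem pderiv_comp (hab : a < b) {g : A → B} {m : ℝ × ℝ × ℝ → A} {q : ℝ × ℝ × ℝ}
    (hq : q ∈ strip ε a b) (hg : ContDiffAt ℝ ∞ g (m q))
    (hm : ContDiffWithinAt ℝ ∞ m (strip ε a b) q) (w : ℝ × ℝ × ℝ) :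
    pderiv ε a b w (fun q => g (m q)) q = fderiv ℝ g (m q) (pderiv ε a b w m q) := by
  have h : HasFDerivWithinAt (fun q => g (m q)) _ (strip ε a b) q :=
    (hg.differentiableAt (by simp)).hasFDerivAt.comp_hasFDerivWithinAt q
      (hm.differentiableWithinAt (by simp)).hasFDerivWithinAt
  rw [pderiv, h.fderivWithin (uniqueDiffOn_strip hab q hq)]
  rfl

theorem pderiv_pderiv_comp (hab : a < b) {g : A → B} {m : ℝ × ℝ × ℝ → A} {q : ℝ × ℝ × ℝ}
    (hq : q ∈ strip ε a b) (hg : ∀ᶠ q in 𝓝[strip ε a b] q, ContDiffAt ℝ ∞ g (m q))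
    (hm : ∀ᶠ q in 𝓝[strip ε a b] q, ContDiffWithinAt ℝ ∞ m (strip ε a b) q) (w w' : ℝ × ℝ × ℝ) :
    pderiv ε a b w (pderiv ε a b w' fun q => g (m q)) q
      = fderiv ℝ (fderiv ℝ g) (m q) (pderiv ε a b w m q) (pderiv ε a b w' m q)
        + fderiv ℝ g (m q) (pderiv ε a b w (pderiv ε a b w' m) q) := by
  have h1 : pderiv ε a b w' (fun q => g (m q))
      =ᶠ[𝓝[strip ε a b] q] fun q => fderiv ℝ g (m q) (pderiv ε a b w' m q) := by
    filter_upwards [hg, hm, self_mem_nhdsWithin] with q' h2 h3 h4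
    exact pderiv_comp hab h4 h2 h3 w'
  have hm0 := hm.self_of_nhdsWithin hq
  have h2 : HasFDerivWithinAt (fun q => fderiv ℝ g (m q)) _ (strip ε a b) q :=
    ((contDiffAt_fderiv_top (hg.self_of_nhdsWithin hq)).differentiableAt
    (by simp)).hasFDerivAt.comp_hasFDerivWithinAt q
    (hm0.differentiableWithinAt (by simp)).hasFDerivWithinAt
  have h3 := ((contDiffWithinAt_pderiv hab hm0 hq w').differentiableWithinAt
    (by simp)).hasFDerivWithinAt
  rw [pderiv_congr hq h1, pderiv, (h2.clm_apply h3).fderivWithin (uniqueDiffOn_strip hab q hq)]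
  simp only [pderiv, add_apply, ContinuousLinearMap.comp_apply, ContinuousLinearMap.flip_apply]
  rw [add_comm]

theorem pderiv_prodMk (hab : a < b) {f : ℝ × ℝ × ℝ → A} {g : ℝ × ℝ × ℝ → B} {q : ℝ × ℝ × ℝ}
    (hq : q ∈ strip ε a b) (hf : ContDiffWithinAt ℝ ∞ f (strip ε a b) q)
    (hg : ContDiffWithinAt ℝ ∞ g (strip ε a b) q) (w : ℝ × ℝ × ℝ) :
    pderiv ε a b w (fun q => (f q, g q)) q = (pderiv ε a b w f q, pderiv ε a b w g q) := by
  rw [pderiv, ((hf.differentiableWithinAt (by simp)).hasFDerivWithinAt.prodMk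
    (hg.differentiableWithinAt (by simp)).hasFDerivWithinAt).fderivWithin
    (uniqueDiffOn_strip hab q hq)]
  rfl

/-- The mixed second derivative of a power of `2 e`. -/
theorem pderiv_pderiv_rpow (hab : a < b) {e : ℝ × ℝ × ℝ → ℝ} {q : ℝ × ℝ × ℝ} {v : ℝ} (hv : 0 < v)
    (hq : q ∈ strip ε a b) (he : ∀ᶠ q in 𝓝[strip ε a b] q, ContDiffWithinAt ℝ ∞ e (strip ε a b) q)
    (hev : 2 * e q = v ^ 2) (p : ℝ) (w w' : ℝ × ℝ × ℝ) :
    pderiv ε a b w (pderiv ε a b w' fun q => (2 * e q) ^ (p / 2)) q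
      = p * v ^ (p - 4) * (v ^ 2 * pderiv ε a b w (pderiv ε a b w' e) q
        + (p - 2) * pderiv ε a b w e q * pderiv ε a b w' e q) := by
  have hpos : 0 < e q := by nlinarith
  have h1 : ∀ᶠ x in 𝓝 (e q), 0 < x := lt_mem_nhds hpos
  have d1 : ∀ r : ℝ, ∀ x : ℝ, 0 < x →
      HasDerivAt (fun x : ℝ => (2 * x) ^ r) (2 * r * (2 * x) ^ (r - 1)) x := by
    intro r x hx
    have := ((hasDerivAt_id x).const_mul 2).rpow_const (p := r) (Or.inl (by simpa using hx.ne'))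
    refine this.congr_deriv ?_
    simp only [id]; ring
  have hs : ∀ x : ℝ, 0 < x → ContDiffAt ℝ ∞ (fun x : ℝ => (2 * x) ^ (p / 2)) x := fun x hx =>
    (contDiffAt_const.mul contDiffAt_id).rpow_const_of_ne (by simpa using hx.ne')
  have d2 : fderiv ℝ (fun x : ℝ => (2 * x) ^ (p / 2)) =ᶠ[𝓝 (e q)]
      fun x => ContinuousLinearMap.toSpanSingleton ℝ (2 * (p / 2) * (2 * x) ^ (p / 2 - 1)) := by
    filter_upwards [h1] with x hx
    exact (d1 _ x hx).hasFDerivAt.fderiv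
  have d3 : ∀ y z : ℝ, fderiv ℝ (fderiv ℝ fun x : ℝ => (2 * x) ^ (p / 2)) (e q) y z
      = 2 * (p / 2) * (2 * (p / 2 - 1) * (2 * e q) ^ (p / 2 - 1 - 1)) * y * z := by
    intro y z
    have h2 := ((d1 (p / 2 - 1) _ hpos).const_mul (2 * (p / 2))).hasFDerivAt
    have h3 := ((contDiffAt_fderiv_top (hs _ hpos)).differentiableAt (by simp)).hasFDerivAt.clm_apply
      (hasFDerivAt_const z (e q))
    have h4 : (fun x => fderiv ℝ (fun x : ℝ => (2 * x) ^ (p / 2)) x z) =ᶠ[𝓝 (e q)]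
        fun x => z * (2 * (p / 2) * (2 * x) ^ (p / 2 - 1)) := by
      filter_upwards [d2] with x hx
      rw [hx]; simp
    have h5 := congrArg (fun L : ℝ →L[ℝ] ℝ => L y)
      (h3.unique ((h2.const_mul z).congr_of_eventuallyEq h4))
    simp only [ContinuousLinearMap.comp_zero, zero_add, ContinuousLinearMap.flip_apply,
      smul_apply, ContinuousLinearMap.toSpanSingleton_apply, smul_eq_mul] at h5
    rw [h5]; ring
  have he0 := he.self_of_nhdsWithin hq
  rw [pderiv_pderiv_comp (g := fun x : ℝ => (2 * x) ^ (p / 2)) (m := e) hab hq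
    ((he0.continuousWithinAt.eventually h1).mono fun q' h => hs _ h) he, d3, d2.self_of_nhds]
  simp only [ContinuousLinearMap.toSpanSingleton_apply, smul_eq_mul]
  have hv2 : ∀ r : ℝ, (2 * e q) ^ r = v ^ (2 * r) := by
    intro r
    rw [hev, ← Real.rpow_natCast v 2, ← Real.rpow_mul hv.le]; norm_num
  -- With 2e = v² the two powers are v^(p-2) and v^(p-4); writing the first as v^(p-4) v² produces
  -- the common factor.
  rw [hv2, hv2, show 2 * (p / 2 - 1 - 1) = p - 4 by ring,
    show v ^ (2 * (p / 2 - 1)) = v ^ (p - 4) * v ^ 2 by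
      rw [← Real.rpow_natCast v 2, ← Real.rpow_add hv]; congr 1; push_cast; ring]
  ring

end Strip

end FinslerPEnergy

namespace FinslerPEnergy

/-! ### The second variation of the Lagrangian -/

section SecondVariation

variable {n : ℕ} {M : Type*} [TopologicalSpace M] [ChartedSpace (EuclideanSpace ℝ (Fin n)) M]
  [IsManifold (𝓡 n) ∞ M]

local notation "𝔼" => EuclideanSpace ℝ (Fin n)

variable {F : TangentBundle (𝓡 n) M → ℝ} {ε a b : ℝ} {C : ℝ → ℝ → ℝ → M} {α : M}

/-- All curves of the family are regular on `[a, b]`. -/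
def RegularOnStrip (n : ℕ) {M : Type*} [TopologicalSpace M]
    [ChartedSpace (EuclideanSpace ℝ (Fin n)) M] (ε a b : ℝ) (C : ℝ → ℝ → ℝ → M) : Prop :=
  ∀ q ∈ strip ε a b, velocity (n := n) (C q.1 q.2.1) (Icc a b) q.2.2 ≠ 0

/-- Points and velocities of the curves of a family, in the chart around `α`. -/
noncomputable def lift (C : ℝ → ℝ → ℝ → M) (α : M) (ε a b : ℝ) (q : ℝ × ℝ × ℝ) : 𝔼 × 𝔼 :=
  (coord C α q, pderiv ε a b (0, 0, 1) (coord C α) q)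

/-- The integrand `F(ċ)^p` of the `p`-energy. -/
noncomputable def lagrangian (F : TangentBundle (𝓡 n) M → ℝ) (p : ℝ) (C : ℝ → ℝ → ℝ → M)
    (a b : ℝ) (q : ℝ × ℝ × ℝ) : ℝ :=
  (F ⟨C q.1 q.2.1 q.2.2, velocity (C q.1 q.2.1) (Icc a b) q.2.2⟩ ^ 2) ^ (p / 2)

theorem lift_mem (hC : SmoothOnStrip n ε a b C) (hr : RegularOnStrip n ε a b C) (hab : a < b)
    {q : ℝ × ℝ × ℝ} (hq : q ∈ strip ε a b) (hα : C q.1 q.2.1 q.2.2 ∈ (chartAt 𝔼 α).source) :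
    (lift (n := n) C α ε a b q).1 ∈ (extChartAt (𝓡 n) α).target ∧
      (lift (n := n) C α ε a b q).2 ≠ 0 := by
  refine ⟨(extChartAt (𝓡 n) α).map_source (by simpa using hα), ?_⟩
  have := comps_ne_zero hα (hr q hq)
  rwa [hC.comps_velocity hab hq hα] at this

theorem contDiffWithinAt_lift (hC : SmoothOnStrip n ε a b C) (hab : a < b)
    {q : ℝ × ℝ × ℝ} (hq : q ∈ strip ε a b) (hα : C q.1 q.2.1 q.2.2 ∈ (chartAt 𝔼 α).source) :
    ContDiffWithinAt ℝ ∞ (lift (n := n) C α ε a b) (strip ε a b) q :=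
  (hC.coord hq hα).prodMk (contDiffWithinAt_pderiv hab (hC.coord hq hα) hq _)

theorem energy_lift (hC : SmoothOnStrip n ε a b C) (hab : a < b)
    {q : ℝ × ℝ × ℝ} (hq : q ∈ strip ε a b) (hα : C q.1 q.2.1 q.2.2 ∈ (chartAt 𝔼 α).source) :
    2 * energy (localF F α) (lift C α ε a b q)
      = F ⟨C q.1 q.2.1 q.2.2, velocity (C q.1 q.2.1) (Icc a b) q.2.2⟩ ^ 2 := by
  rw [← localF_apply F hα, hC.comps_velocity hab hq hα, energy]
  simp only [lift, coord]
  ring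

theorem lagrangian_eq (hC : SmoothOnStrip n ε a b C) (hab : a < b) (p : ℝ)
    {q : ℝ × ℝ × ℝ} (hq : q ∈ strip ε a b) (hα : C q.1 q.2.1 q.2.2 ∈ (chartAt 𝔼 α).source) :
    lagrangian F p C a b q = (2 * energy (localF F α) (lift C α ε a b q)) ^ (p / 2) := by
  rw [energy_lift hC hab hq hα, lagrangian]

theorem contDiffWithinAt_energy_lift (hF : IsFinsler F) (hC : SmoothOnStrip n ε a b C)
    (hr : RegularOnStrip n ε a b C) (hab : a < b) {q : ℝ × ℝ × ℝ} (hq : q ∈ strip ε a b)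
    (hα : C q.1 q.2.1 q.2.2 ∈ (chartAt 𝔼 α).source) :
    ContDiffWithinAt ℝ ∞ (fun q => energy (localF F α) (lift C α ε a b q)) (strip ε a b) q :=
  have hm := lift_mem hC hr hab hq hα
  ((hF.localFinsler α).smooth_energy _ hm.1 hm.2).comp_contDiffWithinAt q
    (contDiffWithinAt_lift hC hab hq hα)

/-- F is smooth only off the zero section and a real power only off zero; regularity of the curves
secures both. -/
theorem contDiffOn_lagrangian (hF : IsFinsler F) (hC : SmoothOnStrip n ε a b C)
    (hr : RegularOnStrip n ε a b C) (hab : a < b) (p : ℝ) :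
    ContDiffOn ℝ ∞ (lagrangian F p C a b) (strip ε a b) := by
  intro q hq
  have hα := mem_chart_source 𝔼 (C q.1 q.2.1 q.2.2)
  have h1 : lagrangian F p C a b =ᶠ[𝓝[strip ε a b] q] fun q' =>
      (2 * energy (localF F (C q.1 q.2.1 q.2.2)) (lift C (C q.1 q.2.1 q.2.2) ε a b q')) ^ (p / 2) :=
    (hC.eventually hq hα).mono fun q' h => lagrangian_eq hC hab p h.1 h.2
  refine ContDiffWithinAt.congr_of_eventuallyEq ?_ h1 (h1.self_of_nhdsWithin hq)
  refine (contDiffWithinAt_const.mul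
    (contDiffWithinAt_energy_lift hF hC hr hab hq hα)).rpow_const_of_ne ?_
  rw [energy_lift hC hab hq hα]
  exact (pow_pos (hF.pos _ _ (hr q hq)) 2).ne'

theorem coord_chartChange (hC : SmoothOnStrip n ε a b C) {β : M} {q : ℝ × ℝ × ℝ}
    (hq : q ∈ strip ε a b) (hα : C q.1 q.2.1 q.2.2 ∈ (chartAt 𝔼 α).source) :
    coord (n := n) C β =ᶠ[𝓝[strip ε a b] q] fun q => chartChange n α β (coord C α q) :=
  (hC.eventually hq hα).mono fun _ h => (chartChange_apply β h.2).symm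

/-- For w and w' in the two parameter directions this is the inhomogeneous law of Z that
`change_boundaryTerm` expects. -/
theorem pderiv_coord_chartChange (hC : SmoothOnStrip n ε a b C) (hab : a < b) {β : M}
    {q : ℝ × ℝ × ℝ} (hq : q ∈ strip ε a b) (hα : C q.1 q.2.1 q.2.2 ∈ (chartAt 𝔼 α).source)
    (hβ : C q.1 q.2.1 q.2.2 ∈ (chartAt 𝔼 β).source) (w w' : ℝ × ℝ × ℝ) :
    pderiv ε a b w (pderiv ε a b w' (coord (n := n) C β)) q
      = fderiv ℝ (chartChange n α β) (coord C α q) (pderiv ε a b w (pderiv ε a b w' (coord C α)) q)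
        + fderiv ℝ (fderiv ℝ (chartChange n α β)) (coord C α q)
          (pderiv ε a b w (coord C α) q) (pderiv ε a b w' (coord C α) q) := by
  have e1 : pderiv ε a b w' (coord (n := n) C β) =ᶠ[𝓝[strip ε a b] q]
      pderiv ε a b w' fun q => chartChange n α β (coord C α q) :=
    (hC.eventually hq hα).mono fun q' h => pderiv_congr h.1 (coord_chartChange hC h.1 h.2) w'
  have hcont := (hC.coord hq hα).continuousWithinAt
  rw [pderiv_congr hq e1, pderiv_pderiv_comp hab hq
    (hcont.eventually (eventually_contDiffAt_chartChange hα hβ))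
    ((hC.eventually hq hα).mono fun q' h => hC.coord h.1 h.2), add_comm]

/-- The parameters range over open intervals, so derivatives within the strip are ordinary ones and
do not depend on the piece [a, b]. This makes `variationBoundary` the same function on adjacent
pieces. -/
theorem deriv_deriv_coord (hC : SmoothOnStrip n ε a b C) (hε : 0 < ε) (hab : a < b) {t : ℝ}
    (ht : t ∈ Icc a b) (hα : C 0 0 t ∈ (chartAt 𝔼 α).source) :
    deriv (fun s => deriv (fun r => coord (n := n) C α (s, r, t)) 0) 0
      = pderiv ε a b (1, 0, 0) (pderiv ε a b (0, 1, 0) (coord C α)) (0, 0, t) := by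
  have hq := zero_mem_strip hε ht
  have h1 : (fun s => deriv (fun r => coord (n := n) C α (s, r, t)) 0) =ᶠ[𝓝 0]
      fun s => pderiv ε a b (0, 1, 0) (coord C α) (s, 0, t) := by
    filter_upwards [(tendsto_slice_fst hε ht).eventually (hC.eventually hq hα)] with s hs
    exact (hasDerivAt_snd (hC.coord hs.1 hs.2) hs.1).deriv
  rw [h1.deriv_eq]
  exact (hasDerivAt_fst (contDiffWithinAt_pderiv hab (hC.coord hq hα) hq _) hq).deriv

/-- The boundary function of the second variation of the energy of a geodesic. -/
noncomputable def variationBoundary (F : TangentBundle (𝓡 n) M → ℝ) (C : ℝ → ℝ → ℝ → M)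
    (t : ℝ) : ℝ :=
  boundaryTerm (energy (localF F (C 0 0 t))) (spray (localF F (C 0 0 t)))
    (phase (C 0 0) (C 0 0 t) t) (comps (C 0 0 t) (C 0 0 t) (fieldX C t))
    (comps (C 0 0 t) (C 0 0 t) (fieldY C t))
    (deriv (fun s => deriv (fun r => coord C (C 0 0 t) (s, r, t)) 0) 0)

/-- `variationBoundary` is evaluated in the chart around the point itself. By `change_boundaryTerm`
any chart containing the point gives the same value, so near a given t a fixed chart may be used and
the function differentiated. -/
theorem variationBoundary_eq (hF : IsFinsler F) (hgeo : IsGeodesic F (C 0 0))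
    (hC : SmoothOnStrip n ε a b C) (hε : 0 < ε) (hab : a < b) (hS : Icc a b ⊆ Icc 0 1) {t : ℝ}
    (ht : t ∈ Icc a b) (hα : C 0 0 t ∈ (chartAt 𝔼 α).source) :
    variationBoundary F C t = boundaryTerm (energy (localF F α)) (spray (localF F α))
      (phase (C 0 0) α t) (pderiv ε a b (1, 0, 0) (coord C α) (0, 0, t))
      (pderiv ε a b (0, 1, 0) (coord C α) (0, 0, t))
      (pderiv ε a b (1, 0, 0) (pderiv ε a b (0, 1, 0) (coord C α)) (0, 0, t)) := by
  have hs := mem_chart_source 𝔼 (C 0 0 t)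
  have hq := zero_mem_strip hε ht
  have hr := hgeo.regular t (hS ht)
  have hp := phase_mem hα hr
  have hp' := phase_mem hs hr
  rw [phase_chartChange hα hs] at hp'
  have key := SprayData.change_boundaryTerm (hF.localFinsler α).sprayData
    (hF.localFinsler (C 0 0 t)).sprayData hp.1 hp.2 (eventually_contDiffAt_chartChange hα hs)
    hp'.1 (bijective_fderiv_chartChange hα hs) (energy_chartChange F hα hs)
    (comps α (C 0 0 t) (fieldX C t)) (comps α (C 0 0 t) (fieldY C t))
    (pderiv ε a b (1, 0, 0) (pderiv ε a b (0, 1, 0) (coord C α)) (0, 0, t))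
  rw [variationBoundary, deriv_deriv_coord hC hε hab ht hs,
    pderiv_coord_chartChange hC hab hq hα hs, phase_chartChange hα hs, comps_chartChange hα hs,
    comps_chartChange hα hs (fieldY C t), ← hC.comps_fieldX hε ht hα, ← hC.comps_fieldY hε ht hα]
  exact key

theorem variationBoundary_eventuallyEq (hF : IsFinsler F) (hgeo : IsGeodesic F (C 0 0))
    (hC : SmoothOnStrip n ε a b C) (hε : 0 < ε) (hab : a < b) (hS : Icc a b ⊆ Icc 0 1) {t : ℝ}
    (ht : t ∈ Icc a b) (hα : C 0 0 t ∈ (chartAt 𝔼 α).source) :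
    variationBoundary F C =ᶠ[𝓝[Icc a b] t] fun t =>
      boundaryTerm (energy (localF F α)) (spray (localF F α))
      (phase (C 0 0) α t) (pderiv ε a b (1, 0, 0) (coord C α) (0, 0, t))
      (pderiv ε a b (0, 1, 0) (coord C α) (0, 0, t))
      (pderiv ε a b (1, 0, 0) (pderiv ε a b (0, 1, 0) (coord C α)) (0, 0, t)) := by
  filter_upwards [(tendsto_slice hε).eventually (hC.eventually (zero_mem_strip hε ht) hα)]
    with s hs
  exact variationBoundary_eq hF hgeo hC hε hab hS hs.1.2.2 hs.2

theorem contDiffOn_variationBoundary (hF : IsFinsler F) (hgeo : IsGeodesic F (C 0 0))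
    (hC : SmoothOnStrip n ε a b C) (hε : 0 < ε) (hab : a < b) (hS : Icc a b ⊆ Icc 0 1) :
    ContDiffOn ℝ ∞ (variationBoundary F C) (Icc a b) := by
  intro t ht
  have hs := mem_chart_source 𝔼 (C 0 0 t)
  have hq := zero_mem_strip hε ht
  have hp := phase_mem hs (hgeo.regular t (hS ht))
  have h := hF.localFinsler (C 0 0 t)
  have h1 := variationBoundary_eventuallyEq hF hgeo hC hε hab hS ht hs
  refine ContDiffWithinAt.congr_of_eventuallyEq ?_ h1 (h1.self_of_nhdsWithin ht)
  have hu := hC.coord hq hs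
  have hX := contDiffWithinAt_slice (contDiffWithinAt_pderiv hab hu hq (1, 0, 0)) hq
  have hY := contDiffWithinAt_slice (contDiffWithinAt_pderiv hab hu hq (0, 1, 0)) hq
  have hZ := contDiffWithinAt_slice (contDiffWithinAt_pderiv hab
    (contDiffWithinAt_pderiv hab hu hq (0, 1, 0)) hq (1, 0, 0)) hq
  have hγ := (contDiffWithinAt_phase hs hgeo.smooth (hS ht)).mono hS
  have k1 := (contDiffAt_fderiv_top (h.smooth_energy _ hp.1 hp.2)).comp_contDiffWithinAt t hγ
  have k2 := (contDiffAt_fderiv_top (contDiffAt_fderiv_top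
    (h.smooth_energy _ hp.1 hp.2))).comp_contDiffWithinAt t hγ
  have k3 := ((contDiffAt_fderiv_top (h.smooth_spray _ hp.1 hp.2)).comp_contDiffWithinAt t
    hγ).clm_apply (contDiffWithinAt_const (c := (0 : 𝔼)) |>.prodMk hX)
  exact (k1.clm_apply (contDiffWithinAt_const.prodMk hZ)).add
    ((k2.clm_apply (contDiffWithinAt_const.prodMk hY)).clm_apply
      (hX.prodMk (ContDiffWithinAt.const_smul _ k3).neg))

theorem lift_zero (hgeo : IsGeodesic F (C 0 0)) (hC : SmoothOnStrip n ε a b C) (hε : 0 < ε)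
    (hab : a < b) (hS : Icc a b ⊆ Icc 0 1) {t : ℝ} (ht : t ∈ Icc a b)
    (hα : C 0 0 t ∈ (chartAt 𝔼 α).source) :
    lift (n := n) C α ε a b (0, 0, t) = phase (C 0 0) α t := by
  have h1 := hC.comps_velocity hab (zero_mem_strip hε ht) hα
  change comps α (C 0 0 t) (velocity (C 0 0) (Icc a b) t) = _ at h1
  rw [hgeo.velocity_subset hS (uniqueDiffOn_Icc hab) ht] at h1
  exact Prod.ext rfl h1.symm

/-- Euler's identity for F² gives g(y, y) = F², which identifies the integrand of the energy with a
power of F. -/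
theorem gAlong_velocity (hF : IsFinsler F) {c : ℝ → M} {t : ℝ}
    (hr : velocity (n := n) c (Icc 0 1) t ≠ 0) :
    gAlong F c t (velocity c (Icc 0 1) t) (velocity c (Icc 0 1) t)
      = F ⟨c t, velocity c (Icc 0 1) t⟩ ^ 2 := by
  have hs := mem_chart_source 𝔼 (c t)
  have hp := phase_mem hs hr
  have h1 := (hF.localFinsler (c t)).sprayData.metric_self_self hp.1 hp.2
  rw [gAlong_eq_self hF hr]
  refine h1.trans ?_
  rw [← localF_apply F hs, energy]
  simp only [phase]
  ring

theorem derivWithin_comps_fieldX (hC : SmoothOnStrip n ε a b C) (hε : 0 < ε) (hab : a < b)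
    {t : ℝ} (ht : t ∈ Icc a b) (hα : C 0 0 t ∈ (chartAt 𝔼 α).source) :
    derivWithin (fun s => comps (n := n) α (C 0 0 s) (fieldX C s)) (Icc a b) t
      = pderiv ε a b (0, 0, 1) (pderiv ε a b (1, 0, 0) (coord C α)) (0, 0, t) := by
  have hq := zero_mem_strip hε ht
  have h1 : (fun s => comps (n := n) α (C 0 0 s) (fieldX C s)) =ᶠ[𝓝[Icc a b] t]
      fun s => pderiv ε a b (1, 0, 0) (coord C α) (0, 0, s) := by
    filter_upwards [(tendsto_slice hε).eventually (hC.eventually hq hα)] with s hs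
    exact hC.comps_fieldX hε hs.1.2.2 hs.2
  rw [h1.derivWithin_eq (h1.self_of_nhdsWithin ht)]
  exact (hasDerivWithinAt_thd (contDiffWithinAt_pderiv hab (hC.coord hq hα) hq _)
    hq).derivWithin (uniqueDiffOn_Icc hab t ht)

theorem derivWithin_comps_fieldY (hC : SmoothOnStrip n ε a b C) (hε : 0 < ε) (hab : a < b)
    {t : ℝ} (ht : t ∈ Icc a b) (hα : C 0 0 t ∈ (chartAt 𝔼 α).source) :
    derivWithin (fun s => comps (n := n) α (C 0 0 s) (fieldY C s)) (Icc a b) t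
      = pderiv ε a b (0, 0, 1) (pderiv ε a b (0, 1, 0) (coord C α)) (0, 0, t) := by
  have hq := zero_mem_strip hε ht
  have h1 : (fun s => comps (n := n) α (C 0 0 s) (fieldY C s)) =ᶠ[𝓝[Icc a b] t]
      fun s => pderiv ε a b (0, 1, 0) (coord C α) (0, 0, s) := by
    filter_upwards [(tendsto_slice hε).eventually (hC.eventually hq hα)] with s hs
    exact hC.comps_fieldY hε hs.1.2.2 hs.2
  rw [h1.derivWithin_eq (h1.self_of_nhdsWithin ht)]
  exact (hasDerivWithinAt_thd (contDiffWithinAt_pderiv hab (hC.coord hq hα) hq _)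
    hq).derivWithin (uniqueDiffOn_Icc hab t ht)

/-- The second variation of the Lagrangian along a geodesic. -/
theorem hasDerivAt_variationBoundary (hF : IsFinsler F) (hgeo : IsGeodesic F (C 0 0))
    (hC : SmoothOnStrip n ε a b C) (hr : RegularOnStrip n ε a b C) (hε : 0 < ε) (hab : a < b)
    (hS : Icc a b ⊆ Icc 0 1) {v : ℝ} (hv : 0 < v) (p : ℝ) {t : ℝ} (ht : t ∈ Ioo a b)
    (hsp : gAlong F (C 0 0) t (velocity (C 0 0) (Icc 0 1) t) (velocity (C 0 0) (Icc 0 1) t)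
      = v ^ 2) :
    HasDerivAt (fun t => p * v ^ (p - 4) * (v ^ 2 * variationBoundary F C t))
      (pderiv ε a b (1, 0, 0) (pderiv ε a b (0, 1, 0) (lagrangian F p C a b)) (0, 0, t)
        - p * v ^ (p - 4) * indexIntegrand F p v (C 0 0) (fieldX C) (fieldY C) t) t := by
  have ht' := Ioo_subset_Icc_self ht
  have hs := mem_chart_source 𝔼 (C 0 0 t)
  have hq := zero_mem_strip hε ht'
  have hreg := hgeo.regular t (hS ht')
  have hp := phase_mem hs hreg
  have h := (hF.localFinsler (C 0 0 t)).sprayData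
  have hu := hC.coord hq hs
  have hl := lift_zero hgeo hC hε hab hS ht' hs
  have hX := contDiffWithinAt_pderiv hab hu hq (1, 0, 0)
  have hY := contDiffWithinAt_pderiv hab hu hq (0, 1, 0)
  have hZ := contDiffWithinAt_pderiv hab hY hq (1, 0, 0)
  have hSu : UniqueDiffOn ℝ (Icc a b) := uniqueDiffOn_Icc hab
  have d1 := h.hasDerivWithinAt_boundaryTerm hp.1 hp.2
    ((hgeo.hasDerivWithinAt_phase hF (hS ht')).mono hS)
    (hasDerivWithinAt_thd hX hq) (hasDerivWithinAt_thd hY hq) (hasDerivWithinAt_thd hZ hq)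
  have e1 := variationBoundary_eventuallyEq hF hgeo hC hε hab hS ht' hs
  have d2 := ((d1.congr_of_eventuallyEq e1 (e1.self_of_nhdsWithin ht')).hasDerivAt
    (Icc_mem_nhds ht.1 ht.2)).const_mul (v ^ 2) |>.const_mul (p * v ^ (p - 4))
  refine d2.congr_deriv ?_
  have ev : lagrangian F p C a b =ᶠ[𝓝[strip ε a b] (0, 0, t)] fun q' =>
      (2 * energy (localF F (C 0 0 t)) (lift C (C 0 0 t) ε a b q')) ^ (p / 2) :=
    (hC.eventually hq hs).mono fun q' h => lagrangian_eq hC hab p h.1 h.2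
  have ev2 : pderiv ε a b (0, 1, 0) (lagrangian F p C a b) =ᶠ[𝓝[strip ε a b] (0, 0, t)]
      pderiv ε a b (0, 1, 0) fun q' =>
        (2 * energy (localF F (C 0 0 t)) (lift C (C 0 0 t) ε a b q')) ^ (p / 2) :=
    (eventually_eventually_nhdsWithin.2 ev |>.and self_mem_nhdsWithin).mono fun q' h =>
      pderiv_congr h.2 h.1 _
  have hm : ∀ᶠ q in 𝓝[strip ε a b] (0, 0, t),
      ContDiffWithinAt ℝ ∞ (lift (n := n) C (C 0 0 t) ε a b) (strip ε a b) q :=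
    (hC.eventually hq hs).mono fun q' h => contDiffWithinAt_lift hC hab h.1 h.2
  have he : ∀ᶠ q in 𝓝[strip ε a b] (0, 0, t),
      ContDiffAt ℝ ∞ (energy (localF F (C 0 0 t))) (lift (n := n) C (C 0 0 t) ε a b q) :=
    (hC.eventually hq hs).mono fun q' h => by
      have hm := lift_mem hC hr hab h.1 h.2
      exact (hF.localFinsler (C 0 0 t)).smooth_energy _ hm.1 hm.2
  have h2e : 2 * energy (localF F (C 0 0 t)) (lift (n := n) C (C 0 0 t) ε a b (0, 0, t))
      = v ^ 2 := by
    rw [hl, ← hsp, gAlong_eq_self hF hreg]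
    exact (h.metric_self_self hp.1 hp.2).symm
  have hp3 := fun w => pderiv_prodMk hab hq hu (contDiffWithinAt_pderiv hab hu hq (0, 0, 1)) w
  -- Commuting ∂/∂t past the parameter derivatives exhibits the derivatives of the lifted family as
  -- (X, X'), (Y, Y') and, just below, (Z, Z').
  have hlift : ∀ w, pderiv ε a b w (lift (n := n) C (C 0 0 t) ε a b) (0, 0, t)
      = (pderiv ε a b w (coord C (C 0 0 t)) (0, 0, t),
        pderiv ε a b (0, 0, 1) (pderiv ε a b w (coord C (C 0 0 t))) (0, 0, t)) := fun w =>
    (hp3 w).trans (by rw [pderiv_comm hab hu hq])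
  have hlift2 : pderiv ε a b (1, 0, 0) (pderiv ε a b (0, 1, 0) (lift (n := n) C (C 0 0 t) ε a b))
      (0, 0, t) = (pderiv ε a b (1, 0, 0) (pderiv ε a b (0, 1, 0) (coord C (C 0 0 t))) (0, 0, t),
        pderiv ε a b (0, 0, 1) (pderiv ε a b (1, 0, 0) (pderiv ε a b (0, 1, 0)
          (coord C (C 0 0 t)))) (0, 0, t)) := by
    have ev3 : pderiv ε a b (0, 1, 0) (lift (n := n) C (C 0 0 t) ε a b)
        =ᶠ[𝓝[strip ε a b] (0, 0, t)] fun q => (pderiv ε a b (0, 1, 0) (coord C (C 0 0 t)) q,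
          pderiv ε a b (0, 0, 1) (pderiv ε a b (0, 1, 0) (coord C (C 0 0 t))) q) := by
      filter_upwards [hC.eventually hq hs] with q hh
      have hu' := hC.coord hh.1 hh.2
      rw [pderiv_comm hab hu' hh.1]
      exact pderiv_prodMk hab hh.1 hu' (contDiffWithinAt_pderiv hab hu' hh.1 (0, 0, 1)) _
    rw [pderiv_congr hq ev3, pderiv_prodMk hab hq hY (contDiffWithinAt_pderiv hab hY hq _),
      pderiv_comm hab hY hq]
  have hec : ∀ᶠ q in 𝓝[strip ε a b] (0, 0, t), ContDiffWithinAt ℝ ∞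
      (fun q => energy (localF F (C 0 0 t)) (lift C (C 0 0 t) ε a b q)) (strip ε a b) q :=
    (hC.eventually hq hs).mono fun q' h => contDiffWithinAt_energy_lift hF hC hr hab h.1 h.2
  rw [pderiv_congr hq ev2, pderiv_pderiv_rpow hab hv hq hec h2e, pderiv_pderiv_comp hab hq he hm,
    pderiv_comp hab hq (he.self_of_nhdsWithin hq) (hm.self_of_nhdsWithin hq),
    pderiv_comp hab hq (he.self_of_nhdsWithin hq) (hm.self_of_nhdsWithin hq), hlift2, hlift, hlift,
    hl, indexIntegrand, R2form_symm hF hreg, R2form, nabla_eq_covDeriv hS ht,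
    nabla_eq_covDeriv hS ht, R2_eq_R2nonlin hF hreg]
  simp only [gAlong_eq_self hF hreg]
  rw [comps_R2nonlin hF hreg, hgeo.comps_covDeriv_self hF hS hSu ht',
    hgeo.comps_covDeriv_self hF hS hSu ht', hC.comps_fieldX hε ht' hs, hC.comps_fieldY hε ht' hs]
  have y1 : derivWithin (fun s => comps (n := n) (C 0 0 t) (C 0 0 s) (fieldX C s)) (Icc a b) t
      = pderiv ε a b (0, 0, 1) (pderiv ε a b (1, 0, 0) (coord C (C 0 0 t))) (0, 0, t) :=
    derivWithin_comps_fieldX hC hε hab ht' hs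
  have y2 : derivWithin (fun s => comps (n := n) (C 0 0 t) (C 0 0 s) (fieldY C s)) (Icc a b) t
      = pderiv ε a b (0, 0, 1) (pderiv ε a b (0, 1, 0) (coord C (C 0 0 t))) (0, 0, t) :=
    derivWithin_comps_fieldY hC hε hab ht' hs
  rw [y1, y2]
  -- The first derivative of e along (X, X') is g(ċ, ∇X), since e has zero horizontal derivative;
  -- this yields the (p-2)-term.
  have x2 : ∀ w w' : 𝔼, metric (energy (localF F (C 0 0 t))) (phase (C 0 0) (C 0 0 t) t)
      (comps (C 0 0 t) (C 0 0 t) (velocity (C 0 0) (Icc 0 1) t))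
      (w' + conn (spray (localF F (C 0 0 t))) (phase (C 0 0) (C 0 0 t) t) w)
      = fderiv ℝ (energy (localF F (C 0 0 t))) (phase (C 0 0) (C 0 0 t) t) (w, w') := by
    intro w w'
    have z1 := h.metric_self hp.1 hp.2 (w' + conn (spray (localF F (C 0 0 t)))
      (phase (C 0 0) (C 0 0 t) t) w)
    have z2 := h.metric_self hp.1 hp.2 (conn (spray (localF F (C 0 0 t)))
      (phase (C 0 0) (C 0 0 t) t) w)
    have z3 := h.metric_self_conn hp.1 hp.2 w
    refine z1.trans ?_
    rw [clm_zero_add, ← z2, z3, clm_prod_split _ w w', add_comm]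
  rw [x2, x2]
  ring

end SecondVariation

end FinslerPEnergy

namespace FinslerPEnergy

/-! ### The second variation formulas -/

/-- On the open interval f' coincides with the one-sided derivative of f, which is continuous up to
the end points. Integrability follows without any assumption on the values of f' at a and b. -/
theorem integral_of_contDiffOn {a b : ℝ} (hab : a < b) {f f' : ℝ → ℝ}
    (hf : ContDiffOn ℝ ∞ f (Icc a b)) (hd : ∀ t ∈ Ioo a b, HasDerivAt f (f' t) t) :
    IntervalIntegrable f' volume a b ∧ ∫ t in a..b, f' t = f b - f a := by
  have h1 : ContinuousOn (derivWithin f (Icc a b)) (Icc a b) := fun t ht =>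
    (contDiffWithinAt_derivWithin (hf t ht) (uniqueDiffOn_Icc hab) ht).continuousWithinAt
  have h2 : IntervalIntegrable f' volume a b := by
    refine (h1.intervalIntegrable_of_Icc hab.le).congr_uIoo fun t ht => ?_
    rw [uIoo_of_le hab.le] at ht
    exact (hd t ht).hasDerivWithinAt.derivWithin
      (uniqueDiffOn_Icc hab t (Ioo_subset_Icc_self ht))
  exact ⟨h2, intervalIntegral.integral_eq_sub_of_hasDerivAt_of_le hab.le hf.continuousOn hd h2⟩

section Formulas

variable {n : ℕ} {M : Type*} [TopologicalSpace M] [ChartedSpace (EuclideanSpace ℝ (Fin n)) M]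
  [IsManifold (𝓡 n) ∞ M]

local notation "𝔼" => EuclideanSpace ℝ (Fin n)

variable {F : TangentBundle (𝓡 n) M → ℝ} {ε : ℝ} {C : ℝ → ℝ → ℝ → M} {x₀ x₁ : M} {P : Finset ℝ}

/-- Regularity of a single curve is known on its own pieces. Such a piece inside [a, b] contains the
given parameter, and there the velocity agrees with that on [a, b] because the curve is smooth on
all of [a, b]. -/
theorem IsVariation.regularOnStrip (hC : IsVariation n x₀ x₁ ε P C) {a b : ℝ}
    (h : IsPiece P a b) : RegularOnStrip n ε a b C := by
  intro q hq
  obtain ⟨-, -, P', hP'⟩ := hC.mem q.1 hq.1 q.2.1 hq.2.1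
  obtain ⟨a', b', h1, h2, h3⟩ := exists_piece P' h.1 h.2.1 h.2.2.1 hq.2.2
  have h4 := (hP' a' b' h1).2 _ h3
  rwa [velocity_subset h2 (uniqueDiffOn_Icc h1.2.1) h3
    (((hC.smoothOnStrip h).curve hq.1 hq.2.1 _ hq.2.2).mdifferentiableWithinAt (by simp))] at h4

/-- The integrand of the `p`-energy of a family of curves. -/
noncomputable def energyDensity (F : TangentBundle (𝓡 n) M → ℝ) (p : ℝ) (C : ℝ → ℝ → ℝ → M)
    (s r t : ℝ) : ℝ :=
  gAlong F (C s r) t (velocity (C s r) (Icc 0 1) t) (velocity (C s r) (Icc 0 1) t) ^ (p / 2)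

/-- Restricted to the open interval: at a break point the derivative within [0,1] may fail to exist,
which is harmless for the integral. -/
theorem energyDensity_eq (hF : IsFinsler F) {a b : ℝ} (hr : RegularOnStrip n ε a b C) (p : ℝ)
    (hS : Icc a b ⊆ Icc 0 1) {s r t : ℝ} (hs : s ∈ Ioo (-ε) ε) (hr' : r ∈ Ioo (-ε) ε)
    (ht : t ∈ Ioo a b) : energyDensity F p C s r t = lagrangian F p C a b (s, r, t) := by
  have h1 : velocity (n := n) (C s r) (Icc 0 1) t = velocity (C s r) (Icc a b) t := by
    rw [velocity, velocity, mfderivWithin_congr_set (Icc_eventuallyEq_unit hS ht)]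
  have h2 : velocity (n := n) (C s r) (Icc 0 1) t ≠ 0 := by
    rw [h1]; exact hr (s, r, t) ⟨hs, hr', Ioo_subset_Icc_self ht⟩
  rw [energyDensity, gAlong_velocity hF h2, h1, lagrangian]

/-- All curves share their end points, so X, Y and the mixed second derivative Z vanish there. -/
theorem IsVariation.variationBoundary_zero (hC : IsVariation n x₀ x₁ ε P C) :
    variationBoundary F C 0 = 0 ∧ variationBoundary F C 1 = 0 := by
  have key : ∀ t x, (∀ s ∈ Ioo (-ε) ε, ∀ r ∈ Ioo (-ε) ε, C s r t = x) → fieldX (n := n) C t = 0 →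
      fieldY (n := n) C t = 0 → variationBoundary F C t = 0 := by
    intro t x h1 h2 h3
    have h4 : (fun s => deriv (fun r => coord (n := n) C (C 0 0 t) (s, r, t)) 0) =ᶠ[𝓝 0]
        fun _ => 0 := by
      filter_upwards [hC.eventually_mem] with s hs
      have : (fun r => coord (n := n) C (C 0 0 t) (s, r, t)) =ᶠ[𝓝 0]
          fun _ => extChartAt (𝓡 n) (C 0 0 t) x := by
        filter_upwards [hC.eventually_mem] with r hr
        rw [coord, h1 s hs r hr]
      rw [this.deriv_eq, deriv_const]
    rw [variationBoundary, h2, h3, comps_zero, h4.deriv_eq, deriv_const, boundaryTerm]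
    simp only [Prod.mk_zero_zero, map_zero, zero_apply, add_zero]
  exact ⟨key 0 x₀ (fun s hs r hr => (hC.mem s hs r hr).1) hC.fieldX_mem.1 hC.fieldY_mem.1,
    key 1 x₁ (fun s hs r hr => (hC.mem s hs r hr).2.1) hC.fieldX_mem.2.1 hC.fieldY_mem.2.1⟩

/-- The second variation of the `p`-energy of a geodesic on an interval. -/
theorem IsVariation.secondVariation (hF : IsFinsler F) (hC : IsVariation n x₀ x₁ ε P C)
    (hgeo : IsGeodesic F (C 0 0)) {p v : ℝ} (hp : p ≠ 0) (hv : 0 < v)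
    (hsp : ∀ t ∈ Icc (0 : ℝ) 1, gAlong F (C 0 0) t (velocity (C 0 0) (Icc 0 1) t)
      (velocity (C 0 0) (Icc 0 1) t) = v ^ 2) {a b : ℝ} (ha : 0 ≤ a) (hab : a < b) (hb : b ≤ 1) :
    IntervalIntegrable (indexIntegrand F p v (C 0 0) (fieldX C) (fieldY C)) volume a b ∧
    (∀ s ∈ Ioo (-ε) ε, ∀ r ∈ Ioo (-ε) ε,
      IntervalIntegrable (energyDensity F p C s r) volume a b) ∧
    ∃ D : ℝ → ℝ, (∀ s ∈ Ioo (-ε) ε,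
        HasDerivAt (fun r => ∫ t in a..b, energyDensity F p C s r t) (D s) 0) ∧
      HasDerivAt D (p * v ^ (p - 4) *
        ((∫ t in a..b, indexIntegrand F p v (C 0 0) (fieldX C) (fieldY C) t)
          + (v ^ 2 * variationBoundary F C b - v ^ 2 * variationBoundary F C a))) 0 := by
  refine piece_induction (P := P) (Q := fun a b =>
    IntervalIntegrable (indexIntegrand F p v (C 0 0) (fieldX C) (fieldY C)) volume a b ∧
    (∀ s ∈ Ioo (-ε) ε, ∀ r ∈ Ioo (-ε) ε,
      IntervalIntegrable (energyDensity F p C s r) volume a b) ∧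
    ∃ D : ℝ → ℝ, (∀ s ∈ Ioo (-ε) ε,
        HasDerivAt (fun r => ∫ t in a..b, energyDensity F p C s r t) (D s) 0) ∧
      HasDerivAt D (p * v ^ (p - 4) *
        ((∫ t in a..b, indexIntegrand F p v (C 0 0) (fieldX C) (fieldY C) t)
          + (v ^ 2 * variationBoundary F C b - v ^ 2 * variationBoundary F C a))) 0)
    ?_ ?_ ha hab hb
  · intro a b h
    have hε := hC.eps_pos
    have h0 := hC.eventually_mem.self_of_nhds
    have hab := h.2.1
    have hS := hC.smoothOnStrip h
    have hr := hC.regularOnStrip h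
    have hsub := h.subset
    have hΛ := contDiffOn_lagrangian hF hS hr hab p
    have hK : p * v ^ (p - 4) ≠ 0 := mul_ne_zero hp (Real.rpow_pos_of_pos hv _).ne'
    have hΛ2 := contDiffOn_pderiv hab hΛ (0, 1, 0)
    have i1 : IntervalIntegrable (fun t => pderiv ε a b (1, 0, 0)
        (pderiv ε a b (0, 1, 0) (lagrangian F p C a b)) (0, 0, t)) volume a b :=
      (continuousOn_slice (contDiffOn_pderiv hab hΛ2 (1, 0, 0)) h0
        h0).intervalIntegrable_of_Icc hab.le
    obtain ⟨i2, i3⟩ := integral_of_contDiffOn hab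
      (contDiffOn_const.mul (contDiffOn_const.mul
        (contDiffOn_variationBoundary hF hgeo hS hε hab hsub)))
      fun t ht => hasDerivAt_variationBoundary hF hgeo hS hr hε hab hsub hv p ht
        (hsp t (hsub (Ioo_subset_Icc_self ht)))
    -- The index integrand is recovered as a multiple of the difference of two integrable functions,
    -- which requires p v^(p-4) to be nonzero.
    have i4 : IntervalIntegrable (indexIntegrand F p v (C 0 0) (fieldX C) (fieldY C))
        volume a b := by
      refine ((i1.sub i2).const_mul (p * v ^ (p - 4))⁻¹).congr fun t _ => ?_
      simp only [sub_sub_cancel]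
      rw [inv_mul_cancel_left₀ hK]
    refine ⟨i4, fun s hs r hr' => ?_, fun s => ∫ t in a..b,
      pderiv ε a b (0, 1, 0) (lagrangian F p C a b) (s, 0, t), fun s hs => ?_, ?_⟩
    · refine ((continuousOn_slice hΛ hs hr').intervalIntegrable_of_Icc hab.le).congr_uIoo
        fun t ht => ?_
      rw [uIoo_of_le hab.le] at ht
      exact (energyDensity_eq hF hr p hsub hs hr' ht).symm
    · refine (hasDerivAt_integral_snd hε hab hΛ hs).congr_of_eventuallyEq ?_
      filter_upwards [hC.eventually_mem] with r hr'
      exact intervalIntegral.integral_congr_Ioo_of_le hab.le fun t ht =>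
        energyDensity_eq hF hr p hsub hs hr' ht
    · refine (hasDerivAt_integral_fst hε hab hΛ2).congr_deriv ?_
      rw [intervalIntegral.integral_sub i1 (i4.const_mul _),
        intervalIntegral.integral_const_mul] at i3
      linarith
  · rintro a b c _ _ _ _ _ ⟨i1, i2, D, d1, d2⟩ ⟨j1, j2, D', e1, e2⟩
    have h0 := hC.eventually_mem.self_of_nhds
    refine ⟨i1.trans j1, fun s hs r hr => (i2 s hs r hr).trans (j2 s hs r hr), D + D',
      fun s hs => ?_, ?_⟩
    · refine ((d1 s hs).add (e1 s hs)).congr_of_eventuallyEq ?_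
      filter_upwards [hC.eventually_mem] with r hr
      exact (intervalIntegral.integral_add_adjacent_intervals (i2 s hs r hr) (j2 s hs r hr)).symm
    -- The boundary values at the common point b cancel, since `variationBoundary` has no jump.
    · refine (d2.add e2).congr_deriv ?_
      rw [← intervalIntegral.integral_add_adjacent_intervals i1 j1]
      ring

theorem gAlong_weighted_sub (p v : ℝ) (c : ℝ → M) (t : ℝ) (U A B : TangentSpace (𝓡 n) (c t)) :
    gAlong F c t U (weighted F p v c t (A - B))
      = gAlong F c t U (weighted F p v c t A) - gAlong F c t U (weighted F p v c t B) := by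
  have h1 := gAlong_add_right (F := F) c t U (A - B) B
  have h2 := gAlong_add_left (F := F) c t (A - B) B (velocity c (Icc 0 1) t)
  rw [sub_add_cancel] at h1 h2
  rw [gAlong_weighted, gAlong_weighted, gAlong_weighted, h1, h2]
  ring

/-- Integration by parts along a piecewise smooth vector field. -/
theorem IsGeodesic.integral_jacobi_add_index (hF : IsFinsler F) {c : ℝ → M}
    (hc : IsGeodesic F c) (p v : ℝ) {X Y : ∀ t : ℝ, TangentSpace (𝓡 n) (c t)}
    (hX : ∀ a b, IsPiece P a b → IsSmoothField c (Icc a b) X)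
    (hY : ∀ a b, IsPiece P a b → IsSmoothField c (Icc a b) Y) {a b : ℝ} (ha : 0 ≤ a) (hab : a < b)
    (hb : b ≤ 1) :
    IntervalIntegrable (fun t => jacobiIntegrand F p v c X Y t + indexIntegrand F p v c X Y t)
      volume a b ∧
    ∫ t in a..b, (jacobiIntegrand F p v c X Y t + indexIntegrand F p v c X Y t)
      = momentum F p v c (Icc 0 b) X Y b - momentum F p v c (Icc a 1) X Y a
        - ∑ t ∈ P with t ∈ Ioo a b, gAlong F c t (Y t) (weighted F p v c t (jumpNabla F c X t)) := by
  refine piece_induction (P := P) (Q := fun a b =>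
    IntervalIntegrable (fun t => jacobiIntegrand F p v c X Y t + indexIntegrand F p v c X Y t)
      volume a b ∧
    ∫ t in a..b, (jacobiIntegrand F p v c X Y t + indexIntegrand F p v c X Y t)
      = momentum F p v c (Icc 0 b) X Y b - momentum F p v c (Icc a 1) X Y a
        - ∑ t ∈ P with t ∈ Ioo a b, gAlong F c t (Y t) (weighted F p v c t (jumpNabla F c X t)))
    ?_ ?_ ha hab hb
  · intro a b h
    have hab := h.2.1
    obtain ⟨i1, i2⟩ := integral_of_contDiffOn hab
      (hc.contDiffOn_momentum hF p v h.subset (uniqueDiffOn_Icc hab) (hX a b h) (hY a b h))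
      fun t ht => hc.hasDerivAt_momentum hF p v h.subset ht (hX a b h) (hY a b h)
    refine ⟨i1, i2.trans ?_⟩
    -- Near b the piece is indistinguishable from [0, b], and near a from [a, 1]. The boundary
    -- values thus refer to the one-sided derivatives used in `jumpNabla`.
    have e1 : Icc a b =ᶠ[𝓝 b] Icc 0 b := by
      filter_upwards [lt_mem_nhds hab] with t ht
      exact propext ⟨fun hh => ⟨h.1.trans hh.1, hh.2⟩, fun hh => ⟨ht.le, hh.2⟩⟩
    have e2 : Icc a b =ᶠ[𝓝 a] Icc a 1 := by
      filter_upwards [gt_mem_nhds hab] with t ht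
      exact propext ⟨fun hh => ⟨hh.1, hh.2.trans h.2.2.1⟩, fun hh => ⟨hh.1, ht.le⟩⟩
    rw [Finset.filter_false_of_mem h.2.2.2, Finset.sum_empty, sub_zero]
    simp only [momentum]
    rw [covDeriv_congr_set e1, covDeriv_congr_set e2]
  · rintro a b d _ hab hbd _ hbP ⟨i1, i2⟩ ⟨j1, j2⟩
    refine ⟨i1.trans j1, ?_⟩
    have hP : P.filter (· ∈ Ioo a d)
        = insert b (P.filter (· ∈ Ioo a b) ∪ P.filter (· ∈ Ioo b d)) := by
      ext t
      simp only [Finset.mem_filter, Finset.mem_insert, Finset.mem_union, mem_Ioo]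
      constructor
      · rintro ⟨h1, h2, h3⟩
        rcases lt_trichotomy t b with h | h | h
        · exact Or.inr (Or.inl ⟨h1, h2, h⟩)
        · exact Or.inl h
        · exact Or.inr (Or.inr ⟨h1, h, h3⟩)
      · rintro (h | ⟨h1, h2, h3⟩ | ⟨h1, h2, h3⟩)
        · exact h ▸ ⟨hbP, hab, hbd⟩
        · exact ⟨h1, h2, h3.trans hbd⟩
        · exact ⟨h1, hab.trans h2, h3⟩
    have hd : Disjoint (P.filter (· ∈ Ioo a b)) (P.filter (· ∈ Ioo b d)) := by
      refine Finset.disjoint_left.2 fun t h1 h2 => ?_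
      exact lt_asymm (Finset.mem_filter.1 h1).2.2 (Finset.mem_filter.1 h2).2.1
    have hb : b ∉ P.filter (· ∈ Ioo a b) ∪ P.filter (· ∈ Ioo b d) := by
      simp
    -- At b the left and right values of `momentum` do not cancel; their difference is the new
    -- summand, by linearity of the weighted pairing.
    rw [← intervalIntegral.integral_add_adjacent_intervals i1 j1, i2, j2, hP,
      Finset.sum_insert hb, Finset.sum_union hd, jumpNabla, gAlong_weighted_sub]
    simp only [momentum]
    ring

end Formulas

end FinslerPEnergy

/-! ### Assembly of the two formulas -/

theorem mainTheorem2 {n : ℕ} {M : Type*} [TopologicalSpace M]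
    [ChartedSpace (EuclideanSpace ℝ (Fin n)) M] [IsManifold (𝓡 n) ∞ M]
    (F : TangentBundle (𝓡 n) M → ℝ) (hF : FinslerPEnergy.IsFinsler F)
    (p : ℝ) (hp : p ≠ 0) (x₀ x₁ : M) (ε : ℝ) (P : Finset ℝ) (C : ℝ → ℝ → ℝ → M)
    (hC : FinslerPEnergy.IsVariation n x₀ x₁ ε P C)
    (hgeo : FinslerPEnergy.IsGeodesic F (C 0 0)) (v : ℝ)
    (hv : ∀ t ∈ Icc (0 : ℝ) 1,
      √(FinslerPEnergy.gAlong F (C 0 0) t (FinslerPEnergy.velocity (C 0 0) (Icc 0 1) t)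
        (FinslerPEnergy.velocity (C 0 0) (Icc 0 1) t)) = v) :
    -- the variation fields belong to the tangent space of the path space
    FinslerPEnergy.fieldX C ∈ FinslerPEnergy.TangentPathSpace n (C 0 0) ∧
    FinslerPEnergy.fieldY C ∈ FinslerPEnergy.TangentPathSpace n (C 0 0) ∧
    -- the two expressions of the curvature term agree
    (∀ t ∈ Icc (0 : ℝ) 1, ∀ W : TangentSpace (𝓡 n) (C 0 0 t),
      FinslerPEnergy.R2 F (C 0 0) t W = FinslerPEnergy.R2nonlin F (C 0 0) t W) ∧
    -- the second variation formula with the jump terms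
    IntervalIntegrable (FinslerPEnergy.jacobiIntegrand F p v (C 0 0)
      (FinslerPEnergy.fieldX C) (FinslerPEnergy.fieldY C)) volume 0 1 ∧
    FinslerPEnergy.HasMixedPartialAtZero (fun s₁ s₂ => FinslerPEnergy.pEnergy F p (C s₁ s₂))
      (p * v ^ (p - 4) *
        (-(∑ t ∈ P, FinslerPEnergy.gAlong F (C 0 0) t (FinslerPEnergy.fieldY C t)
            (FinslerPEnergy.weighted F p v (C 0 0) t
              (FinslerPEnergy.jumpNabla F (C 0 0) (FinslerPEnergy.fieldX C) t)))
          - ∫ t in (0 : ℝ)..1, FinslerPEnergy.jacobiIntegrand F p v (C 0 0)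
              (FinslerPEnergy.fieldX C) (FinslerPEnergy.fieldY C) t)) ∧
    -- the formula after integration by parts
    IntervalIntegrable (FinslerPEnergy.indexIntegrand F p v (C 0 0)
      (FinslerPEnergy.fieldX C) (FinslerPEnergy.fieldY C)) volume 0 1 ∧
    FinslerPEnergy.HasMixedPartialAtZero (fun s₁ s₂ => FinslerPEnergy.pEnergy F p (C s₁ s₂))
      (FinslerPEnergy.indexForm F p v (C 0 0)
        (FinslerPEnergy.fieldX C) (FinslerPEnergy.fieldY C)) ∧
    -- symmetry of the curvature term and of the form
    (∀ t ∈ Icc (0 : ℝ) 1, ∀ U W : TangentSpace (𝓡 n) (C 0 0 t),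
      FinslerPEnergy.R2form F (C 0 0) t U W = FinslerPEnergy.R2form F (C 0 0) t W U) ∧
    (∀ X ∈ FinslerPEnergy.TangentPathSpace n (C 0 0),
      ∀ Y ∈ FinslerPEnergy.TangentPathSpace n (C 0 0),
      FinslerPEnergy.indexForm F p v (C 0 0) X Y = FinslerPEnergy.indexForm F p v (C 0 0) Y X) := by
  have hreg := hgeo.regular
  have h01 : (0 : ℝ) ∈ Icc (0 : ℝ) 1 := left_mem_Icc.2 zero_le_one
  -- The speed is positive because the geodesic is regular at t = 0.
  have hv0 : 0 < v := by
    rw [← hv 0 h01, FinslerPEnergy.gAlong_velocity hF (hreg 0 h01)]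
    exact Real.sqrt_pos.2 (pow_pos (hF.pos _ _ (hreg 0 h01)) 2)
  have hsp : ∀ t ∈ Icc (0 : ℝ) 1, FinslerPEnergy.gAlong F (C 0 0) t
      (FinslerPEnergy.velocity (C 0 0) (Icc 0 1) t)
      (FinslerPEnergy.velocity (C 0 0) (Icc 0 1) t) = v ^ 2 := by
    intro t ht
    rw [← hv t ht, Real.sq_sqrt]
    rw [FinslerPEnergy.gAlong_velocity hF (hreg t ht)]
    positivity
  obtain ⟨i1, -, D, d1, d2⟩ := hC.secondVariation hF hgeo hp hv0 hsp le_rfl zero_lt_one le_rfl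
  obtain ⟨i2, i3⟩ := hgeo.integral_jacobi_add_index hF p v (P := P)
    (fun a b h => (hC.smoothOnStrip h).isSmoothField_fieldX hC.eps_pos h.2.1)
    (fun a b h => (hC.smoothOnStrip h).isSmoothField_fieldY hC.eps_pos h.2.1)
    le_rfl zero_lt_one le_rfl
  have hX := hC.fieldX_mem
  have hY := hC.fieldY_mem
  have i4 : IntervalIntegrable (FinslerPEnergy.jacobiIntegrand F p v (C 0 0)
      (FinslerPEnergy.fieldX C) (FinslerPEnergy.fieldY C)) volume 0 1 :=
    (i2.sub i1).congr fun t _ => add_sub_cancel_right _ _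
  -- Over all of [0,1] the boundary values disappear because Y vanishes at both ends, and every
  -- break point is interior and hence counted.
  rw [intervalIntegral.integral_add i4 i1, Finset.filter_true_of_mem hC.breaks,
    FinslerPEnergy.momentum, FinslerPEnergy.momentum, hY.1, hY.2.1,
    FinslerPEnergy.gAlong_zero_left, FinslerPEnergy.gAlong_zero_left] at i3
  rw [hC.variationBoundary_zero.1, hC.variationBoundary_zero.2] at d2
  have main : FinslerPEnergy.HasMixedPartialAtZero
      (fun s₁ s₂ => FinslerPEnergy.pEnergy F p (C s₁ s₂))
      (FinslerPEnergy.indexForm F p v (C 0 0)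
        (FinslerPEnergy.fieldX C) (FinslerPEnergy.fieldY C)) := by
    refine ⟨D, hC.eventually_mem.mono d1, d2.congr_deriv ?_⟩
    rw [FinslerPEnergy.indexForm]
    ring
  refine ⟨hX, hY, fun t ht W => FinslerPEnergy.R2_eq_R2nonlin hF (hreg t ht) W, i4, ?_, i1, main,
    fun t ht U W => FinslerPEnergy.R2form_symm hF (hreg t ht) U W,
    fun X _ Y _ => hgeo.indexForm_symm hF p v X Y⟩
  -- The version with jumps is the index form with its integral replaced by the integration by parts
  -- in `i3`.
  convert main using 1
  rw [FinslerPEnergy.indexForm]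
  congr 1
  linarith
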